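/- **Conventions.** A $2$-category is strict, and it is locally small if its hom-categories are small. $2$-functors and $2$-natural transformations are strict. A functor $p\colon E\to B$ is a *discrete fibration* if for all $e\in E$ and all $\gamma\colon b\to p(e)$ in $B$ there is a unique map $\gamma'$ of $E$ with codomain $e$ such that $p(\gamma')=\gamma$. A $1$-cell $f$ of a $2$-category $\mathcal K$ is a *discrete fibration* if every functor $\mathcal K(X,f)$ is one. A $2$-functor $F\colon\mathcal C\to\mathcal K$ is a *local discrete fibration* if every functor $\mathcal C(x,y)\to\mathcal K(Fx,Fy)$ is a discrete fibration. A *$2$-equivalence* between $2$-categories consists of $2$-functors in both directions whose composites are isomorphic to the identities by invertible $2$-natural transformations. **The base $\mathbb P\mathcal K$.** Let $\mathcal K$ be a locally small $2$-category. Let $\mathcal P\mathcal K$ be the bicategory with the objects of $\mathcal K$, with hom-categories $\mathcal P\mathcal K(A,B)=[\mathcal K(A,B)^{\mathrm{op}},\mathbf{Set}]$, with identities the representables on identity $1$-cells, and with composition given by Day convolution, the composite of $U\in\mathcal P\mathcal K(A,B)$ and $V\in\mathcal P\mathcal K(B,C)$ being $h\mapsto\int^{f,g}\mathcal K(A,C)(h,gf)\times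 Uf\times Vg$. Let $\mathcal Y\colon\mathcal K\to\mathcal P\mathcal K$ be the homomorphism of bicategories that is the identity on objects and the Yoneda embedding on hom-categories. The weak double category $\mathbb P\mathcal K$ has as objects those of $\mathcal K$; as vertical morphisms $A\to B$ the discrete fibrations $B\to A$ in $\mathcal K$; as horizontal morphisms $A\to C$ the presheaves on $\mathcal K(A,C)$; and as cells from $U\colon A\to C$ to $V\colon B\to D$, with vertical boundaries $f\colon A\to B$ and $g\colon C\to D$, the $2$-cells $U\circ\mathcal Yf\Rightarrow\mathcal Yg\circ V$ of $\mathcal P\mathcal K$. Vertical morphisms compose as in $\mathcal K$, horizontal ones as in $\mathcal P\mathcal K$, and cells by pasting in $\mathcal P\mathcal K$. **Enrichment.** For a weak double category $\mathbb W$, a *$\mathbb W$-category* $\mathcal C$ is a category enriched in the underlying bicategory of $\mathbb W$ (objects, horizontal morphisms, and the cells with identity vertical boundaries): a collection of objects $x$ with extents $|x|\in\mathbb W$, horizontal morphisms $\mathcal C(x,y)\colon|x|\to|y|$, and unit and composition cells satisfying the unit and associativity axioms. A *$\mathbb W$-functor* $H\colon\mathcal C\to\mathcal D$ consists of a function $H$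 on objects, vertical morphisms $H_x\colon|x|\to|Hx|$, and cells $H_{x,y}$ from $\mathcal C(x,y)$ to $\mathcal D(Hx,Hy)$ with vertical boundaries $H_x$ and $H_y$, compatible with units and composition. A *$\mathbb W$-natural transformation* $\alpha\colon H\Rightarrow K$ consists of cells $\alpha_x$ from the horizontal identity $1_{|x|}$ to $\mathcal D(Hx,Kx)$ with vertical boundaries $H_x$ and $K_x$, such that for all $x,y$ the cells from $\mathcal C(x,y)$ to $\mathcal D(Hx,Ky)$ obtained by composing $\alpha_x$ with $K_{x,y}$, respectively $H_{x,y}$ with $\alpha_y$, agree. These form a $2$-category $\mathbb W\text{-}\mathbf{Cat}$. **Proposition.** Let $\mathcal K$ be a locally small $2$-category. Then $\mathbb P\mathcal K\text{-}\mathbf{Cat}$ is $2$-equivalent to the $2$-category in which - objects are local discrete fibrations $F\colon\mathcal C\to\mathcal K$ with $\mathcal C$ a locally small $2$-category; - morphisms from $F\colon\mathcal C\to\mathcal K$ to $G\colon\mathcal D\to\mathcal K$ are pairs $(H,\gamma)$ of a $2$-functor $H\colon\mathcal C\to\mathcal D$ and a $2$-natural transformation $\gamma\colon GH\Rightarrow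 F$ all of whose components are discrete fibrations in $\mathcal K$, and the composite of $(H,\gamma)$ with $(H',\gamma')$ is $(H'H,\ \gamma\cdot\gamma'H)$; - $2$-cells $(H,\gamma)\Rightarrow(H',\gamma')$ are $2$-natural transformations $\theta\colon H\Rightarrow H'$ with $\gamma'\cdot G\theta=\gamma$. (The objects of a $\mathbb P\mathcal K$-category and those of the total $2$-category $\mathcal C$ range over the same universe of sets, which is arbitrary.) -/

import Mathlib

namespace GenWood

open CategoryTheory Bicategory Opposite

universe w v u u₁ u₂ h c w' v' u' w₁ v₁ w₂ v₂ w₃ v₃ u₃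

section Day

theorem map_op_congr {C : Type u} [Category.{v} C] (P : Cᵒᵖ ⥤ Type w) {f g : C} {φ ψ : f ⟶ g}
    (h : φ = ψ) (x : P.obj (op g)) : P.map φ.op x = P.map ψ.op x := by rw [h]

variable {K : Type u} [Bicategory.{w, w} K]

/-- Representatives of elements of the coend
`∫^{f, g} K(A, C)(h, f ≫ g) × U f × V g`. -/
structure DayPre {A B C : K} (U : (A ⟶ B)ᵒᵖ ⥤ Type w) (V : (B ⟶ C)ᵒᵖ ⥤ Type w)
    (h : A ⟶ C) : Type w where
  fst : A ⟶ B
  snd : B ⟶ C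
  arr : h ⟶ fst ≫ snd
  left : U.obj (op fst)
  right : V.obj (op snd)

/-- The dinaturality relation of the coend. -/
inductive DayRel {A B C : K} (U : (A ⟶ B)ᵒᵖ ⥤ Type w) (V : (B ⟶ C)ᵒᵖ ⥤ Type w)
    (h : A ⟶ C) : DayPre U V h → DayPre U V h → Prop
  | intro {f f' : A ⟶ B} {g g' : B ⟶ C} (a : f ⟶ f') (b : g ⟶ g') (φ : h ⟶ f ≫ g)
      (u : U.obj (op f')) (v : V.obj (op g')) :
      DayRel U V h ⟨f, g, φ, U.map a.op u, V.map b.op v⟩ ⟨f', g', φ ≫ a ▷ g ≫ f' ◁ b, u, v⟩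

/-- The value at `h` of the Day convolution: the coend
`∫^{f, g} K(A, C)(h, f ≫ g) × U f × V g`. -/
def DayEl {A B C : K} (U : (A ⟶ B)ᵒᵖ ⥤ Type w) (V : (B ⟶ C)ᵒᵖ ⥤ Type w) (h : A ⟶ C) : Type w :=
  Quot (DayRel U V h)

namespace DayEl
variable {A B C : K} {U : (A ⟶ B)ᵒᵖ ⥤ Type w} {V : (B ⟶ C)ᵒᵖ ⥤ Type w}

def mk {h : A ⟶ C} (f : A ⟶ B) (g : B ⟶ C) (φ : h ⟶ f ≫ g) (u : U.obj (op f))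
    (v : V.obj (op g)) : DayEl U V h :=
  Quot.mk _ ⟨f, g, φ, u, v⟩

theorem ind {h : A ⟶ C} {P : DayEl U V h → Prop}
    (H : ∀ f g φ u v, P (mk f g φ u v)) (x : DayEl U V h) : P x :=
  Quot.ind (fun ⟨f, g, φ, u, v⟩ => H f g φ u v) x

theorem sound {h : A ⟶ C} {f f' : A ⟶ B} {g g' : B ⟶ C} (a : f ⟶ f') (b : g ⟶ g')
    (φ : h ⟶ f ≫ g) (u : U.obj (op f')) (v : V.obj (op g')) :
    mk f g φ (U.map a.op u) (V.map b.op v) = mk f' g' (φ ≫ a ▷ g ≫ f' ◁ b) u v :=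
  Quot.sound (.intro a b φ u v)

theorem sound_left {h : A ⟶ C} {f f' : A ⟶ B} {g : B ⟶ C} (a : f ⟶ f')
    (φ : h ⟶ f ≫ g) (u : U.obj (op f')) (v : V.obj (op g)) :
    mk f g φ (U.map a.op u) v = mk f' g (φ ≫ a ▷ g) u v := by
  simpa using sound a (𝟙 g) φ u v

theorem sound_right {h : A ⟶ C} {f : A ⟶ B} {g g' : B ⟶ C} (b : g ⟶ g')
    (φ : h ⟶ f ≫ g) (u : U.obj (op f)) (v : V.obj (op g')) :
    mk f g φ u (V.map b.op v) = mk f g' (φ ≫ f ◁ b) u v := by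
  simpa using sound (𝟙 f) b φ u v

end DayEl

/-- Day convolution of presheaves on the hom-categories of `K`. -/
def day {A B C : K} (U : (A ⟶ B)ᵒᵖ ⥤ Type w) (V : (B ⟶ C)ᵒᵖ ⥤ Type w) :
    (A ⟶ C)ᵒᵖ ⥤ Type w where
  obj h := DayEl U V h.unop
  map {h h'} ψ := ↾(Quot.map (fun x => ⟨x.fst, x.snd, ψ.unop ≫ x.arr, x.left, x.right⟩) (by
    rintro _ _ ⟨a, b, φ, u, v⟩
    have := DayRel.intro (U := U) (V := V) a b (ψ.unop ≫ φ) u v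
    simpa using this))
  map_id h := by
    ext x
    induction x using DayEl.ind with | H f g φ u v
    change DayEl.mk f g (𝟙 _ ≫ φ) u v = DayEl.mk f g φ u v
    simp
  map_comp a b := by
    ext x
    induction x using DayEl.ind with | H f g φ u v
    change DayEl.mk f g ((b.unop ≫ a.unop) ≫ φ) u v = DayEl.mk f g (b.unop ≫ a.unop ≫ φ) u v
    simp

section
variable {A B C D : K} {U U' : (A ⟶ B)ᵒᵖ ⥤ Type w} {V V' : (B ⟶ C)ᵒᵖ ⥤ Type w}
  {W : (A ⟶ C)ᵒᵖ ⥤ Type w}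

@[simp]
theorem day_map_mk {h h' : (A ⟶ C)ᵒᵖ} (ψ : h ⟶ h') (f : A ⟶ B) (g : B ⟶ C) (φ : h.unop ⟶ f ≫ g)
    (u : U.obj (op f)) (v : V.obj (op g)) :
    (day U V).map ψ (DayEl.mk f g φ u v) = DayEl.mk f g (ψ.unop ≫ φ) u v := rfl

/-- The generating element of the Day convolution given by a pair of elements. -/
def pair {f : A ⟶ B} {g : B ⟶ C} (u : U.obj (op f)) (v : V.obj (op g)) :
    (day U V).obj (op (f ≫ g)) := DayEl.mk f g (𝟙 _) u v

theorem mk_eq_map_pair {h : A ⟶ C} (f : A ⟶ B) (g : B ⟶ C) (φ : h ⟶ f ≫ g) (u : U.obj (op f))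
    (v : V.obj (op g)) : DayEl.mk f g φ u v = (day U V).map φ.op (pair u v) := by
  rw [pair, day_map_mk]; simp

theorem day_ind {h : (A ⟶ C)ᵒᵖ} {P : (day U V).obj h → Prop}
    (H : ∀ (f : A ⟶ B) (g : B ⟶ C) (φ : h.unop ⟶ f ≫ g) (u : U.obj (op f)) (v : V.obj (op g)),
      P ((day U V).map φ.op (pair u v))) (x : (day U V).obj h) : P x :=
  DayEl.ind (P := P) (fun f g φ u v => by
    have := H f g φ u v
    rwa [← mk_eq_map_pair] at this) x

theorem pair_map {f f' : A ⟶ B} {g g' : B ⟶ C} (a : f ⟶ f') (b : g ⟶ g')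
    (u : U.obj (op f')) (v : V.obj (op g')) :
    pair (U.map a.op u) (V.map b.op v) = (day U V).map (a ▷ g ≫ f' ◁ b).op (pair u v) := by
  rw [pair, DayEl.sound, pair, day_map_mk]; simp; rfl

theorem pair_map_left {f f' : A ⟶ B} {g : B ⟶ C} (a : f ⟶ f')
    (u : U.obj (op f')) (v : V.obj (op g)) :
    pair (U.map a.op u) v = (day U V).map (a ▷ g).op (pair u v) := by
  simpa using pair_map a (𝟙 g) u v

theorem pair_map_right {f : A ⟶ B} {g g' : B ⟶ C} (b : g ⟶ g')
    (u : U.obj (op f)) (v : V.obj (op g')) :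
    pair u (V.map b.op v) = (day U V).map (f ◁ b).op (pair u v) := by
  simpa using pair_map (𝟙 f) b u v

/-- A family of functions `U f × V g → W (f ≫ g)`, natural in `f` and `g`, induces a map out
of the Day convolution. -/
def dayDesc (η : ∀ (f : A ⟶ B) (g : B ⟶ C), U.obj (op f) → V.obj (op g) → W.obj (op (f ≫ g)))
    (nat : ∀ {f f' : A ⟶ B} {g g' : B ⟶ C} (a : f ⟶ f') (b : g ⟶ g') (u : U.obj (op f'))
      (v : V.obj (op g')), η f g (U.map a.op u) (V.map b.op v) =
        W.map (a ▷ g ≫ f' ◁ b).op (η f' g' u v)) : day U V ⟶ W where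
  app h := ↾(Quot.lift (fun x => W.map x.arr.op (η x.fst x.snd x.left x.right)) (by
    rintro _ _ ⟨a, b, φ, u, v⟩
    simp [nat]))
  naturality h h' ψ := by
    ext x
    induction x using DayEl.ind with | H f g φ u v
    change W.map (ψ.unop ≫ φ).op (η f g u v) = W.map ψ (W.map φ.op (η f g u v))
    simp

@[simp]
theorem dayDesc_pair (η : ∀ (f : A ⟶ B) (g : B ⟶ C), U.obj (op f) → V.obj (op g) →
    W.obj (op (f ≫ g))) (nat) {f : A ⟶ B} {g : B ⟶ C} (u : U.obj (op f)) (v : V.obj (op g)) :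
    (dayDesc (U := U) (V := V) η nat).app (op (f ≫ g)) (pair u v) = η f g u v := by
  change W.map (𝟙 _) (η f g u v) = _
  simp

theorem day_hom_ext {α β : day U V ⟶ W}
    (H : ∀ (f : A ⟶ B) (g : B ⟶ C) (u : U.obj (op f)) (v : V.obj (op g)),
      α.app (op (f ≫ g)) (pair u v) = β.app (op (f ≫ g)) (pair u v)) : α = β := by
  ext h x
  induction x using day_ind with | H f g φ u v
  change α.app h _ = β.app h _
  rw [NatTrans.naturality_apply, NatTrans.naturality_apply, H]

theorem day_hom_ext₃ {X : (C ⟶ D)ᵒᵖ ⥤ Type w} {W : (A ⟶ D)ᵒᵖ ⥤ Type w}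
    {α β : day (day U V) X ⟶ W}
    (H : ∀ (f : A ⟶ B) (g : B ⟶ C) (h : C ⟶ D) (u : U.obj (op f)) (v : V.obj (op g))
      (x : X.obj (op h)),
      α.app (op ((f ≫ g) ≫ h)) (pair (pair u v) x) =
        β.app (op ((f ≫ g) ≫ h)) (pair (pair u v) x)) : α = β := by
  apply day_hom_ext
  intro p h y x
  induction y using day_ind with | H f g φ u v
  rw [pair_map_left, NatTrans.naturality_apply, NatTrans.naturality_apply, H]

/-- Functoriality of Day convolution. -/
def dayMap (α : U ⟶ U') (β : V ⟶ V') : day U V ⟶ day U' V' :=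
  dayDesc (fun f g u v => pair (α.app _ u) (β.app _ v)) (by
    intro f f' g g' a b u v
    rw [NatTrans.naturality_apply, NatTrans.naturality_apply, pair_map])

@[simp]
theorem dayMap_pair (α : U ⟶ U') (β : V ⟶ V') {f : A ⟶ B} {g : B ⟶ C} (u : U.obj (op f))
    (v : V.obj (op g)) :
    (dayMap α β).app (op (f ≫ g)) (pair u v) = pair (α.app _ u) (β.app _ v) :=
  dayDesc_pair _ _ _ _

theorem dayMap_id : dayMap (𝟙 U) (𝟙 V) = 𝟙 (day U V) :=
  day_hom_ext fun f g u v => by rw [dayMap_pair]; rfl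

theorem dayMap_comp {U'' : (A ⟶ B)ᵒᵖ ⥤ Type w} {V'' : (B ⟶ C)ᵒᵖ ⥤ Type w} (α : U ⟶ U')
    (β : V ⟶ V') (α' : U' ⟶ U'') (β' : V' ⟶ V'') :
    dayMap (α ≫ α') (β ≫ β') = dayMap α β ≫ dayMap α' β' :=
  day_hom_ext fun f g u v => by simp

end

section
variable {A B C D E : K} (U : (A ⟶ B)ᵒᵖ ⥤ Type w) (V : (B ⟶ C)ᵒᵖ ⥤ Type w)
  (X : (C ⟶ D)ᵒᵖ ⥤ Type w) (Z : (D ⟶ E)ᵒᵖ ⥤ Type w)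

def dayAssocFun {p : A ⟶ C} {h : C ⟶ D} (y : (day U V).obj (op p)) (x : X.obj (op h)) :
    (day U (day V X)).obj (op (p ≫ h)) :=
  Quot.lift (fun y : DayPre U V p => (day U (day V X)).map (y.arr ▷ h ≫ (α_ y.fst y.snd h).hom).op
    (pair y.left (pair y.right x))) (by
    rintro _ _ ⟨a, b, φ, u, v⟩
    dsimp only
    rw [pair_map_left, pair_map_left, pair_map_right, ← Functor.map_comp_apply,
      ← Functor.map_comp_apply, ← op_comp, ← op_comp]
    refine map_op_congr _ ?_ _
    simp) y

theorem dayAssocFun_map_pair {p : A ⟶ C} {f : A ⟶ B} {g : B ⟶ C} {h : C ⟶ D} (φ : p ⟶ f ≫ g)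
    (u : U.obj (op f)) (v : V.obj (op g)) (x : X.obj (op h)) :
    dayAssocFun U V X ((day U V).map φ.op (pair u v)) x =
      (day U (day V X)).map (φ ▷ h ≫ (α_ f g h).hom).op (pair u (pair v x)) := by
  rw [← mk_eq_map_pair]; rfl

def dayAssocHom : day (day U V) X ⟶ day U (day V X) :=
  dayDesc (fun p h y x => dayAssocFun U V X y x) (by
    intro p p' h h' a b y x
    induction y using day_ind with | H f g φ u v
    rw [← Functor.map_comp_apply, ← op_comp, dayAssocFun_map_pair,
      dayAssocFun_map_pair, pair_map_right, pair_map_right, ← Functor.map_comp_apply,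
      ← Functor.map_comp_apply, ← op_comp, ← op_comp]
    refine map_op_congr _ ?_ _
    simp [whisker_exchange_assoc])

@[simp]
theorem dayAssocHom_pair {f : A ⟶ B} {g : B ⟶ C} {h : C ⟶ D} (u : U.obj (op f)) (v : V.obj (op g))
    (x : X.obj (op h)) : (dayAssocHom U V X).app (op ((f ≫ g) ≫ h)) (pair (pair u v) x) =
      (day U (day V X)).map (α_ f g h).hom.op (pair u (pair v x)) := by
  rw [dayAssocHom, dayDesc_pair]
  simpa using dayAssocFun_map_pair U V X (𝟙 (f ≫ g)) u v x

def dayAssocInvFun {f : A ⟶ B} {q : B ⟶ D} (u : U.obj (op f)) (y : (day V X).obj (op q)) :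
    (day (day U V) X).obj (op (f ≫ q)) :=
  Quot.lift (fun y : DayPre V X q =>
    (day (day U V) X).map (f ◁ y.arr ≫ (α_ f y.fst y.snd).inv).op
      (pair (pair u y.left) y.right)) (by
    rintro _ _ ⟨a, b, φ, u, v⟩
    dsimp only
    rw [pair_map_right, pair_map_right, pair_map_left, ← Functor.map_comp_apply,
      ← Functor.map_comp_apply, ← op_comp, ← op_comp]
    refine map_op_congr _ ?_ _
    simp only [whisker_assoc, whiskerLeft_comp, comp_whiskerLeft, Category.assoc,
      Iso.inv_hom_id_assoc]
    rw [← whiskerLeft_comp_assoc f (_ ◁ b), whisker_exchange]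
    simp) y

theorem dayAssocInvFun_map_pair {q : B ⟶ D} {f : A ⟶ B} {g : B ⟶ C} {h : C ⟶ D} (φ : q ⟶ g ≫ h)
    (u : U.obj (op f)) (v : V.obj (op g)) (x : X.obj (op h)) :
    dayAssocInvFun U V X u ((day V X).map φ.op (pair v x)) =
      (day (day U V) X).map (f ◁ φ ≫ (α_ f g h).inv).op (pair (pair u v) x) := by
  rw [← mk_eq_map_pair]; rfl

def dayAssocInv : day U (day V X) ⟶ day (day U V) X :=
  dayDesc (fun f q u y => dayAssocInvFun U V X u y) (by
    intro f f' q q' a b u y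
    induction y using day_ind with | H g h φ v x
    rw [← Functor.map_comp_apply, ← op_comp, dayAssocInvFun_map_pair,
      dayAssocInvFun_map_pair, pair_map_left, pair_map_left, ← Functor.map_comp_apply,
      ← Functor.map_comp_apply, ← op_comp, ← op_comp]
    refine map_op_congr _ ?_ _
    simp [← whisker_exchange_assoc])

@[simp]
theorem dayAssocInv_pair {f : A ⟶ B} {g : B ⟶ C} {h : C ⟶ D} (u : U.obj (op f)) (v : V.obj (op g))
    (x : X.obj (op h)) : (dayAssocInv U V X).app (op (f ≫ g ≫ h)) (pair u (pair v x)) =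
      (day (day U V) X).map (α_ f g h).inv.op (pair (pair u v) x) := by
  rw [dayAssocInv, dayDesc_pair]
  simpa using dayAssocInvFun_map_pair U V X (𝟙 (g ≫ h)) u v x

variable {U V X} in
theorem day_hom_ext₃' {W : (A ⟶ D)ᵒᵖ ⥤ Type w}
    {α β : day U (day V X) ⟶ W}
    (H : ∀ (f : A ⟶ B) (g : B ⟶ C) (h : C ⟶ D) (u : U.obj (op f)) (v : V.obj (op g))
      (x : X.obj (op h)),
      α.app (op (f ≫ g ≫ h)) (pair u (pair v x)) =
        β.app (op (f ≫ g ≫ h)) (pair u (pair v x))) : α = β := by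
  apply day_hom_ext
  intro f q u y
  induction y using day_ind with | H g h φ v x
  rw [pair_map_right, NatTrans.naturality_apply, NatTrans.naturality_apply, H]

variable {U V X Z} in
theorem day_hom_ext₄ {W : (A ⟶ E)ᵒᵖ ⥤ Type w}
    {α β : day (day (day U V) X) Z ⟶ W}
    (H : ∀ (f : A ⟶ B) (g : B ⟶ C) (h : C ⟶ D) (k : D ⟶ E) (u : U.obj (op f)) (v : V.obj (op g))
      (x : X.obj (op h)) (z : Z.obj (op k)),
      α.app (op (((f ≫ g) ≫ h) ≫ k)) (pair (pair (pair u v) x) z) =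
        β.app (op (((f ≫ g) ≫ h) ≫ k)) (pair (pair (pair u v) x) z)) : α = β := by
  apply day_hom_ext₃
  intro p h k y x z
  induction y using day_ind with | H f g φ u v
  rw [pair_map_left, pair_map_left, NatTrans.naturality_apply, NatTrans.naturality_apply, H]

/-- The associativity isomorphism of Day convolution. -/
def dayAssoc : day (day U V) X ≅ day U (day V X) where
  hom := dayAssocHom U V X
  inv := dayAssocInv U V X
  hom_inv_id := day_hom_ext₃ fun f g h u v x => by
    rw [NatTrans.comp_app_apply, dayAssocHom_pair, NatTrans.naturality_apply, dayAssocInv_pair,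
      ← Functor.map_comp_apply, ← op_comp]
    simp
  inv_hom_id := day_hom_ext₃' fun f g h u v x => by
    rw [NatTrans.comp_app_apply, dayAssocInv_pair, NatTrans.naturality_apply, dayAssocHom_pair,
      ← Functor.map_comp_apply, ← op_comp]
    simp

def dayLeftUnitorHom : day (yoneda.obj (𝟙 A)) U ⟶ U :=
  dayDesc (fun f g (a : f ⟶ 𝟙 A) u => U.map (a ▷ g ≫ (λ_ g).hom).op u) (by
    intro f f' g g' a b (x : f' ⟶ 𝟙 A) u
    change U.map ((a ≫ x) ▷ g ≫ (λ_ g).hom).op _ = _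
    rw [← Functor.map_comp_apply, ← Functor.map_comp_apply, ← op_comp, ← op_comp]
    refine map_op_congr _ ?_ _
    simp [whisker_exchange_assoc])

theorem dayLeftUnitorHom_pair {f : A ⟶ A} {g : A ⟶ B} (a : f ⟶ 𝟙 A) (u : U.obj (op g)) :
    (dayLeftUnitorHom U).app (op (f ≫ g)) (pair (U := yoneda.obj (𝟙 A)) a u) =
      U.map (a ▷ g ≫ (λ_ g).hom).op u :=
  dayDesc_pair _ _ _ _

def dayLeftUnitorInv : U ⟶ day (yoneda.obj (𝟙 A)) U where
  app g := ↾(fun u => (day (yoneda.obj (𝟙 A)) U).map (λ_ g.unop).inv.op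
    (pair (f := 𝟙 A) (𝟙 (𝟙 A)) u))
  naturality g g' b := by
    ext u
    change (day (yoneda.obj (𝟙 A)) U).map (λ_ g'.unop).inv.op
      (pair (U := yoneda.obj (𝟙 A)) (f := 𝟙 A) (𝟙 (𝟙 A)) (U.map b.unop.op u)) =
      (day (yoneda.obj (𝟙 A)) U).map b.unop.op ((day (yoneda.obj (𝟙 A)) U).map
        (λ_ g.unop).inv.op (pair (U := yoneda.obj (𝟙 A)) (f := 𝟙 A) (𝟙 (𝟙 A)) u))
    rw [pair_map_right, ← Functor.map_comp_apply, ← Functor.map_comp_apply, ← op_comp,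
      ← op_comp]
    refine map_op_congr (day (yoneda.obj (𝟙 A)) U) ?_ _
    simp

theorem dayLeftUnitorInv_apply {g : A ⟶ B} (u : U.obj (op g)) :
    (dayLeftUnitorInv U).app (op g) u = (day (yoneda.obj (𝟙 A)) U).map (λ_ g).inv.op
      (pair (U := yoneda.obj (𝟙 A)) (f := 𝟙 A) (𝟙 (𝟙 A)) u) := rfl

theorem yoneda_pair_left {f f' : A ⟶ B} {g : B ⟶ C} (a : f ⟶ f') (v : V.obj (op g)) :
    pair (U := yoneda.obj f') a v =
      (day (yoneda.obj f') V).map (a ▷ g).op (pair (U := yoneda.obj f') (f := f') (𝟙 f') v) := by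
  rw [← pair_map_left]; simp

theorem yoneda_pair_right {f : A ⟶ B} {g g' : B ⟶ C} (u : U.obj (op f)) (b : g ⟶ g') :
    pair (V := yoneda.obj g') u b =
      (day U (yoneda.obj g')).map (f ◁ b).op (pair (V := yoneda.obj g') (g := g') u (𝟙 g')) := by
  rw [← pair_map_right]; simp

/-- The left unit isomorphism of Day convolution. -/
def dayLeftUnitor : day (yoneda.obj (𝟙 A)) U ≅ U where
  hom := dayLeftUnitorHom U
  inv := dayLeftUnitorInv U
  hom_inv_id := day_hom_ext fun f g (a : f ⟶ 𝟙 A) u => by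
    rw [NatTrans.comp_app_apply, dayLeftUnitorHom_pair, dayLeftUnitorInv_apply,
      pair_map_right, NatTrans.id_app, types_id_apply, yoneda_pair_left U a u, ← Functor.map_comp_apply, ← op_comp]
    refine map_op_congr (day (yoneda.obj (𝟙 A)) U) ?_ _
    simp
  inv_hom_id := by
    ext g u
    change (dayLeftUnitorHom U).app (op g.unop) ((dayLeftUnitorInv U).app (op g.unop) u) = u
    rw [dayLeftUnitorInv_apply, NatTrans.naturality_apply, dayLeftUnitorHom_pair,
      ← Functor.map_comp_apply, ← op_comp]
    simp

def dayRightUnitorHom : day U (yoneda.obj (𝟙 B)) ⟶ U :=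
  dayDesc (fun f g u (a : g ⟶ 𝟙 B) => U.map (f ◁ a ≫ (ρ_ f).hom).op u) (by
    intro f f' g g' a b u (x : g' ⟶ 𝟙 B)
    change U.map (f ◁ (b ≫ x) ≫ (ρ_ f).hom).op _ = _
    rw [← Functor.map_comp_apply, ← Functor.map_comp_apply, ← op_comp, ← op_comp]
    refine map_op_congr _ ?_ _
    simp [← whisker_exchange_assoc])

theorem dayRightUnitorHom_pair {f : A ⟶ B} {g : B ⟶ B} (u : U.obj (op f)) (a : g ⟶ 𝟙 B) :
    (dayRightUnitorHom U).app (op (f ≫ g)) (pair (V := yoneda.obj (𝟙 B)) u a) =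
      U.map (f ◁ a ≫ (ρ_ f).hom).op u :=
  dayDesc_pair _ _ _ _

def dayRightUnitorInv : U ⟶ day U (yoneda.obj (𝟙 B)) where
  app g := ↾(fun u => (day U (yoneda.obj (𝟙 B))).map (ρ_ g.unop).inv.op
    (pair (g := 𝟙 B) u (𝟙 (𝟙 B))))
  naturality g g' b := by
    ext u
    change (day U (yoneda.obj (𝟙 B))).map (ρ_ g'.unop).inv.op
      (pair (V := yoneda.obj (𝟙 B)) (g := 𝟙 B) (U.map b.unop.op u) (𝟙 (𝟙 B))) =
      (day U (yoneda.obj (𝟙 B))).map b.unop.op ((day U (yoneda.obj (𝟙 B))).map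
        (ρ_ g.unop).inv.op (pair (V := yoneda.obj (𝟙 B)) (g := 𝟙 B) u (𝟙 (𝟙 B))))
    rw [pair_map_left, ← Functor.map_comp_apply, ← Functor.map_comp_apply, ← op_comp,
      ← op_comp]
    refine map_op_congr (day U (yoneda.obj (𝟙 B))) ?_ _
    simp

theorem dayRightUnitorInv_apply {g : A ⟶ B} (u : U.obj (op g)) :
    (dayRightUnitorInv U).app (op g) u = (day U (yoneda.obj (𝟙 B))).map (ρ_ g).inv.op
      (pair (V := yoneda.obj (𝟙 B)) (g := 𝟙 B) u (𝟙 (𝟙 B))) := rfl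

/-- The right unit isomorphism of Day convolution. -/
def dayRightUnitor : day U (yoneda.obj (𝟙 B)) ≅ U where
  hom := dayRightUnitorHom U
  inv := dayRightUnitorInv U
  hom_inv_id := day_hom_ext fun f g u (a : g ⟶ 𝟙 B) => by
    rw [NatTrans.comp_app_apply, dayRightUnitorHom_pair, dayRightUnitorInv_apply,
      pair_map_left, NatTrans.id_app, types_id_apply, yoneda_pair_right U u a, ← Functor.map_comp_apply, ← op_comp]
    refine map_op_congr (day U (yoneda.obj (𝟙 B))) ?_ _
    simp
  inv_hom_id := by
    ext g u
    change (dayRightUnitorHom U).app (op g.unop) ((dayRightUnitorInv U).app (op g.unop) u) = u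
    rw [dayRightUnitorInv_apply, NatTrans.naturality_apply, dayRightUnitorHom_pair,
      ← Functor.map_comp_apply, ← op_comp]
    simp

end
end Day

/-- The bicategory `𝒫K`: its objects are those of `K`, a `1`-cell `A ⟶ B` is a presheaf on
`K(A, B)`, a `2`-cell is a natural transformation; composition is Day convolution and the
identity at `A` is the presheaf represented by `𝟙 A`. -/
structure Psh (K : Type u) : Type u where
  of ::
  as : K

instance (K : Type u) [Bicategory.{w, w} K] : CategoryStruct.{w + 1} (Psh K) where
  Hom A B := (A.as ⟶ B.as)ᵒᵖ ⥤ Type w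
  id A := yoneda.obj (𝟙 A.as)
  comp U V := day U V

instance pshHomCategory {K : Type u} [Bicategory.{w, w} K] (A B : Psh K) : Category.{w} (A ⟶ B) :=
  inferInstanceAs (Category ((A.as ⟶ B.as)ᵒᵖ ⥤ Type w))

section
variable {K : Type u} [Bicategory.{w, w} K]
  {A B C D E : K} (U U' : (A ⟶ B)ᵒᵖ ⥤ Type w) (V V' : (B ⟶ C)ᵒᵖ ⥤ Type w)
  (X X' : (C ⟶ D)ᵒᵖ ⥤ Type w) (Z : (D ⟶ E)ᵒᵖ ⥤ Type w)

theorem day_pentagon :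
    dayMap (dayAssocHom U V X) (𝟙 Z) ≫ dayAssocHom U (day V X) Z ≫
      dayMap (𝟙 U) (dayAssocHom V X Z) =
    dayAssocHom (day U V) X Z ≫ dayAssocHom U V (day X Z) :=
  day_hom_ext₄ fun f g h k u v x z => by
    simp only [NatTrans.comp_app_apply, dayMap_pair, dayAssocHom_pair, NatTrans.naturality_apply,
      NatTrans.id_app, types_id_apply, pair_map_left, pair_map_right]
    simp only [← Functor.map_comp_apply, ← op_comp]
    refine map_op_congr _ ?_ _
    simp

theorem day_triangle :
    dayAssocHom U (yoneda.obj (𝟙 B)) V ≫ dayMap (𝟙 U) (dayLeftUnitorHom V) =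
      dayMap (dayRightUnitorHom U) (𝟙 V) :=
  day_hom_ext₃ fun f g h u (a : g ⟶ 𝟙 B) v => by
    simp only [NatTrans.comp_app_apply, dayMap_pair, dayAssocHom_pair, NatTrans.naturality_apply,
      NatTrans.id_app, types_id_apply, dayLeftUnitorHom_pair, dayRightUnitorHom_pair,
      pair_map_left, pair_map_right]
    simp only [← Functor.map_comp_apply, ← op_comp]
    refine map_op_congr _ ?_ _
    simp

variable {U U' V V' X X'} in
theorem day_assoc_nat (α : U ⟶ U') (β : V ⟶ V') (γ : X ⟶ X') :
    dayMap (dayMap α β) γ ≫ dayAssocHom U' V' X' =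
      dayAssocHom U V X ≫ dayMap α (dayMap β γ) :=
  day_hom_ext₃ fun f g h u v x => by
    simp only [NatTrans.comp_app_apply, dayMap_pair, dayAssocHom_pair, NatTrans.naturality_apply]

variable {U U'} in
theorem day_leftUnitor_nat (α : U ⟶ U') :
    dayMap (𝟙 _) α ≫ dayLeftUnitorHom U' = dayLeftUnitorHom U ≫ α :=
  day_hom_ext fun f g (a : f ⟶ 𝟙 A) u => by
    simp only [NatTrans.comp_app_apply, dayMap_pair, dayLeftUnitorHom_pair,
      NatTrans.naturality_apply, NatTrans.id_app, types_id_apply]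

variable {U U'} in
theorem day_rightUnitor_nat (α : U ⟶ U') :
    dayMap α (𝟙 _) ≫ dayRightUnitorHom U' = dayRightUnitorHom U ≫ α :=
  day_hom_ext fun f g u (a : g ⟶ 𝟙 B) => by
    simp only [NatTrans.comp_app_apply, dayMap_pair, dayRightUnitorHom_pair,
      NatTrans.naturality_apply, NatTrans.id_app, types_id_apply]

end

section
variable {K : Type u} [Bicategory.{w, w} K] {A B C D : K} {U U' : (A ⟶ B)ᵒᵖ ⥤ Type w}
  {V V' : (B ⟶ C)ᵒᵖ ⥤ Type w} {X : (C ⟶ D)ᵒᵖ ⥤ Type w}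

def dayWhiskerLeft (U : (A ⟶ B)ᵒᵖ ⥤ Type w) (β : V ⟶ V') : day U V ⟶ day U V' := dayMap (𝟙 U) β

def dayWhiskerRight (α : U ⟶ U') (V : (B ⟶ C)ᵒᵖ ⥤ Type w) : day U V ⟶ day U' V := dayMap α (𝟙 V)

def dayYonedaInv (f : A ⟶ B) (g : B ⟶ C) :
    day (yoneda.obj f) (yoneda.obj g) ⟶ yoneda.obj (f ≫ g) :=
  dayDesc (fun p q (a : p ⟶ f) (b : q ⟶ g) => a ▷ q ≫ f ◁ b) (by
    intro p p' q q' c d (a : p' ⟶ f) (b : q' ⟶ g)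
    change (c ≫ a) ▷ q ≫ f ◁ (d ≫ b) = (c ▷ q ≫ p' ◁ d) ≫ a ▷ q' ≫ f ◁ b
    simp [whisker_exchange_assoc])

theorem dayYonedaInv_pair {f p : A ⟶ B} {g q : B ⟶ C} (a : p ⟶ f) (b : q ⟶ g) :
    (dayYonedaInv f g).app (op (p ≫ q)) (pair (U := yoneda.obj f) (V := yoneda.obj g) a b) =
      a ▷ q ≫ f ◁ b :=
  dayDesc_pair (U := yoneda.obj f) (V := yoneda.obj g) (W := yoneda.obj (f ≫ g)) _ _ _ _

def dayYonedaHom (f : A ⟶ B) (g : B ⟶ C) :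
    yoneda.obj (f ≫ g) ⟶ day (yoneda.obj f) (yoneda.obj g) :=
  yonedaEquiv.symm (pair (U := yoneda.obj f) (V := yoneda.obj g) (𝟙 f) (𝟙 g))

theorem dayYonedaHom_apply {f : A ⟶ B} {g : B ⟶ C} {h : A ⟶ C} (φ : h ⟶ f ≫ g) :
    (dayYonedaHom f g).app (op h) φ = (day (yoneda.obj f) (yoneda.obj g)).map φ.op
      (pair (U := yoneda.obj f) (V := yoneda.obj g) (𝟙 f) (𝟙 g)) := rfl

/-- The isomorphism `𝒴(f ≫ g) ≅ 𝒴f ≫ 𝒴g`. -/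
def dayYoneda (f : A ⟶ B) (g : B ⟶ C) :
    yoneda.obj (f ≫ g) ≅ day (yoneda.obj f) (yoneda.obj g) where
  hom := dayYonedaHom f g
  inv := dayYonedaInv f g
  hom_inv_id := by
    apply yonedaEquiv.injective
    change (dayYonedaInv f g).app _ ((dayYonedaHom f g).app (op (f ≫ g)) (𝟙 (f ≫ g))) = 𝟙 (f ≫ g)
    rw [dayYonedaHom_apply, NatTrans.naturality_apply, dayYonedaInv_pair]
    simp
  inv_hom_id := day_hom_ext fun p q (a : p ⟶ f) (b : q ⟶ g) => by
    rw [NatTrans.comp_app_apply, dayYonedaInv_pair, dayYonedaHom_apply, ← pair_map]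
    simp

theorem yoneda_hom_ext {h : A ⟶ B} {W : (A ⟶ B)ᵒᵖ ⥤ Type w} {α β : yoneda.obj h ⟶ W}
    (H : α.app (op h) (𝟙 h) = β.app (op h) (𝟙 h)) : α = β :=
  yonedaEquiv.injective H

theorem dayYonedaHom_id (f : A ⟶ B) (g : B ⟶ C) :
    (dayYonedaHom f g).app (op (f ≫ g)) (𝟙 (f ≫ g)) =
      pair (U := yoneda.obj f) (V := yoneda.obj g) (𝟙 f) (𝟙 g) := by
  rw [dayYonedaHom_apply]; simp

theorem yoneda_map_app_apply {f g h : A ⟶ B} (α : f ⟶ g) (a : h ⟶ f) :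
    (yoneda.map α).app (op h) a = a ≫ α := rfl

theorem dayYoneda_whiskerLeft (f : A ⟶ B) {g g' : B ⟶ C} (α : g ⟶ g') :
    yoneda.map (f ◁ α) =
      dayYonedaHom f g ≫ dayMap (𝟙 (yoneda.obj f)) (yoneda.map α) ≫ dayYonedaInv f g' :=
  yoneda_hom_ext (by
    rw [NatTrans.comp_app_apply, NatTrans.comp_app_apply, dayYonedaHom_id, dayMap_pair,
      yoneda_map_app_apply, yoneda_map_app_apply, NatTrans.id_app, types_id_apply,
      dayYonedaInv_pair]
    simp)

theorem dayYoneda_whiskerRight {f f' : A ⟶ B} (α : f ⟶ f') (g : B ⟶ C) :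
    yoneda.map (α ▷ g) =
      dayYonedaHom f g ≫ dayMap (yoneda.map α) (𝟙 (yoneda.obj g)) ≫ dayYonedaInv f' g :=
  yoneda_hom_ext (by
    rw [NatTrans.comp_app_apply, NatTrans.comp_app_apply, dayYonedaHom_id, dayMap_pair,
      yoneda_map_app_apply, yoneda_map_app_apply, NatTrans.id_app, types_id_apply,
      dayYonedaInv_pair]
    simp)

theorem dayYoneda_assoc (f : A ⟶ B) (g : B ⟶ C) (h : C ⟶ D) :
    yoneda.map (α_ f g h).hom =
      dayYonedaHom (f ≫ g) h ≫ dayMap (dayYonedaHom f g) (𝟙 (yoneda.obj h)) ≫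
        dayAssocHom (yoneda.obj f) (yoneda.obj g) (yoneda.obj h) ≫
          dayMap (𝟙 (yoneda.obj f)) (dayYonedaInv g h) ≫ dayYonedaInv f (g ≫ h) :=
  yoneda_hom_ext (by
    rw [NatTrans.comp_app_apply, NatTrans.comp_app_apply, NatTrans.comp_app_apply,
      NatTrans.comp_app_apply, dayYonedaHom_id, dayMap_pair,
      yoneda_map_app_apply, NatTrans.id_app, types_id_apply, dayYonedaHom_id,
      dayAssocHom_pair, NatTrans.naturality_apply, NatTrans.naturality_apply, dayMap_pair,
      NatTrans.id_app, types_id_apply, dayYonedaInv_pair, dayYonedaInv_pair]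
    simp)

theorem dayYoneda_leftUnitor (f : A ⟶ B) :
    yoneda.map (λ_ f).hom = dayYonedaHom (𝟙 A) f ≫ dayLeftUnitorHom (yoneda.obj f) :=
  yoneda_hom_ext (by
    rw [NatTrans.comp_app_apply, dayYonedaHom_id, dayLeftUnitorHom_pair, yoneda_map_app_apply]
    simp)

theorem dayYoneda_rightUnitor (f : A ⟶ B) :
    yoneda.map (ρ_ f).hom = dayYonedaHom f (𝟙 B) ≫ dayRightUnitorHom (yoneda.obj f) :=
  yoneda_hom_ext (by
    rw [NatTrans.comp_app_apply, dayYonedaHom_id, dayRightUnitorHom_pair, yoneda_map_app_apply]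
    simp)

end

instance (K : Type u) [Bicategory.{w, w} K] : Bicategory.{w, w + 1} (Psh K) where
  homCategory A B := pshHomCategory A B
  whiskerLeft U _ _ β := dayWhiskerLeft U β
  whiskerRight α V := dayWhiskerRight α V
  associator U V X := dayAssoc U V X
  leftUnitor U := dayLeftUnitor U
  rightUnitor U := dayRightUnitor U
  whiskerLeft_id _ _ := dayMap_id
  whiskerLeft_comp U _ _ _ α β := by
    refine Eq.trans ?_ (dayMap_comp (K := K) _ _ _ _)
    exact congrArg (fun t => dayMap t _) (Category.comp_id _).symm
  id_whiskerLeft {A B U U'} α := by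
    refine Eq.trans ?_ (Category.assoc _ _ _)
    exact (Iso.eq_comp_inv (dayLeftUnitor U')).2 (day_leftUnitor_nat α)
  comp_whiskerLeft {A B C D} U V X X' γ := by
    refine Eq.trans ?_ (Category.assoc _ _ _)
    refine (Iso.eq_comp_inv (dayAssoc U V X')).2 (Eq.trans ?_ (day_assoc_nat _ _ γ))
    exact congrArg (fun t => dayMap t _ ≫ dayAssocHom U V X') dayMap_id.symm
  id_whiskerRight _ _ := dayMap_id
  comp_whiskerRight α β V := by
    refine Eq.trans ?_ (dayMap_comp (K := K) _ _ _ _)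
    exact congrArg (fun t => dayMap _ t) (Category.comp_id _).symm
  whiskerRight_id {A B U U'} α := by
    refine Eq.trans ?_ (Category.assoc _ _ _)
    exact (Iso.eq_comp_inv (dayRightUnitor U')).2 (day_rightUnitor_nat α)
  whiskerRight_comp {A B C D U U'} α V X := by
    refine (Iso.eq_inv_comp (dayAssoc U V X)).2 (Eq.trans ?_ (day_assoc_nat α _ _).symm)
    exact congrArg (fun t => dayAssocHom U V X ≫ dayMap _ t) dayMap_id.symm
  whisker_assoc {A B C D} U V V' β X := by
    refine Eq.trans ?_ (Category.assoc _ _ _)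
    exact (Iso.eq_comp_inv (dayAssoc U V' X)).2 (day_assoc_nat _ _ _)
  whisker_exchange {A B C U U' V V'} α β := by
    refine (dayMap_comp (K := K) _ _ _ _).symm.trans (Eq.trans ?_ (dayMap_comp (K := K) _ _ _ _))
    exact congrArg₂ (fun s t => dayMap s t) ((Category.id_comp _).trans (Category.comp_id _).symm)
      ((Category.comp_id _).trans (Category.id_comp _).symm)
  pentagon _ _ _ _ := day_pentagon _ _ _ _
  triangle _ _ := day_triangle _ _

/-- The homomorphism `𝒴 : K → 𝒫K`: the identity on objects, and the Yoneda embedding on each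
hom-category. -/
def yonedaHom (K : Type u) [Bicategory.{w, w} K] : Pseudofunctor K (Psh K) where
  obj A := ⟨A⟩
  map f := yoneda.obj f
  map₂ α := yoneda.map α
  map₂_id f := yoneda.map_id f
  map₂_comp α β := yoneda.map_comp α β
  mapId A := Iso.refl _
  mapComp f g := dayYoneda f g
  map₂_whisker_left f _ _ α := dayYoneda_whiskerLeft f α
  map₂_whisker_right α g := dayYoneda_whiskerRight α g
  map₂_associator f g h := dayYoneda_assoc f g h
  map₂_left_unitor {A B} f := by
    refine (dayYoneda_leftUnitor f).trans ?_
    refine congrArg (fun t => dayYonedaHom (𝟙 A) f ≫ t) ?_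
    refine (Category.id_comp (dayLeftUnitorHom (yoneda.obj f))).symm.trans ?_
    exact congrArg (fun t => t ≫ dayLeftUnitorHom (yoneda.obj f)) dayMap_id.symm
  map₂_right_unitor {A B} f := by
    refine (dayYoneda_rightUnitor f).trans ?_
    refine congrArg (fun t => dayYonedaHom f (𝟙 B) ≫ t) ?_
    refine (Category.id_comp (dayRightUnitorHom (yoneda.obj f))).symm.trans ?_
    exact congrArg (fun t => t ≫ dayRightUnitorHom (yoneda.obj f)) dayMap_id.symm

/-- A weak double category with objects `D`, presented as a pseudo-category object in `Cat`.
The vertical category is `D` itself. A cell `α : Cell U V` from a horizontal arrow `U : A ⇸ C` to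
a horizontal arrow `V : B ⇸ D` has a left boundary `left α : A ⟶ B` and a right boundary
`right α : C ⟶ D`; cells form a category under vertical composition, over the two vertical
boundaries. Horizontal arrows `U : A ⇸ B` and `V : B ⇸ C` compose to `hcomp U V : A ⇸ C`, and
cells `α`, `β` compose horizontally whenever `right α = left β`; the horizontal composition is
associative and unital up to coherent invertible globular cells. -/
class WeakDoubleCategory (D : Type u) extends Category.{v} D where
  Hor : D → D → Type h
  Cell {A B C E : D} (U : Hor A C) (V : Hor B E) : Type c
  left {A B C E : D} {U : Hor A C} {V : Hor B E} (α : Cell U V) : A ⟶ B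
  right {A B C E : D} {U : Hor A C} {V : Hor B E} (α : Cell U V) : C ⟶ E
  -- vertical composition of cells
  vid {A C : D} (U : Hor A C) : Cell U U
  vcomp {A B C A' B' C' : D} {U : Hor A A'} {V : Hor B B'} {W : Hor C C'}
    (α : Cell U V) (β : Cell V W) : Cell U W
  left_vid {A C : D} (U : Hor A C) : left (vid U) = 𝟙 A
  right_vid {A C : D} (U : Hor A C) : right (vid U) = 𝟙 C
  left_vcomp {A B C A' B' C' : D} {U : Hor A A'} {V : Hor B B'} {W : Hor C C'}
    (α : Cell U V) (β : Cell V W) : left (vcomp α β) = left α ≫ left β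
  right_vcomp {A B C A' B' C' : D} {U : Hor A A'} {V : Hor B B'} {W : Hor C C'}
    (α : Cell U V) (β : Cell V W) : right (vcomp α β) = right α ≫ right β
  vid_vcomp {A B C E : D} {U : Hor A C} {V : Hor B E} (α : Cell U V) : vcomp (vid U) α = α
  vcomp_vid {A B C E : D} {U : Hor A C} {V : Hor B E} (α : Cell U V) : vcomp α (vid V) = α
  vcomp_assoc {A B C E A' B' C' E' : D} {U : Hor A A'} {V : Hor B B'} {W : Hor C C'}
    {X : Hor E E'} (α : Cell U V) (β : Cell V W) (γ : Cell W X) :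
    vcomp (vcomp α β) γ = vcomp α (vcomp β γ)
  -- horizontal identities
  hid (A : D) : Hor A A
  hidMap {A B : D} (f : A ⟶ B) : Cell (hid A) (hid B)
  left_hidMap {A B : D} (f : A ⟶ B) : left (hidMap f) = f
  right_hidMap {A B : D} (f : A ⟶ B) : right (hidMap f) = f
  hidMap_id (A : D) : hidMap (𝟙 A) = vid (hid A)
  hidMap_comp {A B C : D} (f : A ⟶ B) (g : B ⟶ C) :
    hidMap (f ≫ g) = vcomp (hidMap f) (hidMap g)
  -- horizontal composition
  hcomp {A B C : D} (U : Hor A B) (V : Hor B C) : Hor A C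
  hcompMap {A B C A' B' C' : D} {U : Hor A B} {V : Hor B C} {U' : Hor A' B'} {V' : Hor B' C'}
    (α : Cell U U') (β : Cell V V') (e : right α = left β) : Cell (hcomp U V) (hcomp U' V')
  left_hcompMap {A B C A' B' C' : D} {U : Hor A B} {V : Hor B C} {U' : Hor A' B'} {V' : Hor B' C'}
    (α : Cell U U') (β : Cell V V') (e : right α = left β) : left (hcompMap α β e) = left α
  right_hcompMap {A B C A' B' C' : D} {U : Hor A B} {V : Hor B C} {U' : Hor A' B'}
    {V' : Hor B' C'} (α : Cell U U') (β : Cell V V') (e : right α = left β) :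
    right (hcompMap α β e) = right β
  hcompMap_vid {A B C : D} (U : Hor A B) (V : Hor B C) :
    hcompMap (vid U) (vid V) ((right_vid U).trans (left_vid V).symm) = vid (hcomp U V)
  hcompMap_vcomp {A B C A' B' C' A'' B'' C'' : D} {U : Hor A B} {V : Hor B C} {U' : Hor A' B'}
    {V' : Hor B' C'} {U'' : Hor A'' B''} {V'' : Hor B'' C''} (α : Cell U U') (β : Cell V V')
    (e : right α = left β) (α' : Cell U' U'') (β' : Cell V' V'') (e' : right α' = left β') :
    hcompMap (vcomp α α') (vcomp β β') (by rw [right_vcomp, left_vcomp, e, e']) =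
      vcomp (hcompMap α β e) (hcompMap α' β' e')
  -- associativity constraint
  hassoc {A B C E : D} (U : Hor A B) (V : Hor B C) (W : Hor C E) :
    Cell (hcomp (hcomp U V) W) (hcomp U (hcomp V W))
  hassocInv {A B C E : D} (U : Hor A B) (V : Hor B C) (W : Hor C E) :
    Cell (hcomp U (hcomp V W)) (hcomp (hcomp U V) W)
  left_hassoc {A B C E : D} (U : Hor A B) (V : Hor B C) (W : Hor C E) : left (hassoc U V W) = 𝟙 A
  right_hassoc {A B C E : D} (U : Hor A B) (V : Hor B C) (W : Hor C E) : right (hassoc U V W) = 𝟙 E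
  hassoc_hassocInv {A B C E : D} (U : Hor A B) (V : Hor B C) (W : Hor C E) :
    vcomp (hassoc U V W) (hassocInv U V W) = vid _
  hassocInv_hassoc {A B C E : D} (U : Hor A B) (V : Hor B C) (W : Hor C E) :
    vcomp (hassocInv U V W) (hassoc U V W) = vid _
  hassoc_naturality {A B C E A' B' C' E' : D} {U : Hor A B} {V : Hor B C} {W : Hor C E}
    {U' : Hor A' B'} {V' : Hor B' C'} {W' : Hor C' E'} (α : Cell U U') (β : Cell V V')
    (γ : Cell W W') (e : right α = left β) (e' : right β = left γ) :
    vcomp (hcompMap (hcompMap α β e) γ ((right_hcompMap α β e).trans e')) (hassoc U' V' W') =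
      vcomp (hassoc U V W) (hcompMap α (hcompMap β γ e') (e.trans (left_hcompMap β γ e').symm))
  -- unit constraints
  lunit {A B : D} (U : Hor A B) : Cell (hcomp (hid A) U) U
  lunitInv {A B : D} (U : Hor A B) : Cell U (hcomp (hid A) U)
  left_lunit {A B : D} (U : Hor A B) : left (lunit U) = 𝟙 A
  right_lunit {A B : D} (U : Hor A B) : right (lunit U) = 𝟙 B
  lunit_lunitInv {A B : D} (U : Hor A B) : vcomp (lunit U) (lunitInv U) = vid _
  lunitInv_lunit {A B : D} (U : Hor A B) : vcomp (lunitInv U) (lunit U) = vid _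
  lunit_naturality {A B A' B' : D} {U : Hor A B} {U' : Hor A' B'} (α : Cell U U') :
    vcomp (hcompMap (hidMap (left α)) α (right_hidMap _)) (lunit U') = vcomp (lunit U) α
  runit {A B : D} (U : Hor A B) : Cell (hcomp U (hid B)) U
  runitInv {A B : D} (U : Hor A B) : Cell U (hcomp U (hid B))
  left_runit {A B : D} (U : Hor A B) : left (runit U) = 𝟙 A
  right_runit {A B : D} (U : Hor A B) : right (runit U) = 𝟙 B
  runit_runitInv {A B : D} (U : Hor A B) : vcomp (runit U) (runitInv U) = vid _
  runitInv_runit {A B : D} (U : Hor A B) : vcomp (runitInv U) (runit U) = vid _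
  runit_naturality {A B A' B' : D} {U : Hor A B} {U' : Hor A' B'} (α : Cell U U') :
    vcomp (hcompMap α (hidMap (right α)) (left_hidMap _).symm) (runit U') = vcomp (runit U) α
  -- coherence
  pentagon {A B C E F : D} (U : Hor A B) (V : Hor B C) (W : Hor C E) (X : Hor E F) :
    vcomp (hcompMap (hassoc U V W) (vid X) ((right_hassoc U V W).trans (left_vid X).symm))
      (vcomp (hassoc U (hcomp V W) X)
        (hcompMap (vid U) (hassoc V W X) ((right_vid U).trans (left_hassoc V W X).symm))) =
      vcomp (hassoc (hcomp U V) W X) (hassoc U V (hcomp W X))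
  triangle {A B C : D} (U : Hor A B) (V : Hor B C) :
    vcomp (hassoc U (hid B) V)
      (hcompMap (vid U) (lunit V) ((right_vid U).trans (left_lunit V).symm)) =
      hcompMap (runit U) (vid V) ((right_runit U).trans (left_vid V).symm)

namespace WeakDoubleCategory

infixr:80 " ≫ᵥ " => vcomp

attribute [simp] left_vid right_vid left_vcomp right_vcomp vid_vcomp vcomp_vid vcomp_assoc
  left_hidMap right_hidMap left_hcompMap right_hcompMap left_hassoc right_hassoc
  left_lunit right_lunit left_runit right_runit hidMap_id
  hassoc_hassocInv hassocInv_hassoc lunit_lunitInv lunitInv_lunit runit_runitInv runitInv_runit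
  hcompMap_vid

variable {D : Type u} [WeakDoubleCategory.{v, u, h, c} D]

section
variable {A B C E F : D}

@[simp]
theorem left_lunitInv (U : Hor A B) : left (lunitInv U) = 𝟙 A := by
  have := congrArg left (lunitInv_lunit U)
  rwa [left_vcomp, left_vid, left_lunit, Category.comp_id] at this

@[simp]
theorem right_lunitInv (U : Hor A B) : right (lunitInv U) = 𝟙 B := by
  have := congrArg right (lunitInv_lunit U)
  rwa [right_vcomp, right_vid, right_lunit, Category.comp_id] at this

@[simp]
theorem left_runitInv (U : Hor A B) : left (runitInv U) = 𝟙 A := by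
  have := congrArg left (runitInv_runit U)
  rwa [left_vcomp, left_vid, left_runit, Category.comp_id] at this

@[simp]
theorem right_runitInv (U : Hor A B) : right (runitInv U) = 𝟙 B := by
  have := congrArg right (runitInv_runit U)
  rwa [right_vcomp, right_vid, right_runit, Category.comp_id] at this

@[simp]
theorem left_hassocInv (U : Hor A B) (V : Hor B C) (W : Hor C E) :
    left (hassocInv U V W) = 𝟙 A := by
  have := congrArg left (hassocInv_hassoc U V W)
  rwa [left_vcomp, left_vid, left_hassoc, Category.comp_id] at this

@[simp]
theorem right_hassocInv (U : Hor A B) (V : Hor B C) (W : Hor C E) :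
    right (hassocInv U V W) = 𝟙 E := by
  have := congrArg right (hassocInv_hassoc U V W)
  rwa [right_vcomp, right_vid, right_hassoc, Category.comp_id] at this
end

/-- The underlying bicategory of a weak double category: objects, horizontal arrows and globular
cells. -/
structure Underlying (D : Type u) where
  of ::
  as : D

instance : CategoryStruct.{h} (Underlying D) where
  Hom A B := Hor A.as B.as
  id A := hid A.as
  comp U V := hcomp U V

/-- Globular cells: those whose vertical boundaries are identities. -/
@[ext]
structure Globular {A B : D} (U V : Hor A B) where
  cell : Cell U V
  left_cell : left cell = 𝟙 A
  right_cell : right cell = 𝟙 B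

attribute [simp] Globular.left_cell Globular.right_cell

instance underlyingHom (A B : Underlying D) : Category.{c} (A ⟶ B) where
  Hom U V := Globular (A := A.as) (B := B.as) U V
  id U := ⟨vid _, by simp, by simp⟩
  comp α β := ⟨α.cell ≫ᵥ β.cell, by simp, by simp⟩
  id_comp α := Globular.ext (by simp)
  comp_id α := Globular.ext (by simp)
  assoc α β γ := Globular.ext (by simp)

section
variable {A B C E : D}

def Globular.whiskerLeft (U : Hor A B) {V V' : Hor B C} (β : Globular V V') :
    Globular (hcomp U V) (hcomp U V') := ⟨hcompMap (vid U) β.cell (by simp), by simp, by simp⟩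

def Globular.whiskerRight {U U' : Hor A B} (α : Globular U U') (V : Hor B C) :
    Globular (hcomp U V) (hcomp U' V) := ⟨hcompMap α.cell (vid V) (by simp), by simp, by simp⟩

def Globular.assoc (U : Hor A B) (V : Hor B C) (W : Hor C E) :
    Globular (hcomp (hcomp U V) W) (hcomp U (hcomp V W)) := ⟨hassoc U V W, by simp, by simp⟩

def Globular.assocInv (U : Hor A B) (V : Hor B C) (W : Hor C E) :
    Globular (hcomp U (hcomp V W)) (hcomp (hcomp U V) W) := ⟨hassocInv U V W, by simp, by simp⟩

def Globular.lunit (U : Hor A B) : Globular (hcomp (hid A) U) U :=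
  ⟨WeakDoubleCategory.lunit U, by simp, by simp⟩

def Globular.lunitInv (U : Hor A B) : Globular U (hcomp (hid A) U) :=
  ⟨WeakDoubleCategory.lunitInv U, by simp, by simp⟩

def Globular.runit (U : Hor A B) : Globular (hcomp U (hid B)) U :=
  ⟨WeakDoubleCategory.runit U, by simp, by simp⟩

def Globular.runitInv (U : Hor A B) : Globular U (hcomp U (hid B)) :=
  ⟨WeakDoubleCategory.runitInv U, by simp, by simp⟩

end

theorem underlying_hom_ext {A B : Underlying D} {U V : A ⟶ B} {α β : U ⟶ V}
    (e : Globular.cell (A := A.as) (B := B.as) α = Globular.cell (A := A.as) (B := B.as) β) :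
    α = β :=
  Globular.ext e

theorem vid_hcompMap_lunit_naturality {A B : D} {U V : Hor A B} (α : Cell U V) (hl : left α = 𝟙 A) :
    hcompMap (vid (hid A)) α (by simp [hl]) ≫ᵥ lunit V = lunit U ≫ᵥ α := by
  simpa [hl] using lunit_naturality α

theorem hcompMap_vid_runit_naturality {A B : D} {U V : Hor A B} (α : Cell U V)
    (hr : right α = 𝟙 B) :
    hcompMap α (vid (hid B)) (by simp [hr]) ≫ᵥ runit V = runit U ≫ᵥ α := by
  simpa [hr] using runit_naturality α

instance : Bicategory.{c, h} (Underlying D) where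
  whiskerLeft U _ _ β := Globular.whiskerLeft U β
  whiskerRight α V := Globular.whiskerRight α V
  associator U V W :=
    { hom := Globular.assoc U V W
      inv := Globular.assocInv U V W
      hom_inv_id := by refine underlying_hom_ext ?_; exact (by exact hassoc_hassocInv _ _ _)
      inv_hom_id := by refine underlying_hom_ext ?_; exact (by exact hassocInv_hassoc _ _ _) }
  leftUnitor U :=
    { hom := Globular.lunit U
      inv := Globular.lunitInv U
      hom_inv_id := by refine underlying_hom_ext ?_; exact (by exact lunit_lunitInv _)
      inv_hom_id := by refine underlying_hom_ext ?_; exact (by exact lunitInv_lunit _) }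
  rightUnitor U :=
    { hom := Globular.runit U
      inv := Globular.runitInv U
      hom_inv_id := by refine underlying_hom_ext ?_; exact (by exact runit_runitInv _)
      inv_hom_id := by refine underlying_hom_ext ?_; exact (by exact runitInv_runit _) }
  whiskerLeft_id U V := by refine underlying_hom_ext ?_; exact (by exact hcompMap_vid _ _)
  whiskerLeft_comp U V V' V'' α β := by refine underlying_hom_ext ?_; exact (by
    change hcompMap (vid U) (α.cell ≫ᵥ β.cell) _ = hcompMap _ _ _ ≫ᵥ hcompMap _ _ _
    rw [← hcompMap_vcomp]; simp)
  id_whiskerLeft {A B U V} α := by refine underlying_hom_ext ?_; exact (by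
    change hcompMap (vid (hid A.as)) α.cell _ = lunit U ≫ᵥ α.cell ≫ᵥ lunitInv V
    rw [← vcomp_assoc, ← vid_hcompMap_lunit_naturality _ α.left_cell]; simp)
  comp_whiskerLeft {A B C E} U V W W' α := by refine underlying_hom_ext ?_; exact (by
    change hcompMap (vid (hcomp U V)) α.cell _ = hassoc U V W ≫ᵥ hcompMap (vid U)
      (hcompMap (vid V) α.cell _) _ ≫ᵥ hassocInv U V W'
    rw [← vcomp_assoc, ← hassoc_naturality]
    · simp
    · simp)
  id_whiskerRight U V := by refine underlying_hom_ext ?_; exact (by exact hcompMap_vid _ _)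
  comp_whiskerRight α β V := by refine underlying_hom_ext ?_; exact (by
    change hcompMap (α.cell ≫ᵥ β.cell) (vid V) _ = hcompMap _ _ _ ≫ᵥ hcompMap _ _ _
    rw [← hcompMap_vcomp]; simp)
  whiskerRight_id {A B U V} α := by refine underlying_hom_ext ?_; exact (by
    change hcompMap α.cell (vid (hid B.as)) _ = runit U ≫ᵥ α.cell ≫ᵥ runitInv V
    rw [← vcomp_assoc, ← hcompMap_vid_runit_naturality _ α.right_cell]; simp)
  whiskerRight_comp {A B C E U U'} α V W := by refine underlying_hom_ext ?_; exact (by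
    change hcompMap α.cell (vid (hcomp V W)) _ = hassocInv U V W ≫ᵥ hcompMap
      (hcompMap α.cell (vid V) _) (vid W) _ ≫ᵥ hassoc U' V W
    rw [hassoc_naturality _ _ _ _ (by simp)]
    rw [← vcomp_assoc]
    simp)
  whisker_assoc {A B C E} U V V' α W := by refine underlying_hom_ext ?_; exact (by
    change hcompMap (hcompMap (vid U) α.cell _) (vid W) _ = hassoc U V W ≫ᵥ hcompMap (vid U)
      (hcompMap α.cell (vid W) _) _ ≫ᵥ hassocInv U V' W
    rw [← vcomp_assoc, ← hassoc_naturality]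
    · simp
    · simp)
  whisker_exchange {A B C U U' V V'} α β := by refine underlying_hom_ext ?_; exact (by
    change hcompMap _ _ _ ≫ᵥ hcompMap _ _ _ = hcompMap _ _ _ ≫ᵥ hcompMap _ _ _
    rw [← hcompMap_vcomp, ← hcompMap_vcomp]; simp)
  pentagon U V W X := by refine underlying_hom_ext ?_; exact (by exact WeakDoubleCategory.pentagon U V W X)
  triangle U V := by refine underlying_hom_ext ?_; exact (by exact WeakDoubleCategory.triangle U V)

theorem lunit_hid (A : D) : lunit (hid A) = runit (hid A) :=
  congrArg Globular.cell
    (unitors_equal (B := Underlying D) (a := ⟨A⟩))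

theorem lunitInv_hid (A : D) : lunitInv (hid A) = runitInv (hid A) :=
  congrArg Globular.cell
    (unitors_inv_equal (B := Underlying D) (a := ⟨A⟩))

theorem lunitInv_hcomp {A B C : D} (U : Hor A B) (V : Hor B C) :
    lunitInv (hcomp U V) ≫ᵥ hassocInv (hid A) U V = hcompMap (lunitInv U) (vid V) (by simp) := by
  have := leftUnitor_comp_inv (B := Underlying D) (a := ⟨A⟩) (b := ⟨B⟩) (c := ⟨C⟩) U V
  have := congrArg Globular.cell this
  change lunitInv (hcomp U V) = hcompMap (lunitInv U) (vid V) _ ≫ᵥ hassoc _ _ _ at this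
  rw [this]; simp

section
variable {A B C A' B' C' A'' B'' C'' : D}

theorem hcompMap_congr {U : Hor A B} {V : Hor B C} {U' : Hor A' B'} {V' : Hor B' C'}
    {α α' : Cell U U'} {β β' : Cell V V'} (hα : α = α') (hβ : β = β') (e : right α = left β) :
    hcompMap α β e = hcompMap α' β' (by rw [← hα, ← hβ, e]) := by
  subst hα hβ; rfl

theorem vre {U : Hor A A'} {V : Hor B B'} {W : Hor C C'} {α : Cell U V} {β : Cell V W}
    {γ : Cell U W} (e : α ≫ᵥ β = γ) {X : Hor A'' B''} (δ : Cell W X) :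
    α ≫ᵥ β ≫ᵥ δ = γ ≫ᵥ δ := by
  rw [← vcomp_assoc, e]

theorem runitInv_hcompMap_assoc (U : Hor A B) (V : Hor B C) :
    hcompMap (runitInv U) (vid V) (by simp) ≫ᵥ hassoc U (hid B) V =
      hcompMap (vid U) (lunitInv V) (by simp) := by
  have h1 := WeakDoubleCategory.triangle U V
  have h2 : hcompMap (vid U) (lunit V) (by simp) ≫ᵥ hcompMap (vid U) (lunitInv V) (by simp) =
      vid _ := by
    rw [← hcompMap_vcomp]; simp
  have h3 : hcompMap (runitInv U) (vid V) (by simp) ≫ᵥ hcompMap (runit U) (vid V) (by simp) =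
      vid _ := by
    rw [← hcompMap_vcomp]; simp
  calc _ = hcompMap (runitInv U) (vid V) (by simp) ≫ᵥ hassoc U (hid B) V ≫ᵥ
        hcompMap (vid U) (lunit V) (by simp) ≫ᵥ hcompMap (vid U) (lunitInv V) (by simp) := by
        rw [h2, vcomp_vid]
    _ = _ := by rw [vre h1, vre h3, vid_vcomp]

theorem lunitInv_hcompMap_assoc (V : Hor B C) :
    hcompMap (lunitInv (hid B)) (vid V) (by simp) ≫ᵥ hassoc (hid B) (hid B) V =
      hcompMap (vid (hid B)) (lunitInv V) (by simp) := by
  rw [← runitInv_hcompMap_assoc]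
  simp only [lunitInv_hid]

theorem lunitInv_naturality {U : Hor A B} {U' : Hor A' B'} (α : Cell U U') :
    lunitInv U ≫ᵥ hcompMap (hidMap (left α)) α (right_hidMap _) = α ≫ᵥ lunitInv U' := by
  calc _ = lunitInv U ≫ᵥ hcompMap (hidMap (left α)) α (right_hidMap _) ≫ᵥ lunit U' ≫ᵥ
        lunitInv U' := by simp
    _ = _ := by rw [vre (lunit_naturality α), vcomp_assoc, vre (lunitInv_lunit U), vid_vcomp]

theorem runitInv_naturality {U : Hor A B} {U' : Hor A' B'} (α : Cell U U') :
    runitInv U ≫ᵥ hcompMap α (hidMap (right α)) (left_hidMap _).symm = α ≫ᵥ runitInv U' := by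
  calc _ = runitInv U ≫ᵥ hcompMap α (hidMap (right α)) (left_hidMap _).symm ≫ᵥ runit U' ≫ᵥ
        runitInv U' := by simp
    _ = _ := by rw [vre (runit_naturality α), vcomp_assoc, vre (runitInv_runit U), vid_vcomp]

theorem lunitInv_runitInv (U : Hor A B) :
    lunitInv U ≫ᵥ hcompMap (vid (hid A)) (runitInv U) (by simp) =
      runitInv U ≫ᵥ hcompMap (lunitInv U) (vid (hid B)) (by simp) ≫ᵥ hassoc _ _ _ := by
  have h1 := lunitInv_naturality (runitInv U)
  have h2 := lunitInv_hcomp U (hid B)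
  rw [← h2]
  simp only [vcomp_assoc, hassocInv_hassoc, vcomp_vid]
  rw [← h1]
  simp

end

end WeakDoubleCategory

open WeakDoubleCategory

section Enriched

variable (D : Type u) [WeakDoubleCategory.{v, u, h, c} D]

/-- A category enriched in a weak double category `D`, that is, in its underlying bicategory. -/
structure ECat where
  /-- The set of objects. -/
  Ob : Type u₁
  /-- The extent `|x|` of an object. -/
  extent : Ob → D
  hom (x y : Ob) : Hor (extent x) (extent y)
  unit (x : Ob) : Globular (hid (extent x)) (hom x x)
  mul (x y z : Ob) : Globular (hcomp (hom x y) (hom y z)) (hom x z)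
  unit_mul (x y : Ob) :
    hcompMap (unit x).cell (vid (hom x y)) (by simp) ≫ᵥ (mul x x y).cell = lunit (hom x y)
  mul_unit (x y : Ob) :
    hcompMap (vid (hom x y)) (unit y).cell (by simp) ≫ᵥ (mul x y y).cell = runit (hom x y)
  mul_assoc (x y z t : Ob) :
    hcompMap (mul x y z).cell (vid (hom z t)) (by simp) ≫ᵥ (mul x z t).cell =
      hassoc (hom x y) (hom y z) (hom z t) ≫ᵥ
        hcompMap (vid (hom x y)) (mul y z t).cell (by simp) ≫ᵥ (mul x y t).cell

variable {D}

/-- Enriched functors over a weak double category. -/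
structure EFunctor (X Y : ECat.{v, u, u₁, h, c} D) where
  obj : X.Ob → Y.Ob
  vert (x : X.Ob) : X.extent x ⟶ Y.extent (obj x)
  map (x y : X.Ob) : Cell (X.hom x y) (Y.hom (obj x) (obj y))
  left_map (x y : X.Ob) : left (map x y) = vert x
  right_map (x y : X.Ob) : right (map x y) = vert y
  map_unit (x : X.Ob) :
    (X.unit x).cell ≫ᵥ map x x = hidMap (vert x) ≫ᵥ (Y.unit (obj x)).cell
  map_mul (x y z : X.Ob) :
    (X.mul x y z).cell ≫ᵥ map x z =
      hcompMap (map x y) (map y z) (by rw [right_map, left_map]) ≫ᵥ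
        (Y.mul (obj x) (obj y) (obj z)).cell

attribute [simp] EFunctor.left_map EFunctor.right_map

/-- Enriched natural transformations over a weak double category. -/
@[ext]
structure ENatTrans {X Y : ECat.{v, u, u₁, h, c} D} (H K : EFunctor X Y) where
  app (x : X.Ob) : Cell (hid (X.extent x)) (Y.hom (H.obj x) (K.obj x))
  left_app (x : X.Ob) : left (app x) = H.vert x
  right_app (x : X.Ob) : right (app x) = K.vert x
  naturality (x y : X.Ob) :
    lunitInv (X.hom x y) ≫ᵥ hcompMap (app x) (K.map x y) (by rw [right_app, K.left_map]) ≫ᵥ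
        (Y.mul (H.obj x) (K.obj x) (K.obj y)).cell =
      runitInv (X.hom x y) ≫ᵥ hcompMap (H.map x y) (app y) (by rw [left_app, H.right_map]) ≫ᵥ
        (Y.mul (H.obj x) (H.obj y) (K.obj y)).cell

attribute [simp] ENatTrans.left_app ENatTrans.right_app

namespace ECat

theorem mul_left_comp (Y : ECat.{v, u, u₁, h, c} D) {x y z t : Y.Ob} {A B C E : D} {P : Hor A C}
    {U : Hor A B} {V : Hor B C} {W : Hor C E} (p : Cell P (hcomp U V)) (hp : right p = 𝟙 C)
    (a : Cell U (Y.hom x y)) (b : Cell V (Y.hom y z)) (d : Cell W (Y.hom z t))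
    (e : right a = left b) (e' : right b = left d) :
    hcompMap (p ≫ᵥ hcompMap a b e ≫ᵥ (Y.mul x y z).cell) d (by simp [hp, e']) ≫ᵥ
        (Y.mul x z t).cell =
      hcompMap p (vid W) (by simp [hp]) ≫ᵥ hassoc U V W ≫ᵥ
        hcompMap a (hcompMap b d e' ≫ᵥ (Y.mul y z t).cell) (by simp [e]) ≫ᵥ
          (Y.mul x y t).cell := by
  have h1 : hcompMap (p ≫ᵥ hcompMap a b e ≫ᵥ (Y.mul x y z).cell) d (by simp [hp, e']) =
      hcompMap p (vid W) (by simp [hp]) ≫ᵥ hcompMap (hcompMap a b e) d (by simp [e']) ≫ᵥ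
        hcompMap (Y.mul x y z).cell (vid _) (by simp) := by
    rw [← hcompMap_vcomp, ← hcompMap_vcomp]
    exact hcompMap_congr rfl (by simp) _
  have h2 : hcompMap a (hcompMap b d e' ≫ᵥ (Y.mul y z t).cell) (by simp [e]) =
      hcompMap a (hcompMap b d e') (by simp [e]) ≫ᵥ
        hcompMap (vid _) (Y.mul y z t).cell (by simp) := by
    rw [← hcompMap_vcomp]
    exact hcompMap_congr (by simp) rfl _
  rw [h1, h2, vcomp_assoc, vcomp_assoc, Y.mul_assoc, vre (hassoc_naturality a b d e e')]
  simp

theorem mul_right_comp (Y : ECat.{v, u, u₁, h, c} D) {x y z t : Y.Ob} {A B C E : D} {P : Hor B E}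
    {U : Hor A B} {V : Hor B C} {W : Hor C E} (p : Cell P (hcomp V W)) (hp : left p = 𝟙 B)
    (a : Cell U (Y.hom x y)) (b : Cell V (Y.hom y z)) (d : Cell W (Y.hom z t))
    (e : right a = left b) (e' : right b = left d) :
    hcompMap a (p ≫ᵥ hcompMap b d e' ≫ᵥ (Y.mul y z t).cell) (by simp [hp, e]) ≫ᵥ
        (Y.mul x y t).cell =
      hcompMap (vid U) p (by simp [hp]) ≫ᵥ
        hcompMap a (hcompMap b d e' ≫ᵥ (Y.mul y z t).cell) (by simp [e]) ≫ᵥ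
          (Y.mul x y t).cell := by
  have h1 : hcompMap a (p ≫ᵥ hcompMap b d e' ≫ᵥ (Y.mul y z t).cell) (by simp [hp, e]) =
      hcompMap (vid U) p (by simp [hp]) ≫ᵥ
        hcompMap a (hcompMap b d e' ≫ᵥ (Y.mul y z t).cell) (by simp [e]) := by
    rw [← hcompMap_vcomp]
    exact hcompMap_congr (by simp) rfl _
  rw [h1, vcomp_assoc]

end ECat

namespace EFunctor
variable {X Y Z : ECat.{v, u, u₁, h, c} D}

def id (X : ECat.{v, u, u₁, h, c} D) : EFunctor X X where
  obj x := x
  vert x := 𝟙 _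
  map x y := vid _
  left_map _ _ := by simp
  right_map _ _ := by simp
  map_unit _ := by simp
  map_mul _ _ _ := by simp

def comp (F : EFunctor X Y) (G : EFunctor Y Z) : EFunctor X Z where
  obj x := G.obj (F.obj x)
  vert x := F.vert x ≫ G.vert (F.obj x)
  map x y := F.map x y ≫ᵥ G.map (F.obj x) (F.obj y)
  left_map _ _ := by simp
  right_map _ _ := by simp
  map_unit x := by
    rw [← vcomp_assoc, F.map_unit, vcomp_assoc, G.map_unit, hidMap_comp, vcomp_assoc]
  map_mul x y z := by
    rw [← vcomp_assoc, F.map_mul, vcomp_assoc, G.map_mul, hcompMap_vcomp, vcomp_assoc]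

theorem ext' {F G : EFunctor X Y} (h₁ : ∀ x, F.obj x = G.obj x)
    (h₂ : ∀ x, HEq (F.vert x) (G.vert x)) (h₃ : ∀ x y, HEq (F.map x y) (G.map x y)) : F = G := by
  obtain ⟨o, f, m, _, _, _, _⟩ := F
  obtain ⟨o', f', m', _, _, _, _⟩ := G
  obtain rfl : o = o' := funext h₁
  obtain rfl : f = f' := funext fun x => eq_of_heq (h₂ x)
  obtain rfl : m = m' := funext fun x => funext fun y => eq_of_heq (h₃ x y)
  rfl

end EFunctor

namespace ENatTrans
variable {X Y Z : ECat.{v, u, u₁, h, c} D}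

def id (H : EFunctor X Y) : ENatTrans H H where
  app x := hidMap (H.vert x) ≫ᵥ (Y.unit (H.obj x)).cell
  left_app x := by simp
  right_app x := by simp
  naturality x y := by
    have h1 : hcompMap (hidMap (H.vert x) ≫ᵥ (Y.unit (H.obj x)).cell) (H.map x y) (by simp) =
        hcompMap (hidMap (left (H.map x y))) (H.map x y) (by simp) ≫ᵥ
          hcompMap (Y.unit (H.obj x)).cell (vid _) (by simp) := by
      rw [← hcompMap_vcomp]
      exact hcompMap_congr (by simp) (by simp) _
    have h2 : hcompMap (H.map x y) (hidMap (H.vert y) ≫ᵥ (Y.unit (H.obj y)).cell) (by simp) =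
        hcompMap (H.map x y) (hidMap (right (H.map x y))) (by simp) ≫ᵥ
          hcompMap (vid _) (Y.unit (H.obj y)).cell (by simp) := by
      rw [← hcompMap_vcomp]
      exact hcompMap_congr (by simp) (by simp) _
    rw [h1, h2, vcomp_assoc, vcomp_assoc, Y.unit_mul, Y.mul_unit, lunit_naturality,
      runit_naturality, vre (lunitInv_lunit _), vre (runitInv_runit _)]

def comp {H K L : EFunctor X Y} (α : ENatTrans H K) (β : ENatTrans K L) : ENatTrans H L where
  app x := lunitInv (hid (X.extent x)) ≫ᵥ hcompMap (α.app x) (β.app x) (by simp) ≫ᵥ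
    (Y.mul _ _ _).cell
  left_app x := by simp
  right_app x := by simp
  naturality x y := by
    have h1 := α.naturality x y
    have h2 := β.naturality x y
    rw [Y.mul_left_comp _ (by simp) _ _ _ (by simp) (by simp), vre (lunitInv_hcompMap_assoc _),
      ← Y.mul_right_comp _ (by simp) _ _ _ (by simp) (by simp),
      hcompMap_congr rfl h2, Y.mul_right_comp _ (by simp) _ _ _ (by simp) (by simp),
      vre (lunitInv_runitInv _), vcomp_assoc, vcomp_assoc,
      ← Y.mul_left_comp _ (by simp) _ _ _ (by simp) (by simp),
      hcompMap_congr h1 rfl, Y.mul_left_comp _ (by simp) _ _ _ (by simp) (by simp),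
      vre (runitInv_hcompMap_assoc _ _),
      ← Y.mul_right_comp _ (by simp) _ _ _ (by simp) (by simp)]

theorem comp_assoc {H K L M : EFunctor X Y} (α : ENatTrans H K) (β : ENatTrans K L)
    (γ : ENatTrans L M) : (α.comp β).comp γ = α.comp (β.comp γ) := by
  ext x
  dsimp only [comp]
  rw [Y.mul_left_comp _ (by simp) _ _ _ (by simp) (by simp), vre (lunitInv_hcompMap_assoc _),
    ← Y.mul_right_comp _ (by simp) _ _ _ (by simp) (by simp)]

theorem id_comp {H K : EFunctor X Y} (α : ENatTrans H K) : (id H).comp α = α := by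
  ext x
  dsimp only [comp, id]
  have h1 : hcompMap (hidMap (H.vert x) ≫ᵥ (Y.unit (H.obj x)).cell) (α.app x) (by simp) =
      hcompMap (hidMap (left (α.app x))) (α.app x) (by simp) ≫ᵥ
        hcompMap (Y.unit (H.obj x)).cell (vid _) (by simp) := by
    rw [← hcompMap_vcomp]
    exact hcompMap_congr (by simp) (by simp) _
  rw [h1, vcomp_assoc, Y.unit_mul, lunit_naturality, vre (lunitInv_lunit _), vid_vcomp]

theorem comp_id {H K : EFunctor X Y} (α : ENatTrans H K) : α.comp (id K) = α := by
  ext x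
  dsimp only [comp, id]
  have h1 : hcompMap (α.app x) (hidMap (K.vert x) ≫ᵥ (Y.unit (K.obj x)).cell) (by simp) =
      hcompMap (α.app x) (hidMap (right (α.app x))) (by simp) ≫ᵥ
        hcompMap (vid _) (Y.unit (K.obj x)).cell (by simp) := by
    rw [← hcompMap_vcomp]
    exact hcompMap_congr (by simp) (by simp) _
  rw [h1, vcomp_assoc, Y.mul_unit, runit_naturality, lunitInv_hid, vre (runitInv_runit _),
    vid_vcomp]

theorem whiskerLeft_naturality (F : EFunctor X Y) {G G' : EFunctor Y Z} (β : ENatTrans G G')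
    (x y : X.Ob) :
    lunitInv (X.hom x y) ≫ᵥ hcompMap (hidMap (F.vert x) ≫ᵥ β.app (F.obj x))
        (F.map x y ≫ᵥ G'.map (F.obj x) (F.obj y)) (by simp) ≫ᵥ
        (Z.mul (G.obj (F.obj x)) (G'.obj (F.obj x)) (G'.obj (F.obj y))).cell =
      runitInv (X.hom x y) ≫ᵥ hcompMap (F.map x y ≫ᵥ G.map (F.obj x) (F.obj y))
        (hidMap (F.vert y) ≫ᵥ β.app (F.obj y)) (by simp) ≫ᵥ
        (Z.mul (G.obj (F.obj x)) (G.obj (F.obj y)) (G'.obj (F.obj y))).cell := by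
  have h1 : hcompMap (hidMap (F.vert x) ≫ᵥ β.app (F.obj x))
      (F.map x y ≫ᵥ G'.map (F.obj x) (F.obj y)) (by simp) =
      hcompMap (hidMap (left (F.map x y))) (F.map x y) (by simp) ≫ᵥ
        hcompMap (β.app (F.obj x)) (G'.map (F.obj x) (F.obj y)) (by simp) := by
    rw [← hcompMap_vcomp]
    exact hcompMap_congr (by simp) rfl _
  have h2 : hcompMap (F.map x y ≫ᵥ G.map (F.obj x) (F.obj y))
      (hidMap (F.vert y) ≫ᵥ β.app (F.obj y)) (by simp) =
      hcompMap (F.map x y) (hidMap (right (F.map x y))) (by simp) ≫ᵥ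
        hcompMap (G.map (F.obj x) (F.obj y)) (β.app (F.obj y)) (by simp) := by
    rw [← hcompMap_vcomp]
    exact hcompMap_congr rfl (by simp) _
  rw [h1, h2, vcomp_assoc, vcomp_assoc, vre (lunitInv_naturality _),
    vre (runitInv_naturality _), vcomp_assoc, vcomp_assoc, β.naturality (F.obj x) (F.obj y)]

def whiskerLeft (F : EFunctor X Y) {G G' : EFunctor Y Z} (β : ENatTrans G G') :
    ENatTrans (F.comp G) (F.comp G') where
  app x := hidMap (F.vert x) ≫ᵥ β.app (F.obj x)
  left_app x := by simp [EFunctor.comp]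
  right_app x := by simp [EFunctor.comp]
  naturality x y := whiskerLeft_naturality F β x y

theorem whiskerRight_naturality {F F' : EFunctor X Y} (α : ENatTrans F F') (G : EFunctor Y Z)
    (x y : X.Ob) :
    lunitInv (X.hom x y) ≫ᵥ hcompMap (α.app x ≫ᵥ G.map (F.obj x) (F'.obj x))
        (F'.map x y ≫ᵥ G.map (F'.obj x) (F'.obj y)) (by simp) ≫ᵥ
        (Z.mul (G.obj (F.obj x)) (G.obj (F'.obj x)) (G.obj (F'.obj y))).cell =
      runitInv (X.hom x y) ≫ᵥ hcompMap (F.map x y ≫ᵥ G.map (F.obj x) (F.obj y))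
        (α.app y ≫ᵥ G.map (F.obj y) (F'.obj y)) (by simp) ≫ᵥ
        (Z.mul (G.obj (F.obj x)) (G.obj (F.obj y)) (G.obj (F'.obj y))).cell := by
  rw [hcompMap_vcomp _ _ (by simp) _ _ (by simp), hcompMap_vcomp _ _ (by simp) _ _ (by simp),
    vcomp_assoc, vcomp_assoc, ← G.map_mul, ← G.map_mul]
  have h4 := congrArg (fun t => t ≫ᵥ G.map (F.obj x) (F'.obj y)) (α.naturality x y)
  simpa only [vcomp_assoc] using h4

def whiskerRight {F F' : EFunctor X Y} (α : ENatTrans F F') (G : EFunctor Y Z) :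
    ENatTrans (F.comp G) (F'.comp G) where
  app x := α.app x ≫ᵥ G.map (F.obj x) (F'.obj x)
  left_app x := by simp [EFunctor.comp]
  right_app x := by simp [EFunctor.comp]
  naturality x y := whiskerRight_naturality α G x y

theorem whiskerLeft_id (F : EFunctor X Y) (G : EFunctor Y Z) :
    whiskerLeft F (id G) = id (F.comp G) := by
  ext x
  change hidMap (F.vert x) ≫ᵥ hidMap (G.vert (F.obj x)) ≫ᵥ (Z.unit (G.obj (F.obj x))).cell =
    hidMap (F.vert x ≫ G.vert (F.obj x)) ≫ᵥ (Z.unit (G.obj (F.obj x))).cell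
  rw [hidMap_comp, vcomp_assoc]

theorem whiskerLeft_comp (F : EFunctor X Y) {G G' G'' : EFunctor Y Z} (β : ENatTrans G G')
    (β' : ENatTrans G' G'') :
    whiskerLeft F (β.comp β') = (whiskerLeft F β).comp (whiskerLeft F β') := by
  ext x
  change hidMap (F.vert x) ≫ᵥ lunitInv _ ≫ᵥ hcompMap (β.app (F.obj x)) (β'.app (F.obj x)) _ ≫ᵥ
      (Z.mul (G.obj (F.obj x)) (G'.obj (F.obj x)) (G''.obj (F.obj x))).cell =
    lunitInv _ ≫ᵥ hcompMap (hidMap (F.vert x) ≫ᵥ β.app (F.obj x))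
      (hidMap (F.vert x) ≫ᵥ β'.app (F.obj x)) (by simp) ≫ᵥ
      (Z.mul (G.obj (F.obj x)) (G'.obj (F.obj x)) (G''.obj (F.obj x))).cell
  have h1 := lunitInv_naturality (hidMap (F.vert x))
  rw [hcompMap_vcomp _ _ (by simp) _ _ (by simp), vcomp_assoc, vre h1.symm, vcomp_assoc]
  simp

theorem id_whiskerRight (F : EFunctor X Y) (G : EFunctor Y Z) :
    whiskerRight (id F) G = id (F.comp G) := by
  ext x
  change (hidMap (F.vert x) ≫ᵥ (Y.unit (F.obj x)).cell) ≫ᵥ G.map (F.obj x) (F.obj x) =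
    hidMap (F.vert x ≫ G.vert (F.obj x)) ≫ᵥ (Z.unit (G.obj (F.obj x))).cell
  rw [hidMap_comp, vcomp_assoc, G.map_unit, vcomp_assoc]

theorem comp_whiskerRight {F F' F'' : EFunctor X Y} (α : ENatTrans F F') (α' : ENatTrans F' F'')
    (G : EFunctor Y Z) :
    whiskerRight (α.comp α') G = (whiskerRight α G).comp (whiskerRight α' G) := by
  ext x
  change (lunitInv _ ≫ᵥ hcompMap (α.app x) (α'.app x) _ ≫ᵥ
      (Y.mul (F.obj x) (F'.obj x) (F''.obj x)).cell) ≫ᵥ G.map (F.obj x) (F''.obj x) =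
    lunitInv _ ≫ᵥ hcompMap (α.app x ≫ᵥ G.map (F.obj x) (F'.obj x))
      (α'.app x ≫ᵥ G.map (F'.obj x) (F''.obj x)) (by simp) ≫ᵥ
      (Z.mul (G.obj (F.obj x)) (G.obj (F'.obj x)) (G.obj (F''.obj x))).cell
  rw [hcompMap_vcomp _ _ (by simp) _ _ (by simp), vcomp_assoc, vcomp_assoc, vcomp_assoc,
    G.map_mul]

theorem whisker_exchange {F F' : EFunctor X Y} {G G' : EFunctor Y Z} (α : ENatTrans F F')
    (β : ENatTrans G G') :
    (whiskerLeft F β).comp (whiskerRight α G') = (whiskerRight α G).comp (whiskerLeft F' β) := by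
  ext x
  change lunitInv _ ≫ᵥ hcompMap (hidMap (F.vert x) ≫ᵥ β.app (F.obj x))
      (α.app x ≫ᵥ G'.map (F.obj x) (F'.obj x)) (by simp) ≫ᵥ
      (Z.mul (G.obj (F.obj x)) (G'.obj (F.obj x)) (G'.obj (F'.obj x))).cell =
    lunitInv _ ≫ᵥ hcompMap (α.app x ≫ᵥ G.map (F.obj x) (F'.obj x))
      (hidMap (F'.vert x) ≫ᵥ β.app (F'.obj x)) (by simp) ≫ᵥ
      (Z.mul (G.obj (F.obj x)) (G.obj (F'.obj x)) (G'.obj (F'.obj x))).cell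
  have h1 := lunitInv_naturality (α.app x)
  have h2 := runitInv_naturality (α.app x)
  simp only [left_app, right_app] at h1 h2
  rw [hcompMap_vcomp _ _ (by simp) _ _ (by simp), hcompMap_vcomp _ _ (by simp) _ _ (by simp),
    vcomp_assoc, vcomp_assoc, vre h1, lunitInv_hid, vre h2, vcomp_assoc, vcomp_assoc,
    β.naturality (F.obj x) (F'.obj x)]

theorem heq_of {H H' K K' : EFunctor X Y} (α : ENatTrans H K) (β : ENatTrans H' K')
    (h₁ : H = H') (h₂ : K = K') (h₃ : ∀ x, HEq (α.app x) (β.app x)) : HEq α β := by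
  subst h₁ h₂
  exact heq_of_eq (ENatTrans.ext (funext fun x => eq_of_heq (h₃ x)))

end ENatTrans

instance : CategoryStruct (ECat.{v, u, u₁, h, c} D) where
  Hom X Y := EFunctor X Y
  id X := EFunctor.id X
  comp F G := EFunctor.comp F G

instance eCatHom (X Y : ECat.{v, u, u₁, h, c} D) : Category (X ⟶ Y) where
  Hom H K := ENatTrans (X := X) (Y := Y) H K
  id H := ENatTrans.id H
  comp α β := ENatTrans.comp α β
  id_comp α := ENatTrans.id_comp α
  comp_id α := ENatTrans.comp_id α
  assoc α β γ := ENatTrans.comp_assoc α β γ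

end Enriched

/-- A strict `2`-category, given with strictly associative and unital whiskering operations, as a
bicategory whose constraints are identities. -/
@[reducible]
def mkStrict (B : Type u) [CategoryStruct.{v} B] [∀ a b : B, Category.{w} (a ⟶ b)]
    (id_comp : ∀ {a b : B} (f : a ⟶ b), 𝟙 a ≫ f = f)
    (comp_id : ∀ {a b : B} (f : a ⟶ b), f ≫ 𝟙 b = f)
    (assoc : ∀ {a b c d : B} (f : a ⟶ b) (g : b ⟶ c) (h : c ⟶ d), (f ≫ g) ≫ h = f ≫ g ≫ h)
    (wl : ∀ {a b c : B} (f : a ⟶ b) {g h : b ⟶ c} (_ : g ⟶ h), f ≫ g ⟶ f ≫ h)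
    (wr : ∀ {a b c : B} {f g : a ⟶ b} (_ : f ⟶ g) (h : b ⟶ c), f ≫ h ⟶ g ≫ h)
    (wl_id : ∀ {a b c : B} (f : a ⟶ b) (g : b ⟶ c), wl f (𝟙 g) = 𝟙 (f ≫ g))
    (wl_comp : ∀ {a b c : B} (f : a ⟶ b) {g h i : b ⟶ c} (η : g ⟶ h) (θ : h ⟶ i),
      wl f (η ≫ θ) = wl f η ≫ wl f θ)
    (id_wr : ∀ {a b c : B} (f : a ⟶ b) (g : b ⟶ c), wr (𝟙 f) g = 𝟙 (f ≫ g))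
    (comp_wr : ∀ {a b c : B} {f g h : a ⟶ b} (η : f ⟶ g) (θ : g ⟶ h) (i : b ⟶ c),
      wr (η ≫ θ) i = wr η i ≫ wr θ i)
    (exchange : ∀ {a b c : B} {f g : a ⟶ b} {h i : b ⟶ c} (η : f ⟶ g) (θ : h ⟶ i),
      wl f θ ≫ wr η i = wr η h ≫ wl g θ)
    (id_wl : ∀ {a b : B} {f g : a ⟶ b} (η : f ⟶ g), HEq (wl (𝟙 a) η) η)
    (comp_wl : ∀ {a b c d : B} (f : a ⟶ b) (g : b ⟶ c) {h h' : c ⟶ d} (η : h ⟶ h'),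
      HEq (wl (f ≫ g) η) (wl f (wl g η)))
    (wr_id : ∀ {a b : B} {f g : a ⟶ b} (η : f ⟶ g), HEq (wr η (𝟙 b)) η)
    (wr_comp : ∀ {a b c d : B} {f f' : a ⟶ b} (η : f ⟶ f') (g : b ⟶ c) (h : c ⟶ d),
      HEq (wr η (g ≫ h)) (wr (wr η g) h))
    (wl_wr : ∀ {a b c d : B} (f : a ⟶ b) {g g' : b ⟶ c} (η : g ⟶ g') (h : c ⟶ d),
      HEq (wr (wl f η) h) (wl f (wr η h))) :
    Bicategory.{w, v} B where
  whiskerLeft f _ _ η := wl f η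
  whiskerRight η h := wr η h
  associator f g h := eqToIso (assoc f g h)
  leftUnitor f := eqToIso (id_comp f)
  rightUnitor f := eqToIso (comp_id f)
  whiskerLeft_id := wl_id
  whiskerLeft_comp f _ _ _ η θ := wl_comp f η θ
  id_whiskerLeft η := (conj_eqToHom_iff_heq _ _ (id_comp _) (id_comp _)).2 (id_wl η)
  comp_whiskerLeft f g _ _ η :=
    (conj_eqToHom_iff_heq _ _ (assoc _ _ _) (assoc _ _ _)).2 (comp_wl f g η)
  id_whiskerRight := id_wr
  comp_whiskerRight η θ i := comp_wr η θ i
  whiskerRight_id η := (conj_eqToHom_iff_heq _ _ (comp_id _) (comp_id _)).2 (wr_id η)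
  whiskerRight_comp η g h :=
    (conj_eqToHom_iff_heq _ _ (assoc _ _ _).symm (assoc _ _ _).symm).2 (wr_comp η g h)
  whisker_assoc f _ _ η h :=
    (conj_eqToHom_iff_heq _ _ (assoc _ _ _) (assoc _ _ _)).2 (wl_wr f η h)
  whisker_exchange η θ := exchange η θ
  pentagon f g h i := by
    have h1 : ∀ {a b c : B} {f g : a ⟶ b} (e : f = g) (k : b ⟶ c),
        wr (eqToHom e) k = eqToHom (by rw [e]) := by
      rintro a b c f _ rfl k; exact id_wr _ _
    have h2 : ∀ {a b c : B} {f g : b ⟶ c} (e : f = g) (k : a ⟶ b),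
        wl k (eqToHom e) = eqToHom (by rw [e]) := by
      rintro a b c f _ rfl k; exact wl_id _ _
    simp [h1, h2]
  triangle f g := by
    have h1 : ∀ {a b c : B} {f g : a ⟶ b} (e : f = g) (k : b ⟶ c),
        wr (eqToHom e) k = eqToHom (by rw [e]) := by
      rintro a b c f _ rfl k; exact id_wr _ _
    have h2 : ∀ {a b c : B} {f g : b ⟶ c} (e : f = g) (k : a ⟶ b),
        wl k (eqToHom e) = eqToHom (by rw [e]) := by
      rintro a b c f _ rfl k; exact wl_id _ _
    simp [h1, h2]

section
variable {D : Type u} [WeakDoubleCategory.{v, u, h, c} D]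

theorem eFunctor_id_comp {X Y : ECat.{v, u, u₁, h, c} D} (F : EFunctor X Y) :
    (EFunctor.id X).comp F = F :=
  EFunctor.ext' (fun _ => rfl) (fun x => by simp [EFunctor.comp, EFunctor.id])
    (fun x y => by simp [EFunctor.comp, EFunctor.id])

theorem eFunctor_comp_id {X Y : ECat.{v, u, u₁, h, c} D} (F : EFunctor X Y) :
    F.comp (EFunctor.id Y) = F :=
  EFunctor.ext' (fun _ => rfl) (fun x => by simp [EFunctor.comp, EFunctor.id])
    (fun x y => by simp [EFunctor.comp, EFunctor.id])

theorem eFunctor_assoc {X Y Z W : ECat.{v, u, u₁, h, c} D} (F : EFunctor X Y) (G : EFunctor Y Z)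
    (H : EFunctor Z W) : (F.comp G).comp H = F.comp (G.comp H) :=
  EFunctor.ext' (fun _ => rfl) (fun x => by simp [EFunctor.comp])
    (fun x y => by simp [EFunctor.comp])

section
variable {X Y Z W : ECat.{v, u, u₁, h, c} D}

theorem ENatTrans.id_whiskerLeft {H K : EFunctor X Y} (α : ENatTrans H K) :
    HEq (whiskerLeft (EFunctor.id X) α) α :=
  heq_of _ _ (eFunctor_id_comp _) (eFunctor_id_comp _) fun x => heq_of_eq (by
    change hidMap (𝟙 _) ≫ᵥ α.app x = α.app x
    simp)

theorem ENatTrans.comp_whiskerLeft (F : EFunctor X Y) (G : EFunctor Y Z) {H K : EFunctor Z W}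
    (α : ENatTrans H K) :
    HEq (whiskerLeft (F.comp G) α) (whiskerLeft F (whiskerLeft G α)) :=
  heq_of _ _ (eFunctor_assoc _ _ _) (eFunctor_assoc _ _ _) fun x => heq_of_eq (by
    change hidMap (F.vert x ≫ G.vert (F.obj x)) ≫ᵥ α.app (G.obj (F.obj x)) =
      hidMap (F.vert x) ≫ᵥ hidMap (G.vert (F.obj x)) ≫ᵥ α.app (G.obj (F.obj x))
    rw [hidMap_comp, vcomp_assoc])

theorem ENatTrans.whiskerRight_id {H K : EFunctor X Y} (α : ENatTrans H K) :
    HEq (whiskerRight α (EFunctor.id Y)) α :=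
  heq_of _ _ (eFunctor_comp_id _) (eFunctor_comp_id _) fun x => heq_of_eq (by
    change α.app x ≫ᵥ vid _ = α.app x
    simp)

theorem ENatTrans.whiskerRight_comp {H K : EFunctor X Y} (α : ENatTrans H K) (F : EFunctor Y Z)
    (G : EFunctor Z W) :
    HEq (whiskerRight α (F.comp G)) (whiskerRight (whiskerRight α F) G) :=
  heq_of _ _ (eFunctor_assoc _ _ _).symm (eFunctor_assoc _ _ _).symm fun _ => heq_of_eq
    (vcomp_assoc _ _ _).symm

theorem ENatTrans.whisker_assoc (F : EFunctor X Y) {H K : EFunctor Y Z} (α : ENatTrans H K)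
    (G : EFunctor Z W) :
    HEq (whiskerRight (whiskerLeft F α) G) (whiskerLeft F (whiskerRight α G)) :=
  heq_of _ _ (eFunctor_assoc _ _ _) (eFunctor_assoc _ _ _) fun _ => heq_of_eq
    (vcomp_assoc _ _ _)

end

/-- The (strict) `2`-category of `D`-enriched categories. -/
instance eCatBicategory : Bicategory (ECat.{v, u, u₁, h, c} D) :=
  mkStrict _ eFunctor_id_comp eFunctor_comp_id eFunctor_assoc
    (fun F _ _ β => ENatTrans.whiskerLeft F β) (fun α G => ENatTrans.whiskerRight α G)
    (fun F G => ENatTrans.whiskerLeft_id F G)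
    (fun F _ _ _ η θ => ENatTrans.whiskerLeft_comp F η θ)
    (fun F G => ENatTrans.id_whiskerRight F G)
    (fun η θ G => ENatTrans.comp_whiskerRight η θ G)
    (fun η θ => ENatTrans.whisker_exchange η θ)
    (fun η => ENatTrans.id_whiskerLeft η)
    (fun F G _ _ η => ENatTrans.comp_whiskerLeft F G η)
    (fun η => ENatTrans.whiskerRight_id η)
    (fun η G H => ENatTrans.whiskerRight_comp η G H)
    (fun F _ _ η H => ENatTrans.whisker_assoc F η H)

instance : Bicategory.Strict (ECat.{v, u, u₁, h, c} D) where
  id_comp := eFunctor_id_comp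
  comp_id := eFunctor_comp_id
  assoc := eFunctor_assoc
end
section Pasting
variable {B : Type u} [Bicategory.{w, v} B]

/-- Vertical pasting of squares. -/
def vc0 {a b c a' b' c' : B} {U : a ⟶ a'} {V : b ⟶ b'} {W : c ⟶ c'} {F : b ⟶ a} {G : b' ⟶ a'}
    {F' : c ⟶ b} {G' : c' ⟶ b'} (s : F ≫ U ⟶ V ≫ G) (t : F' ≫ V ⟶ W ≫ G') :
    (F' ≫ F) ≫ U ⟶ W ≫ G' ≫ G :=
  (α_ F' F U).hom ≫ F' ◁ s ≫ (α_ F' V G).inv ≫ t ▷ G ≫ (α_ W G' G).hom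

/-- Horizontal pasting of squares. -/
def hc0 {a b c a' b' c' : B} {U : a ⟶ b} {V : b ⟶ c} {U' : a' ⟶ b'} {V' : b' ⟶ c'} {F : a' ⟶ a}
    {G : b' ⟶ b} {H : c' ⟶ c} (s : F ≫ U ⟶ U' ≫ G) (t : G ≫ V ⟶ V' ≫ H) :
    F ≫ U ≫ V ⟶ (U' ≫ V') ≫ H :=
  (α_ F U V).inv ≫ s ▷ V ≫ (α_ U' G V).hom ≫ U' ◁ t ≫ (α_ U' V' H).inv

theorem vc0_assoc {a b c d a' b' c' d' : B} {U : a ⟶ a'} {V : b ⟶ b'} {W : c ⟶ c'} {X : d ⟶ d'}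
    {F : b ⟶ a} {G : b' ⟶ a'} {F' : c ⟶ b} {G' : c' ⟶ b'} {F'' : d ⟶ c} {G'' : d' ⟶ c'}
    (s : F ≫ U ⟶ V ≫ G) (t : F' ≫ V ⟶ W ≫ G') (r : F'' ≫ W ⟶ X ≫ G'') :
    (α_ F'' F' F).hom ▷ U ≫ vc0 (vc0 s t) r = vc0 s (vc0 t r) ≫ X ◁ (α_ G'' G' G).hom := by
  simp only [vc0]
  bicategory

theorem vc0_nat {a b c a' b' c' : B} {U : a ⟶ a'} {V : b ⟶ b'} {W : c ⟶ c'}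
    {F F₁ : b ⟶ a} {G G₁ : b' ⟶ a'}
    {F' F₁' : c ⟶ b} {G' G₁' : c' ⟶ b'} (s : F ≫ U ⟶ V ≫ G) (t : F' ≫ V ⟶ W ≫ G')
    (p : F₁ ⟶ F) (q : G ⟶ G₁) (p' : F₁' ⟶ F') (q' : G' ⟶ G₁') :
    vc0 (p ▷ U ≫ s ≫ V ◁ q) (p' ▷ V ≫ t ≫ W ◁ q') =
      (p' ▷ F₁ ≫ F' ◁ p) ▷ U ≫ vc0 s t ≫ W ◁ (G' ◁ q ≫ q' ▷ G₁) := by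
  simp only [vc0]
  calc
    _ = 𝟙 _ ⊗≫ (F₁' ◁ (p ▷ U ≫ s ≫ V ◁ q) ≫ p' ▷ (V ≫ G₁)) ⊗≫ t ▷ G₁ ⊗≫ W ◁ q' ▷ G₁ ⊗≫ 𝟙 _ := by
      bicategory
    _ = 𝟙 _ ⊗≫ (p' ▷ (F₁ ≫ U) ≫ F' ◁ (p ▷ U ≫ s ≫ V ◁ q)) ⊗≫ t ▷ G₁ ⊗≫ W ◁ q' ▷ G₁ ⊗≫ 𝟙 _ := by
      rw [whisker_exchange]
    _ = 𝟙 _ ⊗≫ p' ▷ F₁ ▷ U ⊗≫ F' ◁ (p ▷ U ≫ s) ⊗≫ ((F' ≫ V) ◁ q ≫ t ▷ G₁) ⊗≫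
        W ◁ q' ▷ G₁ ⊗≫ 𝟙 _ := by
      bicategory
    _ = 𝟙 _ ⊗≫ p' ▷ F₁ ▷ U ⊗≫ F' ◁ (p ▷ U ≫ s) ⊗≫ (t ▷ G ≫ (W ≫ G') ◁ q) ⊗≫
        W ◁ q' ▷ G₁ ⊗≫ 𝟙 _ := by
      rw [whisker_exchange]
    _ = _ := by bicategory

theorem hc0_vc0 {a b c a' b' c' a'' b'' c'' : B} {U : a ⟶ b} {V : b ⟶ c} {U' : a' ⟶ b'}
    {V' : b' ⟶ c'} {U'' : a'' ⟶ b''} {V'' : b'' ⟶ c''} {F : a' ⟶ a}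
    {G : b' ⟶ b} {H : c' ⟶ c} {F' : a'' ⟶ a'}
    {G' : b'' ⟶ b'} {H' : c'' ⟶ c'} (s : F ≫ U ⟶ U' ≫ G) (t : G ≫ V ⟶ V' ≫ H)
    (s' : F' ≫ U' ⟶ U'' ≫ G') (t' : G' ≫ V' ⟶ V'' ≫ H') :
    hc0 (vc0 s s') (vc0 t t') = vc0 (hc0 s t) (hc0 s' t') := by
  simp only [vc0, hc0]
  calc
    _ = 𝟙 _ ⊗≫ F' ◁ s ▷ V ⊗≫ (s' ▷ (G ≫ V) ≫ (U'' ≫ G') ◁ t) ⊗≫ U'' ◁ t' ▷ H ⊗≫ 𝟙 _ := by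
      bicategory
    _ = 𝟙 _ ⊗≫ F' ◁ s ▷ V ⊗≫ ((F' ≫ U') ◁ t ≫ s' ▷ (V' ≫ H)) ⊗≫ U'' ◁ t' ▷ H ⊗≫ 𝟙 _ := by
      rw [whisker_exchange]
    _ = _ := by bicategory

theorem hc0_assoc {a b c d a' b' c' d' : B} {U : a ⟶ b} {V : b ⟶ c} {W : c ⟶ d} {U' : a' ⟶ b'}
    {V' : b' ⟶ c'} {W' : c' ⟶ d'} {F : a' ⟶ a}
    {G : b' ⟶ b} {H : c' ⟶ c} {L : d' ⟶ d} (s : F ≫ U ⟶ U' ≫ G) (t : G ≫ V ⟶ V' ≫ H)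
    (r : H ≫ W ⟶ W' ≫ L) :
    hc0 (hc0 s t) r ≫ (α_ U' V' W').hom ▷ L = F ◁ (α_ U V W).hom ≫ hc0 s (hc0 t r) := by
  simp only [hc0]
  bicategory

theorem hc0_nat {a b c a' b' c' : B} {U : a ⟶ b} {V : b ⟶ c} {U' : a' ⟶ b'} {V' : b' ⟶ c'}
    {F F₁ : a' ⟶ a} {G G₁ : b' ⟶ b} {H H₁ : c' ⟶ c} (s : F ≫ U ⟶ U' ≫ G) (t : G₁ ≫ V ⟶ V' ≫ H)
    (p : F₁ ⟶ F) (q : G ⟶ G₁) (r : H ⟶ H₁) :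
    hc0 (p ▷ U ≫ s ≫ U' ◁ q) (t ≫ V' ◁ r) =
      p ▷ (U ≫ V) ≫ hc0 s (q ▷ V ≫ t) ≫ (U' ≫ V') ◁ r := by
  simp only [hc0]
  bicategory

/-- The square with identity vertical sides given by a `2`-cell. -/
def gl0 {a b : B} {U V : a ⟶ b} (φ : U ⟶ V) : 𝟙 a ≫ U ⟶ V ≫ 𝟙 b :=
  (λ_ U).hom ≫ φ ≫ (ρ_ V).inv

theorem gl0_vc0 {a b a' b' : B} {U U' : a ⟶ a'} {V : b ⟶ b'} {F : b ⟶ a} {G : b' ⟶ a'}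
    (φ : U ⟶ U') (t : F ≫ U' ⟶ V ≫ G) :
    vc0 (gl0 φ) t = (ρ_ F).hom ▷ U ≫ F ◁ φ ≫ t ≫ V ◁ (ρ_ G).inv := by
  simp only [vc0, gl0]
  calc
    _ = 𝟙 _ ⊗≫ F ◁ φ ⊗≫ t ⊗≫ 𝟙 _ := by bicategory
    _ = _ := by bicategory

theorem vc0_gl0 {a b a' b' : B} {U : a ⟶ a'} {V V' : b ⟶ b'} {F : b ⟶ a} {G : b' ⟶ a'}
    (φ : V ⟶ V') (t : F ≫ U ⟶ V ≫ G) :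
    vc0 t (gl0 φ) = (λ_ F).hom ▷ U ≫ t ≫ φ ▷ G ≫ V' ◁ (λ_ G).inv := by
  simp only [vc0, gl0]
  bicategory

theorem hc0_gl0 {a b c : B} {U U' : a ⟶ b} {V V' : b ⟶ c} (φ : U ⟶ U') (ψ : V ⟶ V') :
    hc0 (gl0 φ) (gl0 ψ) = gl0 (φ ▷ V ≫ U' ◁ ψ) := by
  simp only [hc0, gl0]
  bicategory

/-- The square on identity horizontal arrows. -/
def hid0 {a b : B} (F : b ⟶ a) : F ≫ 𝟙 a ⟶ 𝟙 b ≫ F := (ρ_ F).hom ≫ (λ_ F).inv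

theorem hid0_id (a : B) : hid0 (𝟙 a) = gl0 (𝟙 (𝟙 a)) := by
  simp only [hid0, gl0]
  bicategory

theorem hid0_comp {a b c : B} (F : b ⟶ a) (F' : c ⟶ b) :
    hid0 (F' ≫ F) = vc0 (hid0 F) (hid0 F') := by
  simp only [hid0, vc0]
  bicategory

theorem hid0_nat {a b : B} {F F' : b ⟶ a} (p : F ⟶ F') :
    p ▷ 𝟙 a ≫ hid0 F' = hid0 F ≫ 𝟙 b ◁ p := by
  simp only [hid0]
  bicategory

theorem hid0_hc0 {a b a' b' : B} {U : a ⟶ a'} {V : b ⟶ b'} {F : b ⟶ a} {G : b' ⟶ a'}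
    (t : F ≫ U ⟶ V ≫ G) :
    hc0 (hid0 F) t ≫ (λ_ V).hom ▷ G = F ◁ (λ_ U).hom ≫ t := by
  simp only [hid0, hc0]
  bicategory

theorem hc0_hid0 {a b a' b' : B} {U : a ⟶ a'} {V : b ⟶ b'} {F : b ⟶ a} {G : b' ⟶ a'}
    (t : F ≫ U ⟶ V ≫ G) :
    hc0 t (hid0 G) ≫ (ρ_ V).hom ▷ G = F ◁ (ρ_ U).hom ≫ t := by
  simp only [hid0, hc0]
  bicategory

end Pasting

/-- A functor `p : E ⥤ B` is a discrete fibration if each map `γ : b ⟶ p e` has a unique lift to a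
map with codomain `e`. -/
def IsDiscreteFibration {E : Type u} [Category.{v} E] {B : Type u'} [Category.{v'} B]
    (p : E ⥤ B) : Prop :=
  ∀ (e : E) (b : B) (γ : b ⟶ p.obj e),
    ∃! x : (e' : E) × (e' ⟶ e), (⟨p.obj x.1, p.map x.2⟩ : (b' : B) × (b' ⟶ p.obj e)) = ⟨b, γ⟩

section
variable {E : Type u} [Category.{v} E] {B : Type u'} [Category.{v'} B]

theorem isDiscreteFibration_iff (p : E ⥤ B) : IsDiscreteFibration p ↔ ∀ e : E,
    Function.Bijective (fun x : (e' : E) × (e' ⟶ e) =>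
      (⟨p.obj x.1, p.map x.2⟩ : (b' : B) × (b' ⟶ p.obj e))) := by
  simp only [Function.bijective_iff_existsUnique, Sigma.forall, IsDiscreteFibration]

theorem isDiscreteFibration_id : IsDiscreteFibration (𝟭 E) :=
  (isDiscreteFibration_iff _).2 fun _ => Function.bijective_id

theorem IsDiscreteFibration.comp {C : Type u₁} [Category.{w} C] {p : E ⥤ B} {q : B ⥤ C}
    (hp : IsDiscreteFibration p) (hq : IsDiscreteFibration q) : IsDiscreteFibration (p ⋙ q) :=
  (isDiscreteFibration_iff _).2 fun e => by
    have := ((isDiscreteFibration_iff q).1 hq (p.obj e)).comp ((isDiscreteFibration_iff p).1 hp e)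
    exact this

end

/-- A `1`-cell `f` of a `2`-category `K` is a discrete fibration if each `K(X, f)` is one. -/
def IsDiscFib {K : Type u} [Bicategory.{w, v} K] {A B : K} (f : A ⟶ B) : Prop :=
  ∀ X : K, IsDiscreteFibration (postcomp X f)

section
variable {K : Type u} [Bicategory.{w, v} K] [Bicategory.Strict K]

theorem isDiscFib_id (A : K) : IsDiscFib (𝟙 A) := fun X => by
  have : postcomp X (𝟙 A) = 𝟭 _ :=
    CategoryTheory.Functor.ext (fun f => Bicategory.Strict.comp_id f) (fun f g η => by
      simp [Bicategory.Strict.rightUnitor_eqToIso]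
      rfl)
  rw [this]
  exact isDiscreteFibration_id

theorem IsDiscFib.comp {A B C : K} {f : A ⟶ B} {g : B ⟶ C} (hf : IsDiscFib f) (hg : IsDiscFib g) :
    IsDiscFib (f ≫ g) := fun X => by
  have : postcomp X (f ≫ g) = postcomp X f ⋙ postcomp X g :=
    CategoryTheory.Functor.ext (fun h => (Bicategory.Strict.assoc h f g).symm) (fun h k η => by
      simp [Bicategory.Strict.associator_eqToIso]
      rfl)
  rw [this]
  exact (hf X).comp (hg X)

end

section PseudoPasting
variable {K : Type u} [Bicategory.{w, v} K] {B : Type u'} [Bicategory.{w', v'} B]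
  (Y : Pseudofunctor K B)

/-- Vertical pasting of squares whose vertical sides are in the image of `Y`. -/
def vcY {a b c a' b' c' : K} {U : Y.obj a ⟶ Y.obj a'} {V : Y.obj b ⟶ Y.obj b'}
    {W : Y.obj c ⟶ Y.obj c'} {f : b ⟶ a} {g : b' ⟶ a'} {f' : c ⟶ b} {g' : c' ⟶ b'}
    (s : Y.map f ≫ U ⟶ V ≫ Y.map g) (t : Y.map f' ≫ V ⟶ W ≫ Y.map g') :
    Y.map (f' ≫ f) ≫ U ⟶ W ≫ Y.map (g' ≫ g) :=
  (Y.mapComp f' f).hom ▷ U ≫ vc0 s t ≫ W ◁ (Y.mapComp g' g).inv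

/-- The square with identity vertical sides given by a `2`-cell. -/
def glY {a b : K} {U V : Y.obj a ⟶ Y.obj b} (φ : U ⟶ V) :
    Y.map (𝟙 a) ≫ U ⟶ V ≫ Y.map (𝟙 b) :=
  (Y.mapId a).hom ▷ U ≫ gl0 φ ≫ V ◁ (Y.mapId b).inv

theorem vcY_assoc {a b c d a' b' c' d' : K} {U : Y.obj a ⟶ Y.obj a'} {V : Y.obj b ⟶ Y.obj b'}
    {W : Y.obj c ⟶ Y.obj c'} {X : Y.obj d ⟶ Y.obj d'} {f : b ⟶ a} {g : b' ⟶ a'} {f' : c ⟶ b}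
    {g' : c' ⟶ b'} {f'' : d ⟶ c} {g'' : d' ⟶ c'}
    (s : Y.map f ≫ U ⟶ V ≫ Y.map g) (t : Y.map f' ≫ V ⟶ W ≫ Y.map g')
    (r : Y.map f'' ≫ W ⟶ X ≫ Y.map g'') :
    Y.map₂ (α_ f'' f' f).hom ▷ U ≫ vcY Y (vcY Y s t) r =
      vcY Y s (vcY Y t r) ≫ X ◁ Y.map₂ (α_ g'' g' g).hom := by
  have h1 : vcY Y (vcY Y s t) r = ((Y.mapComp f'' (f' ≫ f)).hom ≫
      Y.map f'' ◁ (Y.mapComp f' f).hom) ▷ U ≫ vc0 (vc0 s t) r ≫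
      X ◁ (Y.map g'' ◁ (Y.mapComp g' g).inv ≫ (Y.mapComp g'' (g' ≫ g)).inv) := by
    have := vc0_nat (vc0 s t) r (Y.mapComp f' f).hom (Y.mapComp g' g).inv (𝟙 _) (𝟙 _)
    simp only [id_whiskerRight, whiskerLeft_id, Category.id_comp, Category.comp_id] at this
    simp only [vcY, this, comp_whiskerRight, whiskerLeft_comp, Category.assoc]
  have h2 : vcY Y s (vcY Y t r) = ((Y.mapComp (f'' ≫ f') f).hom ≫
      (Y.mapComp f'' f').hom ▷ Y.map f) ▷ U ≫ vc0 s (vc0 t r) ≫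
      X ◁ ((Y.mapComp g'' g').inv ▷ Y.map g ≫ (Y.mapComp (g'' ≫ g') g).inv) := by
    have := vc0_nat s (vc0 t r) (𝟙 _) (𝟙 _) (Y.mapComp f'' f').hom (Y.mapComp g'' g').inv
    simp only [id_whiskerRight, whiskerLeft_id, Category.id_comp, Category.comp_id] at this
    simp only [vcY, this, comp_whiskerRight, whiskerLeft_comp, Category.assoc]
  have h3 := vc0_assoc s t r
  rw [h1, h2, Y.mapComp_assoc_right_hom, Y.mapComp_assoc_right_inv]
  rw [← comp_whiskerRight_assoc, ← Category.assoc (Y.map₂ _), ← Y.map₂_comp, Iso.hom_inv_id,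
    Y.map₂_id, Category.id_comp]
  simp only [comp_whiskerRight, whiskerLeft_comp, Category.assoc]
  rw [reassoc_of% h3, ← whiskerLeft_comp_assoc X (α_ _ _ _).hom, Iso.hom_inv_id]
  simp

theorem glY_vcY {a b a' b' : K} {U U' : Y.obj a ⟶ Y.obj a'} {V : Y.obj b ⟶ Y.obj b'}
    {f : b ⟶ a} {g : b' ⟶ a'} (φ : U ⟶ U') (t : Y.map f ≫ U' ⟶ V ≫ Y.map g) :
    vcY Y (glY Y φ) t ≫ V ◁ Y.map₂ (ρ_ g).hom =
      Y.map₂ (ρ_ f).hom ▷ U ≫ Y.map f ◁ φ ≫ t := by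
  have := vc0_nat (gl0 φ) t (Y.mapId a).hom (Y.mapId a').inv (𝟙 _) (𝟙 _)
  simp only [id_whiskerRight, whiskerLeft_id, Category.id_comp, Category.comp_id] at this
  simp only [vcY, glY, this, gl0_vc0, Y.map₂_right_unitor, comp_whiskerRight, whiskerLeft_comp,
    Category.assoc]
  simp only [← whiskerLeft_comp, Iso.inv_hom_id_assoc]
  simp

theorem vcY_glY {a b a' b' : K} {U : Y.obj a ⟶ Y.obj a'} {V V' : Y.obj b ⟶ Y.obj b'}
    {f : b ⟶ a} {g : b' ⟶ a'} (φ : V ⟶ V') (t : Y.map f ≫ U ⟶ V ≫ Y.map g) :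
    vcY Y t (glY Y φ) ≫ V' ◁ Y.map₂ (λ_ g).hom =
      Y.map₂ (λ_ f).hom ▷ U ≫ t ≫ φ ▷ Y.map g := by
  have := vc0_nat t (gl0 φ) (𝟙 _) (𝟙 _) (Y.mapId b).hom (Y.mapId b').inv
  simp only [id_whiskerRight, whiskerLeft_id, Category.id_comp, Category.comp_id] at this
  simp only [vcY, glY, this, vc0_gl0, Y.map₂_left_unitor, comp_whiskerRight, whiskerLeft_comp,
    Category.assoc]
  simp only [← whiskerLeft_comp, Iso.inv_hom_id_assoc]
  simp

theorem hc0_vcY {a b c a' b' c' a'' b'' c'' : K} {U : Y.obj a ⟶ Y.obj b} {V : Y.obj b ⟶ Y.obj c}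
    {U' : Y.obj a' ⟶ Y.obj b'} {V' : Y.obj b' ⟶ Y.obj c'} {U'' : Y.obj a'' ⟶ Y.obj b''}
    {V'' : Y.obj b'' ⟶ Y.obj c''} {f : a' ⟶ a} {g : b' ⟶ b} {k : c' ⟶ c} {f' : a'' ⟶ a'}
    {g' : b'' ⟶ b'} {k' : c'' ⟶ c'} (s : Y.map f ≫ U ⟶ U' ≫ Y.map g)
    (t : Y.map g ≫ V ⟶ V' ≫ Y.map k) (s' : Y.map f' ≫ U' ⟶ U'' ≫ Y.map g')
    (t' : Y.map g' ≫ V' ⟶ V'' ≫ Y.map k') :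
    hc0 (vcY Y s s') (vcY Y t t') = vcY Y (hc0 s t) (hc0 s' t') := by
  have := hc0_nat (vc0 s s') ((Y.mapComp g' g).hom ▷ V ≫ vc0 t t') (Y.mapComp f' f).hom
    (Y.mapComp g' g).inv (Y.mapComp k' k).inv
  simp only [Category.assoc] at this
  simp only [vcY, this]
  rw [← comp_whiskerRight_assoc (Y.mapComp g' g).inv, Iso.inv_hom_id, id_whiskerRight,
    Category.id_comp, hc0_vc0]

theorem hc0_glY {a b c : K} {U U' : Y.obj a ⟶ Y.obj b} {V V' : Y.obj b ⟶ Y.obj c}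
    (φ : U ⟶ U') (ψ : V ⟶ V') :
    hc0 (glY Y φ) (glY Y ψ) = glY Y (φ ▷ V ≫ U' ◁ ψ) := by
  have := hc0_nat (gl0 φ) ((Y.mapId b).hom ▷ V ≫ gl0 ψ) (Y.mapId a).hom
    (Y.mapId b).inv (Y.mapId c).inv
  simp only [Category.assoc] at this
  simp only [glY, this]
  rw [← comp_whiskerRight_assoc (Y.mapId b).inv, Iso.inv_hom_id, id_whiskerRight,
    Category.id_comp, hc0_gl0]

theorem hid0_glY (a : K) : hid0 (Y.map (𝟙 a)) = glY Y (𝟙 (𝟙 (Y.obj a))) := by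
  have := hid0_nat (Y.mapId a).hom
  rw [glY, ← hid0_id, reassoc_of% this, ← whiskerLeft_comp, Iso.hom_inv_id]
  simp

theorem hid0_vcY {a b c : K} (f : b ⟶ a) (f' : c ⟶ b) :
    hid0 (Y.map (f' ≫ f)) = vcY Y (hid0 (Y.map f)) (hid0 (Y.map f')) := by
  have := hid0_nat (Y.mapComp f' f).hom
  rw [vcY, ← hid0_comp, reassoc_of% this, ← whiskerLeft_comp, Iso.hom_inv_id]
  simp

end PseudoPasting

/-- The objects of the weak double category `ℙK` are those of `K`. -/
structure DblPsh (K : Type u) where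
  of ::
  as : K

section
variable {K : Type u} [Bicategory.{w, v} K] [Bicategory.Strict K]

/-- A vertical morphism `A ⟶ B` is a discrete fibration `B ⟶ A` in `K`. -/
instance : Category.{v} (DblPsh K) where
  Hom A B := { f : B.as ⟶ A.as // IsDiscFib f }
  id A := ⟨𝟙 A.as, isDiscFib_id _⟩
  comp f g := ⟨g.1 ≫ f.1, g.2.comp f.2⟩
  id_comp f := Subtype.ext (Bicategory.Strict.comp_id f.1)
  comp_id f := Subtype.ext (Bicategory.Strict.id_comp f.1)
  assoc f g h := Subtype.ext (Bicategory.Strict.assoc h.1 g.1 f.1).symm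

variable {B : Type u'} [Bicategory.{w', v'} B] (Y : Pseudofunctor K B)

/-- Squares in `B` whose vertical sides are images under `Y` of discrete fibrations, with arbitrary
horizontal sides. -/
structure PCell {A A' C C' : DblPsh K} (U : Y.obj A.as ⟶ Y.obj C.as)
    (V : Y.obj A'.as ⟶ Y.obj C'.as) where
  left : A ⟶ A'
  right : C ⟶ C'
  cell : Y.map left.1 ≫ U ⟶ V ≫ Y.map right.1

namespace PCell
variable {Y}
variable {A A' A'' A₃ C C' C'' C₃ E E' E'' F : DblPsh K}

theorem ext_of {U : Y.obj A.as ⟶ Y.obj C.as} {V : Y.obj A'.as ⟶ Y.obj C'.as}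
    {α β : PCell Y U V} (p : α.left.1 = β.left.1) (q : α.right.1 = β.right.1)
    (e : Y.map₂ (eqToHom p) ▷ U ≫ β.cell = α.cell ≫ V ◁ Y.map₂ (eqToHom q)) : α = β := by
  obtain ⟨⟨l, _⟩, ⟨r, _⟩, s⟩ := α
  obtain ⟨⟨l', _⟩, ⟨r', _⟩, s'⟩ := β
  dsimp only at p q
  subst p q
  have : s' = s := by simpa using e
  subst this
  rfl

def glob {U V : Y.obj A.as ⟶ Y.obj C.as} (φ : U ⟶ V) : PCell Y U V where
  left := 𝟙 A
  right := 𝟙 C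
  cell := glY Y φ

def vcomp {U : Y.obj A.as ⟶ Y.obj C.as} {V : Y.obj A'.as ⟶ Y.obj C'.as}
    {W : Y.obj A''.as ⟶ Y.obj C''.as} (α : PCell Y U V) (β : PCell Y V W) : PCell Y U W where
  left := α.left ≫ β.left
  right := α.right ≫ β.right
  cell := vcY Y α.cell β.cell

def hidMap (f : A ⟶ A') : PCell Y (𝟙 (Y.obj A.as)) (𝟙 (Y.obj A'.as)) where
  left := f
  right := f
  cell := hid0 (Y.map f.1)

def hcompMap {U : Y.obj A.as ⟶ Y.obj C.as} {V : Y.obj C.as ⟶ Y.obj E.as}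
    {U' : Y.obj A'.as ⟶ Y.obj C'.as} {V' : Y.obj C'.as ⟶ Y.obj E'.as}
    (α : PCell Y U U') (β : PCell Y V V') (e : α.right = β.left) :
    PCell Y (U ≫ V) (U' ≫ V') where
  left := α.left
  right := β.right
  cell := hc0 α.cell (eqToHom (by rw [e]) ≫ β.cell)

theorem vcomp_assoc {U : Y.obj A.as ⟶ Y.obj C.as} {V : Y.obj A'.as ⟶ Y.obj C'.as}
    {W : Y.obj A''.as ⟶ Y.obj C''.as} {X : Y.obj A₃.as ⟶ Y.obj C₃.as} (α : PCell Y U V)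
    (β : PCell Y V W) (γ : PCell Y W X) :
    (α.vcomp β).vcomp γ = α.vcomp (β.vcomp γ) := by
  refine (ext_of ?_ ?_ ?_).symm
  · exact Bicategory.Strict.assoc γ.left.1 β.left.1 α.left.1
  · exact Bicategory.Strict.assoc γ.right.1 β.right.1 α.right.1
  · have := vcY_assoc Y α.cell β.cell γ.cell
    simp only [Bicategory.Strict.associator_eqToIso, eqToIso.hom] at this
    exact this

theorem glob_vcomp {U U' : Y.obj A.as ⟶ Y.obj C.as} {V : Y.obj A'.as ⟶ Y.obj C'.as} (φ : U ⟶ U')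
    (t : PCell Y U' V) :
    (glob φ).vcomp t = ⟨t.left, t.right, Y.map t.left.1 ◁ φ ≫ t.cell⟩ := by
  refine ext_of ?_ ?_ ?_
  · exact Bicategory.Strict.comp_id t.left.1
  · exact Bicategory.Strict.comp_id t.right.1
  · have := glY_vcY Y φ t.cell
    simp only [Bicategory.Strict.rightUnitor_eqToIso, eqToIso.hom] at this
    exact this.symm

theorem vcomp_glob {U : Y.obj A.as ⟶ Y.obj C.as} {V V' : Y.obj A'.as ⟶ Y.obj C'.as} (φ : V ⟶ V')
    (t : PCell Y U V) :
    t.vcomp (glob φ) = ⟨t.left, t.right, t.cell ≫ φ ▷ Y.map t.right.1⟩ := by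
  refine ext_of ?_ ?_ ?_
  · exact Bicategory.Strict.id_comp t.left.1
  · exact Bicategory.Strict.id_comp t.right.1
  · have := vcY_glY Y φ t.cell
    simp only [Bicategory.Strict.leftUnitor_eqToIso, eqToIso.hom] at this
    exact this.symm

theorem mk_congr {U : Y.obj A.as ⟶ Y.obj C.as} {V : Y.obj A'.as ⟶ Y.obj C'.as} {f : A ⟶ A'}
    {g : C ⟶ C'} {s t : Y.map f.1 ≫ U ⟶ V ≫ Y.map g.1} (e : s = t) :
    (⟨f, g, s⟩ : PCell Y U V) = ⟨f, g, t⟩ := by rw [e]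

theorem glob_vcomp_glob {U V W : Y.obj A.as ⟶ Y.obj C.as} (φ : U ⟶ V) (ψ : V ⟶ W) :
    (glob φ).vcomp (glob ψ) = glob (φ ≫ ψ) := by
  rw [glob_vcomp]
  refine mk_congr ?_
  change Y.map (𝟙 A.as) ◁ φ ≫ (Y.mapId A.as).hom ▷ V ≫ ((λ_ V).hom ≫ ψ ≫ (ρ_ W).inv) ≫
      W ◁ (Y.mapId C.as).inv =
    (Y.mapId A.as).hom ▷ U ≫ ((λ_ U).hom ≫ (φ ≫ ψ) ≫ (ρ_ W).inv) ≫ W ◁ (Y.mapId C.as).inv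
  rw [whisker_exchange_assoc]
  simp

theorem hcompMap_glob {U U' : Y.obj A.as ⟶ Y.obj C.as} {V V' : Y.obj C.as ⟶ Y.obj E.as}
    (φ : U ⟶ U') (ψ : V ⟶ V') :
    hcompMap (glob φ) (glob ψ) rfl = glob (φ ▷ V ≫ U' ◁ ψ) := by
  refine mk_congr ?_
  refine Eq.trans ?_ (hc0_glY Y φ ψ)
  exact congrArg (hc0 _) (Category.id_comp _)

theorem hcompMap_mk {U : Y.obj A.as ⟶ Y.obj C.as} {V : Y.obj C.as ⟶ Y.obj E.as}
    {U' : Y.obj A'.as ⟶ Y.obj C'.as} {V' : Y.obj C'.as ⟶ Y.obj E'.as}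
    {f : A ⟶ A'} {g : C ⟶ C'} {k : E ⟶ E'} (s : Y.map f.1 ≫ U ⟶ U' ≫ Y.map g.1)
    (t : Y.map g.1 ≫ V ⟶ V' ≫ Y.map k.1) :
    hcompMap (⟨f, g, s⟩ : PCell Y U U') (⟨g, k, t⟩ : PCell Y V V') rfl = ⟨f, k, hc0 s t⟩ :=
  mk_congr (congrArg (hc0 _) (Category.id_comp _))

theorem hcompMap_vcomp {U : Y.obj A.as ⟶ Y.obj C.as} {V : Y.obj C.as ⟶ Y.obj E.as}
    {U' : Y.obj A'.as ⟶ Y.obj C'.as} {V' : Y.obj C'.as ⟶ Y.obj E'.as}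
    {U'' : Y.obj A''.as ⟶ Y.obj C''.as} {V'' : Y.obj C''.as ⟶ Y.obj E''.as}
    (α : PCell Y U U') (β : PCell Y V V') (e : α.right = β.left)
    (α' : PCell Y U' U'') (β' : PCell Y V' V'') (e' : α'.right = β'.left)
    (e'' : (α.vcomp α').right = (β.vcomp β').left) :
    hcompMap (α.vcomp α') (β.vcomp β') e'' = (hcompMap α β e).vcomp (hcompMap α' β' e') := by
  obtain ⟨f, g, s⟩ := α
  obtain ⟨g₁, k, t⟩ := β
  obtain ⟨f', g', s'⟩ := α'
  obtain ⟨g₁', k', t'⟩ := β'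
  dsimp only at e e'
  subst e e'
  rw [hcompMap_mk, hcompMap_mk]
  refine (hcompMap_mk _ _).trans ?_
  exact mk_congr (hc0_vcY Y s t s' t')

theorem hassoc_naturality {U : Y.obj A.as ⟶ Y.obj C.as} {V : Y.obj C.as ⟶ Y.obj E.as}
    {W : Y.obj E.as ⟶ Y.obj F.as} {F' : DblPsh K}
    {U' : Y.obj A'.as ⟶ Y.obj C'.as} {V' : Y.obj C'.as ⟶ Y.obj E'.as}
    {W' : Y.obj E'.as ⟶ Y.obj F'.as}
    (α : PCell Y U U') (β : PCell Y V V') (γ : PCell Y W W') (e : α.right = β.left)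
    (e' : β.right = γ.left) :
    (hcompMap (hcompMap α β e) γ e').vcomp (glob (α_ U' V' W').hom) =
      (glob (α_ U V W).hom).vcomp (hcompMap α (hcompMap β γ e') e) := by
  obtain ⟨f, g, s⟩ := α
  obtain ⟨g₁, k, t⟩ := β
  obtain ⟨k₁, l, r⟩ := γ
  dsimp only at e e'
  subst e e'
  simp only [hcompMap_mk]
  rw [vcomp_glob, glob_vcomp]
  exact mk_congr (hc0_assoc s t r)

theorem lunit_naturality {U : Y.obj A.as ⟶ Y.obj C.as} {U' : Y.obj A'.as ⟶ Y.obj C'.as}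
    (α : PCell Y U U') :
    (hcompMap (hidMap α.left) α rfl).vcomp (glob (λ_ U').hom) =
      (glob (λ_ U).hom).vcomp α := by
  obtain ⟨f, g, s⟩ := α
  dsimp only [hidMap]
  rw [hcompMap_mk, vcomp_glob, glob_vcomp]
  exact mk_congr (hid0_hc0 s)

theorem runit_naturality {U : Y.obj A.as ⟶ Y.obj C.as} {U' : Y.obj A'.as ⟶ Y.obj C'.as}
    (α : PCell Y U U') :
    (hcompMap α (hidMap α.right) rfl).vcomp (glob (ρ_ U').hom) =
      (glob (ρ_ U).hom).vcomp α := by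
  obtain ⟨f, g, s⟩ := α
  dsimp only [hidMap]
  rw [hcompMap_mk, vcomp_glob, glob_vcomp]
  exact mk_congr (hc0_hid0 s)

end PCell

open PCell in
/-- The weak double category with objects those of `K`, vertical morphisms the discrete fibrations
of `K` reversed, horizontal arrows those of `B` between objects in the image of `Y`, and cells the
squares in `B` with vertical sides in the image of `Y`, composed by pasting. -/
@[reducible]
def squares : WeakDoubleCategory.{v, u, v', max v w'} (DblPsh K) where
  Hor A C := Y.obj A.as ⟶ Y.obj C.as
  Cell U V := PCell Y U V
  left α := α.left
  right α := α.right
  vid U := glob (𝟙 U)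
  vcomp α β := α.vcomp β
  left_vid _ := rfl
  right_vid _ := rfl
  left_vcomp _ _ := rfl
  right_vcomp _ _ := rfl
  vid_vcomp α := by
    refine (glob_vcomp _ α).trans ?_
    exact mk_congr (by simp)
  vcomp_vid α := by
    refine (vcomp_glob _ α).trans ?_
    exact mk_congr (by simp)
  vcomp_assoc α β γ := PCell.vcomp_assoc α β γ
  hid A := 𝟙 (Y.obj A.as)
  hidMap f := hidMap f
  left_hidMap _ := rfl
  right_hidMap _ := rfl
  hidMap_id A := mk_congr (hid0_glY Y A.as)
  hidMap_comp f g := mk_congr (hid0_vcY Y f.1 g.1)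
  hcomp U V := U ≫ V
  hcompMap α β e := hcompMap α β e
  left_hcompMap _ _ _ := rfl
  right_hcompMap _ _ _ := rfl
  hcompMap_vid U V := (hcompMap_glob _ _).trans (by simp)
  hcompMap_vcomp α β e α' β' e' := PCell.hcompMap_vcomp α β e α' β' e' _
  hassoc U V W := glob (α_ U V W).hom
  hassocInv U V W := glob (α_ U V W).inv
  left_hassoc _ _ _ := rfl
  right_hassoc _ _ _ := rfl
  hassoc_hassocInv U V W := (glob_vcomp_glob _ _).trans (by simp)
  hassocInv_hassoc U V W := (glob_vcomp_glob _ _).trans (by simp)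
  hassoc_naturality α β γ e e' := PCell.hassoc_naturality α β γ e e'
  lunit U := glob (λ_ U).hom
  lunitInv U := glob (λ_ U).inv
  left_lunit _ := rfl
  right_lunit _ := rfl
  lunit_lunitInv U := (glob_vcomp_glob _ _).trans (by simp)
  lunitInv_lunit U := (glob_vcomp_glob _ _).trans (by simp)
  lunit_naturality α := PCell.lunit_naturality α
  runit U := glob (ρ_ U).hom
  runitInv U := glob (ρ_ U).inv
  left_runit _ := rfl
  right_runit _ := rfl
  runit_runitInv U := (glob_vcomp_glob _ _).trans (by simp)
  runitInv_runit U := (glob_vcomp_glob _ _).trans (by simp)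
  runit_naturality α := PCell.runit_naturality α
  pentagon U V W X := by
    rw [hcompMap_glob, hcompMap_glob, glob_vcomp_glob, glob_vcomp_glob, glob_vcomp_glob]
    simp
  triangle U V := by
    rw [hcompMap_glob, hcompMap_glob, glob_vcomp_glob]
    simp

end

/-- The weak double category `ℙK`: its horizontal arrows and cells are those of `𝒫K`, and the
vertical sides of its cells are the images under the Yoneda embedding of discrete fibrations. -/
instance (K : Type u) [Bicategory.{w, w} K] [Bicategory.Strict K] :
    WeakDoubleCategory.{w, u, w + 1, w} (DblPsh K) :=
  squares (yonedaHom K)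

section StrictLemmas
variable {B : Type u₁} [Bicategory.{w₁, v₁} B] [Bicategory.Strict B]

theorem heq_of_conj {C : Type u} [Category.{v} C] {a b a' b' : C} {x : a ⟶ b} {y : a' ⟶ b'}
    (p : a = a') (q : b' = b) (e : x = eqToHom p ≫ y ≫ eqToHom q) : HEq x y := by
  subst p q
  exact heq_of_eq (by simpa using e)

theorem whiskerRight_heq {a b d : B} {f f' g g' : a ⟶ b} {η : f ⟶ g} {η' : f' ⟶ g'}
    (hf : f = f') (hg : g = g') (e : HEq η η') (k : b ⟶ d) : HEq (η ▷ k) (η' ▷ k) := by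
  subst hf hg; rw [eq_of_heq e]

theorem whiskerLeft_heq {a b d : B} {f f' g g' : b ⟶ d} {η : f ⟶ g} {η' : f' ⟶ g'}
    (hf : f = f') (hg : g = g') (e : HEq η η') (k : a ⟶ b) : HEq (k ◁ η) (k ◁ η') := by
  subst hf hg; rw [eq_of_heq e]

theorem whiskerRight_id_heq {a b : B} {f g : a ⟶ b} (η : f ⟶ g) : HEq (η ▷ 𝟙 b) η :=
  heq_of_conj (Bicategory.Strict.comp_id f) (Bicategory.Strict.comp_id g).symm
    (by simp [Bicategory.Strict.rightUnitor_eqToIso])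

theorem id_whiskerLeft_heq {a b : B} {f g : a ⟶ b} (η : f ⟶ g) : HEq (𝟙 a ◁ η) η :=
  heq_of_conj (Bicategory.Strict.id_comp f) (Bicategory.Strict.id_comp g).symm
    (by simp [Bicategory.Strict.leftUnitor_eqToIso])

theorem whiskerRight_comp_heq {a b c d : B} {f g : a ⟶ b} (η : f ⟶ g) (k : b ⟶ c) (l : c ⟶ d) :
    HEq (η ▷ (k ≫ l)) (η ▷ k ▷ l) :=
  heq_of_conj (Bicategory.Strict.assoc f k l).symm (Bicategory.Strict.assoc g k l)
    (by simp [Bicategory.Strict.associator_eqToIso])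

theorem comp_whiskerLeft_heq {a b c d : B} (k : a ⟶ b) (l : b ⟶ c) {f g : c ⟶ d} (η : f ⟶ g) :
    HEq ((k ≫ l) ◁ η) (k ◁ l ◁ η) :=
  heq_of_conj (Bicategory.Strict.assoc k l f) (Bicategory.Strict.assoc k l g).symm
    (by simp [Bicategory.Strict.associator_eqToIso])

theorem whisker_assoc_heq {a b c d : B} (k : a ⟶ b) {f g : b ⟶ c} (η : f ⟶ g) (l : c ⟶ d) :
    HEq ((k ◁ η) ▷ l) (k ◁ η ▷ l) :=
  heq_of_conj (Bicategory.Strict.assoc k f l) (Bicategory.Strict.assoc k g l).symm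
    (by simp [Bicategory.Strict.associator_eqToIso])

end StrictLemmas

section Functors
variable {A : Type u₁} [Bicategory.{w₁, v₁} A] {B : Type u₂} [Bicategory.{w₂, v₂} B]
  {C : Type u₃} [Bicategory.{w₃, v₃} C]

theorem strictPseudofunctor_ext {F G : StrictPseudofunctor A B}
    (e : F.toPrelaxFunctor = G.toPrelaxFunctor) : F = G := by
  obtain ⟨⟨⟨F, mi, mc, _, _, _, _, _⟩, i, hi⟩, c, hc⟩ := F
  obtain ⟨⟨⟨G, mi', mc', _, _, _, _, _⟩, i', hi'⟩, c', hc'⟩ := G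
  dsimp only at e hi hi' hc hc'
  subst e
  obtain rfl : mi = mi' := funext fun x => (hi x).trans (hi' x).symm
  obtain rfl : @mc = @mc' := by
    funext x y z f g
    exact (hc f g).trans (hc' f g).symm
  rfl

theorem map₂_heq (F : StrictPseudofunctor A B) {a b : A} {f f' g g' : a ⟶ b} {η : f ⟶ g}
    {η' : f' ⟶ g'} (hf : f = f') (hg : g = g') (e : HEq η η') : HEq (F.map₂ η) (F.map₂ η') := by
  subst hf hg; rw [eq_of_heq e]

theorem map₂_whiskerRight_heq (F : StrictPseudofunctor A B) {a b c : A} {f g : a ⟶ b} (η : f ⟶ g)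
    (k : b ⟶ c) : HEq (F.map₂ (η ▷ k)) (F.map₂ η ▷ F.map k) :=
  heq_of_conj (F.map_comp f k) (F.map_comp g k).symm
    (by simp [F.map₂_whisker_right, F.mapComp_eq_eqToIso])

theorem map₂_whiskerLeft_heq (F : StrictPseudofunctor A B) {a b c : A} (k : a ⟶ b) {f g : b ⟶ c}
    (η : f ⟶ g) : HEq (F.map₂ (k ◁ η)) (F.map k ◁ F.map₂ η) :=
  heq_of_conj (F.map_comp k f) (F.map_comp k g).symm
    (by simp [F.map₂_whisker_left, F.mapComp_eq_eqToIso])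

end Functors

/-- A (strict) `2`-natural transformation between `2`-functors. The two whiskered `2`-cells in
`naturality₂` have types that agree by `naturality`. -/
@[ext]
structure TwoNat {A : Type u₁} [Bicategory.{w₁, v₁} A] {B : Type u₂} [Bicategory.{w₂, v₂} B]
    (F G : StrictPseudofunctor A B) where
  app (a : A) : F.obj a ⟶ G.obj a
  naturality {a b : A} (f : a ⟶ b) : F.map f ≫ app b = app a ≫ G.map f
  naturality₂ {a b : A} {f g : a ⟶ b} (η : f ⟶ g) : HEq (F.map₂ η ▷ app b) (app a ◁ G.map₂ η)

namespace TwoNat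
section
variable {A : Type u₁} [Bicategory.{w₁, v₁} A] {B : Type u₂} [Bicategory.{w₂, v₂} B]
  [Bicategory.Strict B]

def id (F : StrictPseudofunctor A B) : TwoNat F F where
  app _ := 𝟙 _
  naturality _ := (Bicategory.Strict.comp_id _).trans (Bicategory.Strict.id_comp _).symm
  naturality₂ _ := (whiskerRight_id_heq _).trans (id_whiskerLeft_heq _).symm

def comp {F G H : StrictPseudofunctor A B} (α : TwoNat F G) (β : TwoNat G H) : TwoNat F H where
  app a := α.app a ≫ β.app a
  naturality {a b} f := by
    rw [← Bicategory.Strict.assoc, α.naturality, Bicategory.Strict.assoc, β.naturality,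
      Bicategory.Strict.assoc]
  naturality₂ {a b f g} η :=
    (whiskerRight_comp_heq _ _ _).trans <|
      (whiskerRight_heq (α.naturality f) (α.naturality g) (α.naturality₂ η) _).trans <|
      (whisker_assoc_heq _ _ _).trans <|
      (whiskerLeft_heq (β.naturality f) (β.naturality g) (β.naturality₂ η) _).trans
      (comp_whiskerLeft_heq _ _ _).symm

end

section
variable {A : Type u₁} [Bicategory.{w₁, v₁} A] {B : Type u₂} [Bicategory.{w₂, v₂} B]
  {C : Type u₃} [Bicategory.{w₃, v₃} C]

/-- Precomposition with a `2`-functor. -/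
def pre (H : StrictPseudofunctor A B) {F G : StrictPseudofunctor B C} (α : TwoNat F G) :
    TwoNat (H.comp F) (H.comp G) where
  app a := α.app (H.obj a)
  naturality f := α.naturality (H.map f)
  naturality₂ η := α.naturality₂ (H.map₂ η)

/-- Postcomposition with a `2`-functor. -/
def post {F G : StrictPseudofunctor A B} (α : TwoNat F G) (H : StrictPseudofunctor B C) :
    TwoNat (F.comp H) (G.comp H) where
  app a := H.map (α.app a)
  naturality f := by
    have := congrArg H.map (α.naturality f)
    rw [H.map_comp, H.map_comp] at this
    exact this
  naturality₂ {a b f g} η :=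
    (map₂_whiskerRight_heq H _ _).symm.trans <|
      (map₂_heq H (α.naturality f) (α.naturality g) (α.naturality₂ η)).trans
        (map₂_whiskerLeft_heq H _ _)

end
end TwoNat

/-- A local discrete fibration `F : C → K`: a `2`-functor between `2`-categories, with `C` locally
small, which is a discrete fibration on each hom-category. -/
structure LDF (K : Type u) [Bicategory.{w, w} K] where
  C : Type u₁
  [bicategory : Bicategory.{w, w} C]
  [strict : Bicategory.Strict C]
  F : StrictPseudofunctor C K
  isDiscreteFibration (x y : C) : IsDiscreteFibration (F.mapFunctor x y)

attribute [instance] LDF.bicategory LDF.strict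

namespace LDF

variable {K : Type u} [Bicategory.{w, w} K]

/-- A lax triangle: a `2`-functor `H` over `K` up to a `2`-natural transformation
`γ : G H ⟶ F` with components discrete fibrations. -/
structure Hom (P Q : LDF.{w, u, u₁} K) where
  H : StrictPseudofunctor P.C Q.C
  γ : TwoNat (H.comp Q.F) P.F
  isDiscFib (x : P.C) : IsDiscFib (γ.app x)

/-- The component of `γ` at `x`. -/
def Hom.leg {P Q : LDF.{w, u, u₁} K} (S : Hom P Q) (x : P.C) : Q.F.obj (S.H.obj x) ⟶ P.F.obj x :=
  S.γ.app x

theorem Hom.ext_of {P Q : LDF.{w, u, u₁} K} {S T : Hom P Q}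
    (e : S.H.toPrelaxFunctor = T.H.toPrelaxFunctor) (e' : ∀ x, HEq (S.γ.app x) (T.γ.app x)) :
    S = T := by
  have := strictPseudofunctor_ext e
  obtain ⟨H, γ, _⟩ := S
  obtain ⟨H', γ', _⟩ := T
  dsimp only at this e'
  subst this
  obtain rfl : γ = γ' := TwoNat.ext (funext fun x => eq_of_heq (e' x))
  rfl

variable [Bicategory.Strict K]

/-- A `2`-cell of lax triangles: a `2`-natural transformation compatible with the triangles. -/
@[ext]
structure Hom₂ {P Q : LDF.{w, u, u₁} K} (S T : Hom P Q) where
  θ : TwoNat S.H T.H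
  comm : (θ.post Q.F).comp T.γ = S.γ

namespace Hom

def id (P : LDF.{w, u, u₁} K) : Hom P P where
  H := StrictPseudofunctor.id P.C
  γ :=
    { app _ := 𝟙 _
      naturality f := (TwoNat.id P.F).naturality f
      naturality₂ η := (TwoNat.id P.F).naturality₂ η }
  isDiscFib _ := isDiscFib_id _

def comp {P Q R : LDF.{w, u, u₁} K} (S : Hom P Q) (T : Hom Q R) : Hom P R where
  H := S.H.comp T.H
  γ :=
    { app x := T.γ.app (S.H.obj x) ≫ S.γ.app x
      naturality f := ((T.γ.pre S.H).comp S.γ).naturality f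
      naturality₂ η := ((T.γ.pre S.H).comp S.γ).naturality₂ η }
  isDiscFib x := (T.isDiscFib _).comp (S.isDiscFib x)

theorem id_comp {P Q : LDF.{w, u, u₁} K} (S : Hom P Q) : (id P).comp S = S :=
  ext_of rfl fun _ => heq_of_eq (Bicategory.Strict.comp_id _)

theorem comp_id {P Q : LDF.{w, u, u₁} K} (S : Hom P Q) : S.comp (id Q) = S :=
  ext_of rfl fun _ => heq_of_eq (Bicategory.Strict.id_comp _)

theorem assoc {P Q R R' : LDF.{w, u, u₁} K} (S : Hom P Q) (T : Hom Q R) (V : Hom R R') :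
    (S.comp T).comp V = S.comp (T.comp V) :=
  ext_of rfl fun _ => heq_of_eq (Bicategory.Strict.assoc _ _ _).symm

end Hom

namespace Hom₂
variable {P Q R R' : LDF.{w, u, u₁} K}

theorem comm_app {S T : Hom P Q} (σ : Hom₂ S T) (x : P.C) :
    Q.F.map (σ.θ.app x) ≫ T.leg x = S.leg x :=
  congrFun (congrArg TwoNat.app σ.comm) x

/-- Build a `2`-cell from the componentwise equation. -/
def mk' {S T : Hom P Q} (θ : TwoNat S.H T.H)
    (comm : ∀ x, Q.F.map (θ.app x) ≫ T.leg x = S.leg x) : Hom₂ S T :=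
  ⟨θ, TwoNat.ext (funext comm)⟩

theorem ext_app {S T : Hom P Q} {σ τ : Hom₂ S T} (e : ∀ x, σ.θ.app x = τ.θ.app x) : σ = τ :=
  Hom₂.ext (TwoNat.ext (funext e))

def id (S : Hom P Q) : Hom₂ S S :=
  mk' (TwoNat.id S.H) fun x => by
    change Q.F.map (𝟙 _) ≫ S.leg x = S.leg x
    rw [Q.F.map_id, Bicategory.Strict.id_comp]

def comp {S T V : Hom P Q} (σ : Hom₂ S T) (τ : Hom₂ T V) : Hom₂ S V :=
  mk' (σ.θ.comp τ.θ) fun x => by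
    change Q.F.map (σ.θ.app x ≫ τ.θ.app x) ≫ V.leg x = S.leg x
    rw [Q.F.map_comp, Bicategory.Strict.assoc, τ.comm_app, σ.comm_app]

def whiskerLeft (S : Hom P Q) {T V : Hom Q R} (τ : Hom₂ T V) : Hom₂ (S.comp T) (S.comp V) :=
  mk' (τ.θ.pre S.H) fun x => by
    change R.F.map (τ.θ.app (S.H.obj x)) ≫ V.leg (S.H.obj x) ≫ S.leg x =
      T.leg (S.H.obj x) ≫ S.leg x
    rw [← Bicategory.Strict.assoc, τ.comm_app]

def whiskerRight {S T : Hom P Q} (σ : Hom₂ S T) (V : Hom Q R) : Hom₂ (S.comp V) (T.comp V) :=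
  mk' (σ.θ.post V.H) fun x => by
    have := V.γ.naturality (σ.θ.app x)
    change R.F.map (V.H.map (σ.θ.app x)) ≫ V.leg (T.H.obj x) =
      V.leg (S.H.obj x) ≫ Q.F.map (σ.θ.app x) at this
    change R.F.map (V.H.map (σ.θ.app x)) ≫ V.leg (T.H.obj x) ≫ T.leg x =
      V.leg (S.H.obj x) ≫ S.leg x
    rw [← Bicategory.Strict.assoc, this, Bicategory.Strict.assoc, σ.comm_app]

theorem heq_of {S S' T T' : Hom P Q} (σ : Hom₂ S T) (τ : Hom₂ S' T') (h₁ : S = S') (h₂ : T = T')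
    (h₃ : ∀ x, HEq (σ.θ.app x) (τ.θ.app x)) : HEq σ τ := by
  subst h₁ h₂
  exact heq_of_eq (ext_app fun x => eq_of_heq (h₃ x))

end Hom₂

instance : CategoryStruct (LDF.{w, u, u₁} K) where
  Hom P Q := Hom P Q
  id P := Hom.id P
  comp S T := Hom.comp S T

instance homCategory (P Q : LDF.{w, u, u₁} K) : Category (P ⟶ Q) where
  Hom S T := Hom₂ (P := P) (Q := Q) S T
  id S := Hom₂.id S
  comp σ τ := Hom₂.comp σ τ
  id_comp _ := Hom₂.ext_app fun _ => Bicategory.Strict.id_comp _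
  comp_id _ := Hom₂.ext_app fun _ => Bicategory.Strict.comp_id _
  assoc _ _ _ := Hom₂.ext_app fun _ => Bicategory.Strict.assoc _ _ _

/-- The (strict) `2`-category of local discrete fibrations over `K`. -/
instance ldfBicategory : Bicategory (LDF.{w, u, u₁} K) :=
  mkStrict _ Hom.id_comp Hom.comp_id Hom.assoc
    (fun S _ _ τ => Hom₂.whiskerLeft S τ) (fun σ V => Hom₂.whiskerRight σ V)
    (fun _ _ => rfl)
    (fun _ _ _ _ _ _ => rfl)
    (fun _ V => Hom₂.ext_app fun _ => V.H.map_id _)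
    (fun _ _ V => Hom₂.ext_app fun _ => V.H.map_comp _ _)
    (fun σ τ => Hom₂.ext_app fun x => (τ.θ.naturality (σ.θ.app x)).symm)
    (fun _ => Hom₂.heq_of _ _ (Hom.id_comp _) (Hom.id_comp _) fun _ => HEq.rfl)
    (fun _ _ _ _ _ => Hom₂.heq_of _ _ (Hom.assoc _ _ _) (Hom.assoc _ _ _) fun _ => HEq.rfl)
    (fun _ => Hom₂.heq_of _ _ (Hom.comp_id _) (Hom.comp_id _) fun _ => HEq.rfl)
    (fun _ _ _ => Hom₂.heq_of _ _ (Hom.assoc _ _ _).symm (Hom.assoc _ _ _).symm fun _ => HEq.rfl)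
    (fun _ _ _ _ _ => Hom₂.heq_of _ _ (Hom.assoc _ _ _) (Hom.assoc _ _ _) fun _ => HEq.rfl)

instance : Bicategory.Strict (LDF.{w, u, u₁} K) where
  id_comp := Hom.id_comp
  comp_id := Hom.comp_id
  assoc := Hom.assoc

end LDF

/-- Invertible `2`-natural transformations. -/
structure TwoNatIso {A : Type u₁} [Bicategory.{w₁, v₁} A] {B : Type u₂} [Bicategory.{w₂, v₂} B]
    (F G : StrictPseudofunctor A B) where
  hom : TwoNat F G
  inv : TwoNat G F
  hom_inv_id (a : A) : hom.app a ≫ inv.app a = 𝟙 (F.obj a)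
  inv_hom_id (a : A) : inv.app a ≫ hom.app a = 𝟙 (G.obj a)

/-- A `2`-equivalence of `2`-categories: `2`-functors in both directions which are mutually inverse
up to invertible `2`-natural transformations. -/
structure TwoEquivalence (A : Type u₁) [Bicategory.{w₁, v₁} A] [Bicategory.Strict A]
    (B : Type u₂) [Bicategory.{w₂, v₂} B] [Bicategory.Strict B] where
  functor : StrictPseudofunctor A B
  inverse : StrictPseudofunctor B A
  unitIso : TwoNatIso (StrictPseudofunctor.id A) (functor.comp inverse)
  counitIso : TwoNatIso (inverse.comp functor) (StrictPseudofunctor.id B)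

end GenWood

/-! Everything rests on a description of the cells of `ℙK` by elements. Writing `*` for Day
convolution in diagrammatic order, a cell from `U` to `V` with sides `f` and `g` is a map of
presheaves `s : 𝒴f * U ⟶ V * 𝒴g`. By the Yoneda lemma `s` is determined by the elements `s(𝟙 f, a)`
of `(V * 𝒴g)(f ≫ u)`, for `a ∈ U u`. On the target side, co-Yoneda gives `(V * 𝒴g)(h) ≅ ∫^v K(h, v ≫
g) × V v`. When `g` is a discrete fibration, every `2`-cell `h ⟶ v ≫ g` is `ψ ▷ g` for a unique `ψ :
v' ⟶ v` with `v' ≫ g = h`, and the coend collapses to the disjoint union of the sets `V v` over all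
`v` with `v ≫ g = h`.

Hence a cell of `ℙK` is a function sending each `a` over `u` to some `b` over some `v` with `f ≫ u =
v ≫ g`, compatibly with restriction: restricting `a` along `φ` corresponds to restricting `b` along
the lift of `f ◁ φ`. The relations `TracksAt` and `Tracks` are the graph of this function;
`exists_eq_map_pair` and `dayYonedaSplit_map_pair` show that it is one. Vertical pasting composes
functions and horizontal pasting applies them to pairs (`Tracks.vcomp`, `Tracks.hcompMap`), and
cells with equal boundaries agree once they agree on generating elements (`Tracks.cell_ext` and its
variants). Axioms of enrichment thereby become equations between elements.

A local discrete fibration `F : C → K` gives an enriched category with the objects of `C`, extents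
`F x`, and as homs the presheaves of fibres `u ↦ {f | F f = u}`; this is the `2`-functor
`LDF.enrich`. It is bijective on `1`-cells: an enriched functor has legs that are discrete
fibrations and acts on `1`-cells by tracking. Its action on a `2`-cell `η` is forced, being obtained
by lifting the whiskering of `F η` with a leg, first along the other leg and then along the target
local discrete fibration (`LDF.exists_eMap₂`). It is also bijective on `2`-cells: the components of
an enriched transformation are `1`-cells read off from the universal element of the unit presheaf,
and `2`-dimensional naturality is automatic because whiskering with a discrete fibration is faithful
(`LDF.eApp_naturality₂`).

Finally, every enriched category `X` is isomorphic to one in the image. Its total `2`-category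
`ECat.Total X`, a local Grothendieck construction, has as `1`-cells the elements of the homs of `X`,
and its fibres over `K` are canonically the homs of `X`. A `2`-functor that is bijective on
`1`-cells and `2`-cells and surjective on objects up to isomorphism is a `2`-equivalence
(`Replacement.twoEquivalence`). -/

namespace GenWood

open CategoryTheory Bicategory Opposite

universe w v u u₁ u₂ h c w' v' u' w₁ v₁ w₂ v₂ w₃ v₃ u₃

/-! ### Locally bijective `2`-functors that are surjective up to isomorphism -/

section LocalIso
variable {A : Type u₁} [Bicategory.{w₁, v₁} A] {B : Type u₂} [Bicategory.{w₂, v₂} B]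

/-- In a strict bicategory the two bracketings of a composite are only propositionally equal
`1`-cells, so `2`-cells between them are compared by `HEq`. This lemma and its mirror image are the
congruence rules of that calculus. -/
theorem whiskerLeft_heq_congr {a b d : B} {k k' : a ⟶ b} {f f' g g' : b ⟶ d} {η : f ⟶ g}
    {η' : f' ⟶ g'} (hk : k = k') (hf : f = f') (hg : g = g') (e : HEq η η') :
    HEq (k ◁ η) (k' ◁ η') := by
  subst hk hf hg; rw [eq_of_heq e]

theorem whiskerRight_heq_congr {a b d : B} {f f' g g' : a ⟶ b} {η : f ⟶ g} {η' : f' ⟶ g'}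
    {k k' : b ⟶ d} (hf : f = f') (hg : g = g') (e : HEq η η') (hk : k = k') :
    HEq (η ▷ k) (η' ▷ k') := by
  subst hk hf hg; rw [eq_of_heq e]

/-- Passes from `HEq` to conjugation by `eqToHom`, the form in which `StrictPseudofunctor.mk''`
takes compatibility with whiskering. -/
theorem eq_conj_of_heq {C : Type u} [Category.{v} C] {a b a' b' : C} {x : a ⟶ b} {y : a' ⟶ b'}
    (p : a = a') (q : b' = b) (e : HEq x y) : x = eqToHom p ≫ y ≫ eqToHom q := by
  subst p q
  simpa using eq_of_heq e

/-- A `2`-functor that is bijective on `1`-cells and on `2`-cells between given objects. -/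
structure IsLocallyBijective (F : StrictPseudofunctor A B) : Prop where
  map_bijective (a b : A) : Function.Bijective (fun f : a ⟶ b => F.map f)
  map₂_bijective {a b : A} (f g : a ⟶ b) : Function.Bijective (fun η : f ⟶ g => F.map₂ η)

namespace IsLocallyBijective
variable {F : StrictPseudofunctor A B}

/-- Faithfulness on `2`-cells when the boundaries are equal but not syntactically the same. The next
lemma is fullness in the same setting. -/
theorem heq_of_map₂_heq (hF : IsLocallyBijective F) {a b : A} {f f' g g' : a ⟶ b}
    {η : f ⟶ g} {η' : f' ⟶ g'} (hf : f = f')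
    (hg : g = g') (e : HEq (F.map₂ η) (F.map₂ η')) : HEq η η' := by
  subst hf hg
  exact heq_of_eq ((hF.map₂_bijective _ _).1 (eq_of_heq e))

theorem exists_map₂_heq (hF : IsLocallyBijective F) {a b : A} {f g : a ⟶ b}
    {f' g' : F.obj a ⟶ F.obj b} (η : f' ⟶ g')
    (hf : F.map f = f') (hg : F.map g = g') : ∃ ζ : f ⟶ g, HEq (F.map₂ ζ) η := by
  subst hf hg
  obtain ⟨ζ, h⟩ := (hF.map₂_bijective f g).2 η
  exact ⟨ζ, heq_of_eq h⟩

end IsLocallyBijective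

/-- A choice, for each object of the codomain, of an object of the domain whose image is isomorphic
to it. -/
structure Replacement (F : StrictPseudofunctor A B) where
  obj : B → A
  hom (b : B) : F.obj (obj b) ⟶ b
  inv (b : B) : b ⟶ F.obj (obj b)
  hom_inv_id (b : B) : hom b ≫ inv b = 𝟙 _
  inv_hom_id (b : B) : inv b ≫ hom b = 𝟙 _

namespace Replacement
variable {F : StrictPseudofunctor A B} (R : Replacement F) (hF : IsLocallyBijective F)

/-- The action on `1`-cells of the inverse of a locally bijective `2`-functor. -/
noncomputable def map {b c : B} (k : b ⟶ c) : R.obj b ⟶ R.obj c :=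
  ((hF.map_bijective _ _).2 (R.hom b ≫ k ≫ R.inv c)).choose

theorem map_map {b c : B} (k : b ⟶ c) : F.map (R.map hF k) = R.hom b ≫ k ≫ R.inv c :=
  ((hF.map_bijective _ _).2 (R.hom b ≫ k ≫ R.inv c)).choose_spec

/-- The action on `2`-cells of the inverse of a locally bijective `2`-functor. -/
noncomputable def map₂ {b c : B} {k l : b ⟶ c} (η : k ⟶ l) : R.map hF k ⟶ R.map hF l :=
  (hF.exists_map₂_heq (R.hom b ◁ η ▷ R.inv c) (R.map_map hF k) (R.map_map hF l)).choose

theorem map₂_map₂ {b c : B} {k l : b ⟶ c} (η : k ⟶ l) :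
    HEq (F.map₂ (R.map₂ hF η)) (R.hom b ◁ η ▷ R.inv c) :=
  (hF.exists_map₂_heq (R.hom b ◁ η ▷ R.inv c) (R.map_map hF k) (R.map_map hF l)).choose_spec

/-- The unit of the equivalence. -/
noncomputable def unitApp (a : A) : a ⟶ R.obj (F.obj a) :=
  ((hF.map_bijective _ _).2 (R.inv (F.obj a))).choose

theorem map_unitApp (a : A) : F.map (R.unitApp hF a) = R.inv (F.obj a) :=
  ((hF.map_bijective _ _).2 (R.inv (F.obj a))).choose_spec

/-- The inverse of the unit of the equivalence. -/
noncomputable def unitInvApp (a : A) : R.obj (F.obj a) ⟶ a :=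
  ((hF.map_bijective _ _).2 (R.hom (F.obj a))).choose

theorem map_unitInvApp (a : A) : F.map (R.unitInvApp hF a) = R.hom (F.obj a) :=
  ((hF.map_bijective _ _).2 (R.hom (F.obj a))).choose_spec

theorem unitInvApp_unitApp (a : A) : R.unitInvApp hF a ≫ R.unitApp hF a = 𝟙 _ :=
  (hF.map_bijective _ _).1 <| by
    change F.map _ = F.map _
    rw [F.map_comp, map_unitApp, map_unitInvApp, R.hom_inv_id, F.map_id]

theorem unitApp_unitInvApp (a : A) : R.unitApp hF a ≫ R.unitInvApp hF a = 𝟙 _ :=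
  (hF.map_bijective _ _).1 <| by
    change F.map _ = F.map _
    rw [F.map_comp, map_unitApp, map_unitInvApp, R.inv_hom_id, F.map_id]

variable [Bicategory.Strict B]

theorem inv_hom_assoc {b c : B} (k : b ⟶ c) : R.inv b ≫ R.hom b ≫ k = k := by
  rw [← Bicategory.Strict.assoc, R.inv_hom_id, Bicategory.Strict.id_comp]

theorem inv_hom_whiskerLeft {b c : B} {k l : b ⟶ c} (η : k ⟶ l) :
    HEq (R.inv b ◁ R.hom b ◁ η) η :=
  (comp_whiskerLeft_heq _ _ _).symm.trans <|
    (whiskerLeft_heq_congr (R.inv_hom_id b) rfl rfl HEq.rfl).trans (id_whiskerLeft_heq η)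

theorem whiskerRight_inv_hom {b c : B} {k l : b ⟶ c} (η : k ⟶ l) :
    HEq (η ▷ R.inv c ▷ R.hom c) η :=
  (whiskerRight_comp_heq _ _ _).symm.trans <|
    (whiskerRight_heq_congr rfl rfl HEq.rfl (R.inv_hom_id c)).trans (whiskerRight_id_heq η)

/-- The laws of the inverse `2`-functor are all checked after applying `F`, where `map_map` and
`map₂_map₂` turn them into statements about conjugation by the isomorphisms `R.hom` and `R.inv`. -/
theorem map_id (b : B) : R.map hF (𝟙 b) = 𝟙 (R.obj b) :=
  (hF.map_bijective _ _).1 <| by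
    change F.map _ = F.map _
    rw [map_map, F.map_id, Bicategory.Strict.id_comp, R.hom_inv_id]

theorem map_comp {b c d : B} (k : b ⟶ c) (l : c ⟶ d) :
    R.map hF (k ≫ l) = R.map hF k ≫ R.map hF l :=
  (hF.map_bijective _ _).1 <| by
    change F.map _ = F.map _
    rw [map_map, F.map_comp, map_map, map_map]
    simp only [Bicategory.Strict.assoc, inv_hom_assoc]

theorem map₂_id {b c : B} (k : b ⟶ c) : R.map₂ hF (𝟙 k) = 𝟙 (R.map hF k) :=
  (hF.map₂_bijective _ _).1 <| eq_of_heq <| by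
    change HEq (F.map₂ _) (F.map₂ _)
    refine (R.map₂_map₂ hF (𝟙 k)).trans ?_
    rw [F.map₂_id, R.map_map hF k, id_whiskerRight, Bicategory.whiskerLeft_id]

theorem map₂_comp {b c : B} {k l m : b ⟶ c} (η : k ⟶ l) (θ : l ⟶ m) :
    R.map₂ hF (η ≫ θ) = R.map₂ hF η ≫ R.map₂ hF θ :=
  (hF.map₂_bijective _ _).1 <| eq_of_heq <| by
    change HEq (F.map₂ _) (F.map₂ _)
    refine (R.map₂_map₂ hF _).trans ?_
    rw [F.map₂_comp, comp_whiskerRight, Bicategory.whiskerLeft_comp]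
    exact heq_comp (R.map_map hF k).symm (R.map_map hF l).symm (R.map_map hF m).symm
      (R.map₂_map₂ hF η).symm (R.map₂_map₂ hF θ).symm

/-- After applying `F`, the right-hand side contains `R.inv c` followed by `R.hom c` between `k` and
`η`. Rebracketing brings these two together and they cancel. -/
theorem map₂_whiskerLeft {b c d : B} (k : b ⟶ c) {l m : c ⟶ d} (η : l ⟶ m) :
    HEq (R.map₂ hF (k ◁ η)) (R.map hF k ◁ R.map₂ hF η) := by
  refine hF.heq_of_map₂_heq (R.map_comp hF _ _) (R.map_comp hF _ _) ?_
  refine (R.map₂_map₂ hF _).trans (HEq.trans ?_ (map₂_whiskerLeft_heq F _ _).symm)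
  refine HEq.trans ?_ (whiskerLeft_heq_congr (R.map_map hF k) (R.map_map hF l) (R.map_map hF m)
    (R.map₂_map₂ hF η)).symm
  refine HEq.trans ?_ (comp_whiskerLeft_heq _ _ _).symm
  refine whiskerLeft_heq_congr rfl ?_ ?_ ?_
  · simp only [Bicategory.Strict.assoc, inv_hom_assoc]
  · simp only [Bicategory.Strict.assoc, inv_hom_assoc]
  refine (whisker_assoc_heq _ _ _).trans (HEq.trans ?_ (comp_whiskerLeft_heq _ _ _).symm)
  refine whiskerLeft_heq_congr rfl ?_ ?_ (R.inv_hom_whiskerLeft _).symm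
  · simp only [inv_hom_assoc]
  · simp only [inv_hom_assoc]

theorem map₂_whiskerRight {b c d : B} {k l : b ⟶ c} (η : k ⟶ l) (m : c ⟶ d) :
    HEq (R.map₂ hF (η ▷ m)) (R.map₂ hF η ▷ R.map hF m) := by
  refine hF.heq_of_map₂_heq (R.map_comp hF _ _) (R.map_comp hF _ _) ?_
  refine (R.map₂_map₂ hF _).trans (HEq.trans ?_ (map₂_whiskerRight_heq F _ _).symm)
  refine HEq.trans ?_ (whiskerRight_heq_congr (R.map_map hF k) (R.map_map hF l)
    (R.map₂_map₂ hF η) (R.map_map hF m)).symm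
  refine HEq.trans ?_ (whisker_assoc_heq _ _ _).symm
  refine whiskerLeft_heq_congr rfl ?_ ?_ ?_
  · simp only [Bicategory.Strict.assoc, inv_hom_assoc]
  · simp only [Bicategory.Strict.assoc, inv_hom_assoc]
  refine HEq.trans ?_ (whiskerRight_comp_heq _ _ _).symm
  refine (whiskerRight_comp_heq _ _ _).symm.trans ?_
  refine whiskerRight_heq_congr ?_ ?_ (R.whiskerRight_inv_hom _).symm rfl
  · simp only [Bicategory.Strict.assoc, R.inv_hom_id, Bicategory.Strict.comp_id]
  · simp only [Bicategory.Strict.assoc, R.inv_hom_id, Bicategory.Strict.comp_id]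

theorem naturality_hom {b c : B} (k : b ⟶ c) :
    F.map (R.map hF k) ≫ R.hom c = R.hom b ≫ k := by
  simp only [map_map, Bicategory.Strict.assoc, R.inv_hom_id, Bicategory.Strict.comp_id]

theorem naturality_inv {b c : B} (k : b ⟶ c) :
    k ≫ R.inv c = R.inv b ≫ F.map (R.map hF k) := by
  rw [map_map, inv_hom_assoc]

theorem naturality₂_hom {b c : B} {k l : b ⟶ c} (η : k ⟶ l) :
    HEq (F.map₂ (R.map₂ hF η) ▷ R.hom c) (R.hom b ◁ η) := by
  refine (whiskerRight_heq (R.map_map hF k) (R.map_map hF l) (R.map₂_map₂ hF η) _).trans ?_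
  refine (whisker_assoc_heq _ _ _).trans ?_
  refine whiskerLeft_heq_congr rfl ?_ ?_ (R.whiskerRight_inv_hom η)
  · simp only [Bicategory.Strict.assoc, R.inv_hom_id, Bicategory.Strict.comp_id]
  · simp only [Bicategory.Strict.assoc, R.inv_hom_id, Bicategory.Strict.comp_id]

theorem naturality₂_inv {b c : B} {k l : b ⟶ c} (η : k ⟶ l) :
    HEq (η ▷ R.inv c) (R.inv b ◁ F.map₂ (R.map₂ hF η)) := by
  refine HEq.trans ?_ (whiskerLeft_heq_congr rfl (R.map_map hF k) (R.map_map hF l)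
    (R.map₂_map₂ hF η)).symm
  exact (R.inv_hom_whiskerLeft _).symm

/-- The unit is the preimage under `F` of the counit at `F.obj a`, so its naturality is reflected
from that of `R.inv`. -/
theorem naturality_unitApp {a b : A} (f : a ⟶ b) :
    f ≫ R.unitApp hF b = R.unitApp hF a ≫ R.map hF (F.map f) :=
  (hF.map_bijective _ _).1 <| by
    change F.map _ = F.map _
    rw [F.map_comp, F.map_comp, map_unitApp, map_unitApp, R.naturality_inv hF]

theorem naturality_unitInvApp {a b : A} (f : a ⟶ b) :
    R.map hF (F.map f) ≫ R.unitInvApp hF b = R.unitInvApp hF a ≫ f :=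
  (hF.map_bijective _ _).1 <| by
    change F.map _ = F.map _
    rw [F.map_comp, F.map_comp, map_unitInvApp, map_unitInvApp, R.naturality_hom hF]

theorem naturality₂_unitApp {a b : A} {f g : a ⟶ b} (η : f ⟶ g) :
    HEq (η ▷ R.unitApp hF b) (R.unitApp hF a ◁ R.map₂ hF (F.map₂ η)) := by
  refine hF.heq_of_map₂_heq (R.naturality_unitApp hF f) (R.naturality_unitApp hF g) ?_
  refine (map₂_whiskerRight_heq F _ _).trans (HEq.trans ?_ (map₂_whiskerLeft_heq F _ _).symm)
  rw [map_unitApp, map_unitApp]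
  exact R.naturality₂_inv hF _

theorem naturality₂_unitInvApp {a b : A} {f g : a ⟶ b} (η : f ⟶ g) :
    HEq (R.map₂ hF (F.map₂ η) ▷ R.unitInvApp hF b) (R.unitInvApp hF a ◁ η) := by
  refine hF.heq_of_map₂_heq (R.naturality_unitInvApp hF f) (R.naturality_unitInvApp hF g) ?_
  refine (map₂_whiskerRight_heq F _ _).trans (HEq.trans ?_ (map₂_whiskerLeft_heq F _ _).symm)
  rw [map_unitInvApp, map_unitInvApp]
  exact R.naturality₂_hom hF _

variable [Bicategory.Strict A]

/-- The inverse of a locally bijective `2`-functor that is surjective up to isomorphism. -/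
noncomputable def inverse : StrictPseudofunctor B A :=
  StrictPseudofunctor.mk''
    { obj := R.obj
      map := R.map hF
      map₂ := R.map₂ hF
      map₂_id := R.map₂_id hF
      map₂_comp := R.map₂_comp hF
      map_id := R.map_id hF
      map_comp := R.map_comp hF
      map₂_whisker_left k _ _ η := eq_conj_of_heq _ _ (R.map₂_whiskerLeft hF k η)
      map₂_whisker_right η k := eq_conj_of_heq _ _ (R.map₂_whiskerRight hF η k) }

/-- A locally bijective `2`-functor that is surjective up to isomorphism is a
`2`-equivalence; here it is the backward direction of the equivalence. -/
noncomputable def twoEquivalence : TwoEquivalence B A where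
  functor := R.inverse hF
  inverse := F
  unitIso :=
    { hom :=
        { app := R.inv
          naturality := R.naturality_inv hF
          naturality₂ := R.naturality₂_inv hF }
      inv :=
        { app := R.hom
          naturality := R.naturality_hom hF
          naturality₂ := R.naturality₂_hom hF }
      hom_inv_id := R.inv_hom_id
      inv_hom_id := R.hom_inv_id }
  counitIso :=
    { hom :=
        { app := R.unitInvApp hF
          naturality := R.naturality_unitInvApp hF
          naturality₂ := R.naturality₂_unitInvApp hF }
      inv :=
        { app := R.unitApp hF
          naturality := R.naturality_unitApp hF
          naturality₂ := R.naturality₂_unitApp hF }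
      hom_inv_id := R.unitInvApp_unitApp hF
      inv_hom_id := R.unitApp_unitInvApp hF }

end Replacement
end LocalIso

end GenWood

namespace GenWood

open CategoryTheory Bicategory Opposite

universe w v u u₁ u₂ h c w' v' u' w₁ v₁ w₂ v₂ w₃ v₃ u₃

/-! ### Squares whose right side is a discrete fibration, as functions on elements -/

section Tracking
variable {K : Type u} [Bicategory.{w, w} K]

section
variable {A C : K}

theorem map_op_map_op (P : (A ⟶ C)ᵒᵖ ⥤ Type w) {f g h : A ⟶ C} (φ : f ⟶ g) (ψ : g ⟶ h)
    (x : P.obj (op h)) : P.map φ.op (P.map ψ.op x) = P.map (φ ≫ ψ).op x := by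
  rw [op_comp, Functor.map_comp_apply]

/-- Elements over equal but distinct expressions for a `1`-cell are compared inside a sigma type,
where transport along `eqToHom` becomes invisible. -/
theorem sigma_map_eqToHom (P : (A ⟶ C)ᵒᵖ ⥤ Type w) {f g : A ⟶ C} (e : f = g) (x : P.obj (op g)) :
    (⟨f, P.map (eqToHom e).op x⟩ : (u : A ⟶ C) × P.obj (op u)) = ⟨g, x⟩ := by
  subst e
  simp

end

variable {A A' C C' : K} {f : A' ⟶ A} {g : C' ⟶ C} {U : (A ⟶ C)ᵒᵖ ⥤ Type w}
  {V : (A' ⟶ C')ᵒᵖ ⥤ Type w}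

section Fibration

/-- The lift of a `2`-cell along a discrete fibration. -/
noncomputable def IsDiscFib.lift (hg : IsDiscFib g) {v : A' ⟶ C'} {h : A' ⟶ C} (φ : h ⟶ v ≫ g) :
    (v' : A' ⟶ C') × (v' ⟶ v) :=
  (hg A' v h φ).choose

theorem IsDiscFib.lift_spec (hg : IsDiscFib g) {v : A' ⟶ C'} {h : A' ⟶ C} (φ : h ⟶ v ≫ g) :
    (⟨(hg.lift φ).1 ≫ g, (hg.lift φ).2 ▷ g⟩ : (h : A' ⟶ C) × (h ⟶ v ≫ g)) = ⟨h, φ⟩ :=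
  (hg A' v h φ).choose_spec.1

theorem IsDiscFib.lift_eq (hg : IsDiscFib g) {v v' : A' ⟶ C'} {h : A' ⟶ C} {φ : h ⟶ v ≫ g}
    {ψ : v' ⟶ v} (e : (⟨v' ≫ g, ψ ▷ g⟩ : (h : A' ⟶ C) × (h ⟶ v ≫ g)) = ⟨h, φ⟩) :
    hg.lift φ = ⟨v', ψ⟩ :=
  ((hg A' v h φ).choose_spec.2 ⟨v', ψ⟩ e).symm

theorem sigma_comp_eq {v v' : A' ⟶ C} {h h' : A' ⟶ C} {φ : h ⟶ v} {φ' : h' ⟶ v}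
    (e : (⟨h, φ⟩ : (h : A' ⟶ C) × (h ⟶ v)) = ⟨h', φ'⟩) (ψ : v ⟶ v') :
    (⟨h, φ ≫ ψ⟩ : (h : A' ⟶ C) × (h ⟶ v')) = ⟨h', φ' ≫ ψ⟩ := by
  cases e
  rfl

/-- The element lying over the canonical representative of an element of a Day convolution with the
presheaf represented by a discrete fibration. -/
noncomputable def dayYonedaSplit (hg : IsDiscFib g) {h : A' ⟶ C}
    (x : (day V (yoneda.obj g)).obj (op h)) : (v : A' ⟶ C') × V.obj (op v) :=
  -- A representative `(v, q, φ, b, k)` with `k : q ⟶ g` yields the `2`-cell `φ ≫ v ◁ k : h ⟶ v ≫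
  -- g`. Its lift `v' ⟶ v` along `g` is then used to restrict `b`.
  Quot.lift (fun y : DayPre V (yoneda.obj g) h =>
    (⟨(hg.lift (y.arr ≫ y.fst ◁ y.right)).1,
      V.map (hg.lift (y.arr ≫ y.fst ◁ y.right)).2.op y.left⟩ : (v : A' ⟶ C') × V.obj (op v))) (by
    rintro _ _ ⟨a, b, φ, x, (k : _ ⟶ g)⟩
    rename_i v v' q q'
    have hk : (yoneda.obj g).map b.op k = b ≫ k := rfl
    have h₁ := hg.lift_spec (φ ≫ v ◁ (b ≫ k))
    -- By interchange the `2`-cells of the two related representatives differ by `a ▷ g`, so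
    -- uniqueness of lifts makes the lift of one the lift of the other followed by `a`.
    have h₂ : hg.lift ((φ ≫ a ▷ q ≫ v' ◁ b) ≫ v' ◁ k) =
        ⟨(hg.lift (φ ≫ v ◁ (b ≫ k))).1, (hg.lift (φ ≫ v ◁ (b ≫ k))).2 ≫ a⟩ := by
      refine hg.lift_eq ?_
      have h₃ := sigma_comp_eq h₁ (a ▷ g)
      rw [comp_whiskerRight, h₃]
      congr 1
      simp [whisker_exchange, whisker_exchange_assoc]
    dsimp only
    rw [hk, h₂]
    simp) x

/-- The relevant `2`-cell is an identity, whose lift is an identity. Consequently the canonical form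
`(v, b)` of an element of the convolution is unique. -/
theorem dayYonedaSplit_map_pair (hg : IsDiscFib g) {h : A' ⟶ C} {v : A' ⟶ C'} (e : h = v ≫ g)
    (b : V.obj (op v)) :
    dayYonedaSplit hg ((day V (yoneda.obj g)).map (eqToHom e).op
      (pair (V := yoneda.obj g) b (𝟙 g))) = ⟨v, b⟩ := by
  subst e
  have h₁ : hg.lift (𝟙 (v ≫ g) ≫ 𝟙 (v ≫ g) ≫ v ◁ 𝟙 g) = ⟨v, 𝟙 v⟩ := hg.lift_eq (by simp)
  change (⟨(hg.lift ((𝟙 (v ≫ g) ≫ 𝟙 (v ≫ g)) ≫ v ◁ 𝟙 g)).1, V.map (hg.lift _).2.op b⟩ :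
    (v : A' ⟶ C') × V.obj (op v)) = _
  rw [Category.assoc, h₁]
  simp

/-- Existence of the canonical form: the map into `g` is absorbed by the Yoneda lemma, and the
remaining `2`-cell `h ⟶ v ≫ g` is lifted along `g` and absorbed into the element of `V`. With the
preceding lemma, the convolution at `h` is the disjoint union of the sets `V v` over `v ≫ g = h`. -/
theorem exists_eq_map_pair (hg : IsDiscFib g) {h : A' ⟶ C}
    (x : (day V (yoneda.obj g)).obj (op h)) :
    ∃ (v : A' ⟶ C') (b : V.obj (op v)) (e : h = v ≫ g),
      x = (day V (yoneda.obj g)).map (eqToHom e).op (pair (V := yoneda.obj g) b (𝟙 g)) := by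
  induction x using day_ind with | H v q φ b k
  have h₁ := hg.lift_spec (φ ≫ v ◁ (show q ⟶ g from k))
  -- Generalising the lift, and later the `2`-cell, makes the equality of pairs `h₁` accessible to
  -- `cases`.
  generalize hg.lift (φ ≫ v ◁ (show q ⟶ g from k)) = l at h₁
  obtain ⟨v', ψ⟩ := l
  refine ⟨v', V.map ψ.op b, (congrArg Sigma.fst h₁).symm, ?_⟩
  rw [yoneda_pair_right V b k, pair_map_left, map_op_map_op, map_op_map_op]
  refine map_op_congr (day V (yoneda.obj g)) ?_ _
  change φ ≫ v ◁ (show q ⟶ g from k) = _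
  dsimp only at h₁
  generalize φ ≫ v ◁ (show q ⟶ g from k) = χ at h₁
  dsimp only [unop_op] at χ h₁ ⊢
  cases h₁
  simp

end Fibration

/-- The square `s` sends the element `a` of `U` to the element `b` of `V`. -/
def TracksAt (s : day (yoneda.obj f) U ⟶ day V (yoneda.obj g)) {u : A ⟶ C} (a : U.obj (op u))
    {v : A' ⟶ C'} (b : V.obj (op v)) : Prop :=
  ∃ e : f ≫ u = v ≫ g, s.app (op (f ≫ u)) (pair (U := yoneda.obj f) (𝟙 f) a) =
    (day V (yoneda.obj g)).map (eqToHom e).op (pair (V := yoneda.obj g) b (𝟙 g))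

namespace TracksAt
variable {s t : day (yoneda.obj f) U ⟶ day V (yoneda.obj g)}

/-- Together with `unique`, this says that `TracksAt s` is the graph of a function on elements. Both
halves use that `g` is a discrete fibration. -/
theorem exists_of (hg : IsDiscFib g) (s : day (yoneda.obj f) U ⟶ day V (yoneda.obj g))
    {u : A ⟶ C} (a : U.obj (op u)) : ∃ (v : A' ⟶ C') (b : V.obj (op v)), TracksAt s a b := by
  obtain ⟨v, b, e, h⟩ := exists_eq_map_pair hg (s.app (op (f ≫ u)) (pair (U := yoneda.obj f) (𝟙 f) a))
  exact ⟨v, b, e, h⟩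

theorem unique (hg : IsDiscFib g) {u : A ⟶ C} {a : U.obj (op u)} {v v' : A' ⟶ C'}
    {b : V.obj (op v)} {b' : V.obj (op v')} (h : TracksAt s a b) (h' : TracksAt s a b') :
    (⟨v, b⟩ : (v : A' ⟶ C') × V.obj (op v)) = ⟨v', b'⟩ := by
  obtain ⟨e, h⟩ := h
  obtain ⟨e', h'⟩ := h'
  rw [← dayYonedaSplit_map_pair hg e b, ← h, h', dayYonedaSplit_map_pair]

/-- The Yoneda lemma in the first factor: every pair `(k, a)` is a restriction of `(𝟙 f, a)`. -/
theorem ext_pair (H : ∀ (u : A ⟶ C) (a : U.obj (op u)),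
    s.app (op (f ≫ u)) (pair (U := yoneda.obj f) (𝟙 f) a) =
      t.app (op (f ≫ u)) (pair (U := yoneda.obj f) (𝟙 f) a)) : s = t :=
  day_hom_ext fun p u (k : p ⟶ f) a => by
    rw [yoneda_pair_left U k a, NatTrans.naturality_apply, NatTrans.naturality_apply, H]

theorem of_sigma_eq {u : A ⟶ C} {a : U.obj (op u)} {v v' : A' ⟶ C'} {b : V.obj (op v)}
    {b' : V.obj (op v')} (h : TracksAt s a b)
    (e : (⟨v, b⟩ : (v : A' ⟶ C') × V.obj (op v)) = ⟨v', b'⟩) : TracksAt s a b' := by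
  cases e
  exact h

/-- The hypothesis `H` says that `ψ` lifts `f ◁ φ` along `g`. The lemma is the naturality of the
function on elements; it is what later determines the action on `2`-cells. -/
theorem map {u u' : A ⟶ C} {a : U.obj (op u)} {v v' : A' ⟶ C'} {b : V.obj (op v)}
    (h : TracksAt s a b) (φ : u' ⟶ u) (ψ : v' ⟶ v) (e : f ≫ u' = v' ≫ g)
    (H : HEq (f ◁ φ) (ψ ▷ g)) : TracksAt s (U.map φ.op a) (V.map ψ.op b) := by
  obtain ⟨e', h⟩ := h
  refine ⟨e, ?_⟩
  rw [pair_map_left, pair_map_right, NatTrans.naturality_apply, h, map_op_map_op, map_op_map_op]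
  refine map_op_congr (day V (yoneda.obj g)) ?_ _
  rw [eq_conj_of_heq e e'.symm H]
  simp

end TracksAt

/-- The square sending each element of `U` to a given element of `V`. -/
def squareMk (tgt : ∀ (u : A ⟶ C) (_ : U.obj (op u)), A' ⟶ C')
    (el : ∀ (u : A ⟶ C) (a : U.obj (op u)), V.obj (op (tgt u a)))
    (comm : ∀ (u : A ⟶ C) (a : U.obj (op u)), f ≫ u = tgt u a ≫ g)
    (nat : ∀ {u u' : A ⟶ C} (φ : u' ⟶ u) (a : U.obj (op u)),
      ∃ ψ : tgt u' (U.map φ.op a) ⟶ tgt u a, V.map ψ.op (el u a) = el u' (U.map φ.op a) ∧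
        HEq (f ◁ φ) (ψ ▷ g)) :
    day (yoneda.obj f) U ⟶ day V (yoneda.obj g) :=
  dayDesc (fun p u (k : p ⟶ f) a => (day V (yoneda.obj g)).map (k ▷ u ≫ eqToHom (comm u a)).op
    (pair (V := yoneda.obj g) (el u a) (𝟙 g))) (by
    intro p p' u u' k φ (x : p' ⟶ f) a
    obtain ⟨ψ, h₁, h₂⟩ := nat φ a
    dsimp only
    rw [← h₁, pair_map_left, map_op_map_op, map_op_map_op]
    refine map_op_congr (day V (yoneda.obj g)) ?_ _
    change ((k ≫ x) ▷ u ≫ _) ≫ _ = _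
    have h₃ := eq_conj_of_heq (comm _ _) (comm _ _).symm h₂
    -- Interchange moves `φ` to the position `f ◁ φ`, where it can be replaced by `ψ ▷ g`.
    rw [Category.assoc, Category.assoc, whisker_exchange_assoc, h₃]
    simp)

theorem squareMk_tracksAt (tgt : ∀ (u : A ⟶ C) (_ : U.obj (op u)), A' ⟶ C')
    (el : ∀ (u : A ⟶ C) (a : U.obj (op u)), V.obj (op (tgt u a)))
    (comm : ∀ (u : A ⟶ C) (a : U.obj (op u)), f ≫ u = tgt u a ≫ g) (nat) {u : A ⟶ C}
    (a : U.obj (op u)) : TracksAt (squareMk (V := V) tgt el comm nat) a (el u a) := by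
  refine ⟨comm u a, (dayDesc_pair (U := yoneda.obj f) _ _ _ _).trans ?_⟩
  refine map_op_congr (day V (yoneda.obj g)) ?_ _
  simp

end Tracking

end GenWood

namespace GenWood

open CategoryTheory Bicategory Opposite WeakDoubleCategory

universe w v u u₁ u₂ h c w' v' u' w₁ v₁ w₂ v₂ w₃ v₃ u₃

/-! ### Pasting of squares, computed on generating elements -/

section Squares
variable {K : Type u} [Bicategory.{w, w} K]
variable {A A' A'' C C' C'' E E' : K} {f : A' ⟶ A} {g : C' ⟶ C} {f' : A'' ⟶ A'} {g' : C'' ⟶ C'}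
  {k : E' ⟶ E} {U : (A ⟶ C)ᵒᵖ ⥤ Type w} {V : (A' ⟶ C')ᵒᵖ ⥤ Type w} {W : (A'' ⟶ C'')ᵒᵖ ⥤ Type w}
  {X : (C ⟶ E)ᵒᵖ ⥤ Type w} {Z : (C' ⟶ E')ᵒᵖ ⥤ Type w}

/-- Vertical pasting of squares, in terms of Day convolution. -/
def dayVComp (s : day (yoneda.obj f) U ⟶ day V (yoneda.obj g))
    (t : day (yoneda.obj f') V ⟶ day W (yoneda.obj g')) :
    day (yoneda.obj (f' ≫ f)) U ⟶ day W (yoneda.obj (g' ≫ g)) :=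
  dayMap (dayYonedaHom f' f) (𝟙 U) ≫
    (dayAssocHom (yoneda.obj f') (yoneda.obj f) U ≫ dayMap (𝟙 (yoneda.obj f')) s ≫
      dayAssocInv (yoneda.obj f') V (yoneda.obj g) ≫ dayMap t (𝟙 (yoneda.obj g)) ≫
      dayAssocHom W (yoneda.obj g') (yoneda.obj g)) ≫ dayMap (𝟙 W) (dayYonedaInv g' g)

/-- Horizontal pasting of squares, in terms of Day convolution. -/
def dayHComp (s : day (yoneda.obj f) U ⟶ day V (yoneda.obj g))
    (t : day (yoneda.obj g) X ⟶ day Z (yoneda.obj k)) :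
    day (yoneda.obj f) (day U X) ⟶ day (day V Z) (yoneda.obj k) :=
  dayAssocInv (yoneda.obj f) U X ≫ dayMap s (𝟙 X) ≫ dayAssocHom V (yoneda.obj g) X ≫
    dayMap (𝟙 V) t ≫ dayAssocInv V Z (yoneda.obj k)

/-- The square with identity sides given by a map of presheaves. -/
def dayGlob {U' : (A ⟶ C)ᵒᵖ ⥤ Type w} (φ : U ⟶ U') :
    day (yoneda.obj (𝟙 A)) U ⟶ day U' (yoneda.obj (𝟙 C)) :=
  dayLeftUnitorHom U ≫ φ ≫ dayRightUnitorInv U'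

/-- The square on identity presheaves. -/
def dayHid (f : A' ⟶ A) : day (yoneda.obj f) (yoneda.obj (𝟙 A)) ⟶
    day (yoneda.obj (𝟙 A')) (yoneda.obj f) :=
  dayRightUnitorHom (yoneda.obj f) ≫ dayLeftUnitorInv (yoneda.obj f)

/-- The unit constraints of `yonedaHom` are identity isomorphisms, so the two definitions differ
only by whiskered identities. -/
theorem yonedaHom_glY {U' : (A ⟶ C)ᵒᵖ ⥤ Type w} (φ : U ⟶ U') :
    glY (yonedaHom K) (a := A) (b := C) (U := U) (V := U') φ = dayGlob φ := by
  have h₁ : glY (yonedaHom K) (a := A) (b := C) (U := U) (V := U') φ =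
    dayMap (𝟙 _) (𝟙 U) ≫ dayGlob φ ≫ dayMap (𝟙 U') (𝟙 _) := rfl
  rw [h₁, dayMap_id, dayMap_id]
  exact (Category.id_comp _).trans (Category.comp_id _)

/-- Each factor of the pasting is known on generating pairs only. The generator is pushed through
one factor at a time, and naturality moves the accumulated `2`-cell of `K` out of the way.
Strictness is not needed while `φ` and `ψ` stay arbitrary. -/
theorem dayVComp_pair (s : day (yoneda.obj f) U ⟶ day V (yoneda.obj g))
    (t : day (yoneda.obj f') V ⟶ day W (yoneda.obj g')) {u : A ⟶ C} (a : U.obj (op u))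
    {v : A' ⟶ C'} {b : V.obj (op v)} {φ : f ≫ u ⟶ v ≫ g}
    (hs : s.app (op (f ≫ u)) (pair (U := yoneda.obj f) (𝟙 f) a) =
      (day V (yoneda.obj g)).map φ.op (pair (V := yoneda.obj g) b (𝟙 g)))
    {x : A'' ⟶ C''} {c : W.obj (op x)} {ψ : f' ≫ v ⟶ x ≫ g'}
    (ht : t.app (op (f' ≫ v)) (pair (U := yoneda.obj f') (𝟙 f') b) =
      (day W (yoneda.obj g')).map ψ.op (pair (V := yoneda.obj g') c (𝟙 g'))) :
    (dayVComp s t).app (op ((f' ≫ f) ≫ u)) (pair (U := yoneda.obj (f' ≫ f)) (𝟙 (f' ≫ f)) a) =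
      (day W (yoneda.obj (g' ≫ g))).map ((α_ f' f u).hom ≫ f' ◁ φ ≫ (α_ f' v g).inv ≫ ψ ▷ g ≫
        (α_ x g' g).hom).op (pair (V := yoneda.obj (g' ≫ g)) c (𝟙 (g' ≫ g))) := by
  simp only [dayVComp, NatTrans.comp_app_apply]
  rw [dayMap_pair, dayYonedaHom_id, dayAssocHom_pair, NatTrans.id_app, types_id_apply,
    NatTrans.naturality_apply, dayMap_pair, hs, NatTrans.id_app, types_id_apply, pair_map_right]
  rw [map_op_map_op, NatTrans.naturality_apply, dayAssocInv_pair, map_op_map_op,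
    NatTrans.naturality_apply, dayMap_pair, ht, pair_map_left, NatTrans.id_app, types_id_apply,
    map_op_map_op, NatTrans.naturality_apply, dayAssocHom_pair, map_op_map_op,
    NatTrans.naturality_apply, dayMap_pair, dayYonedaInv_pair, NatTrans.id_app, types_id_apply]
  simp

theorem dayHComp_pair (s : day (yoneda.obj f) U ⟶ day V (yoneda.obj g))
    (t : day (yoneda.obj g) X ⟶ day Z (yoneda.obj k)) {u : A ⟶ C} {a : U.obj (op u)}
    {v : A' ⟶ C'} {b : V.obj (op v)} {φ : f ≫ u ⟶ v ≫ g}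
    (hs : s.app (op (f ≫ u)) (pair (U := yoneda.obj f) (𝟙 f) a) =
      (day V (yoneda.obj g)).map φ.op (pair (V := yoneda.obj g) b (𝟙 g)))
    {x : C ⟶ E} {c : X.obj (op x)} {z : C' ⟶ E'} {d : Z.obj (op z)} {ψ : g ≫ x ⟶ z ≫ k}
    (ht : t.app (op (g ≫ x)) (pair (U := yoneda.obj g) (𝟙 g) c) =
      (day Z (yoneda.obj k)).map ψ.op (pair (V := yoneda.obj k) d (𝟙 k))) :
    (dayHComp s t).app (op (f ≫ u ≫ x)) (pair (U := yoneda.obj f) (𝟙 f) (pair a c)) =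
      (day (day V Z) (yoneda.obj k)).map ((α_ f u x).inv ≫ φ ▷ x ≫ (α_ v g x).hom ≫ v ◁ ψ ≫
        (α_ v z k).inv).op (pair (V := yoneda.obj k) (pair b d) (𝟙 k)) := by
  simp only [dayHComp, NatTrans.comp_app_apply]
  rw [dayAssocInv_pair, NatTrans.naturality_apply, dayMap_pair, hs, pair_map_left,
    NatTrans.id_app, types_id_apply, map_op_map_op, NatTrans.naturality_apply, dayAssocHom_pair,
    map_op_map_op, NatTrans.naturality_apply, dayMap_pair, ht, pair_map_right, NatTrans.id_app,
    types_id_apply, map_op_map_op, NatTrans.naturality_apply, dayAssocInv_pair, map_op_map_op]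
  simp

theorem dayGlob_pair {U' : (A ⟶ C)ᵒᵖ ⥤ Type w} (φ : U ⟶ U') {u : A ⟶ C} (a : U.obj (op u)) :
    (dayGlob φ).app (op (𝟙 A ≫ u)) (pair (U := yoneda.obj (𝟙 A)) (𝟙 (𝟙 A)) a) =
      (day U' (yoneda.obj (𝟙 C))).map ((λ_ u).hom ≫ (ρ_ u).inv).op
        (pair (V := yoneda.obj (𝟙 C)) (φ.app _ a) (𝟙 (𝟙 C))) := by
  simp only [dayGlob, NatTrans.comp_app_apply]
  rw [dayLeftUnitorHom_pair, NatTrans.naturality_apply, NatTrans.naturality_apply,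
    dayRightUnitorInv_apply, map_op_map_op]
  simp

theorem dayHid_pair (f : A' ⟶ A) :
    (dayHid f).app (op (f ≫ 𝟙 A)) (pair (U := yoneda.obj f) (V := yoneda.obj (𝟙 A)) (𝟙 f)
      (𝟙 (𝟙 A))) =
      (day (yoneda.obj (𝟙 A')) (yoneda.obj f)).map ((ρ_ f).hom ≫ (λ_ f).inv).op
        (pair (U := yoneda.obj (𝟙 A')) (V := yoneda.obj f) (𝟙 (𝟙 A')) (𝟙 f)) := by
  simp only [dayHid, NatTrans.comp_app_apply]
  rw [dayRightUnitorHom_pair, NatTrans.naturality_apply]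
  rw [dayLeftUnitorInv_apply, map_op_map_op]
  simp

namespace TracksAt
variable [Bicategory.Strict K]

/-- In a strict `K` the constraints are `eqToHom`s, so when `φ` and `ψ` are `eqToHom`s the `2`-cell
found in `dayVComp_pair` is one too, which is exactly what tracking demands. The same holds for the
lemmas that follow. -/
theorem vcomp {s : day (yoneda.obj f) U ⟶ day V (yoneda.obj g)}
    {t : day (yoneda.obj f') V ⟶ day W (yoneda.obj g')} {u : A ⟶ C} {a : U.obj (op u)}
    {v : A' ⟶ C'} {b : V.obj (op v)} {x : A'' ⟶ C''} {c : W.obj (op x)} (hs : TracksAt s a b)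
    (ht : TracksAt t b c) : TracksAt (dayVComp s t) a c := by
  obtain ⟨e, hs⟩ := hs
  obtain ⟨e', ht⟩ := ht
  refine ⟨by
    rw [Bicategory.Strict.assoc, e, ← Bicategory.Strict.assoc, e', Bicategory.Strict.assoc], ?_⟩
  refine (dayVComp_pair s t a hs ht).trans (map_op_congr (day W (yoneda.obj (g' ≫ g))) ?_ _)
  simp [Bicategory.Strict.associator_eqToIso]

theorem hcomp {s : day (yoneda.obj f) U ⟶ day V (yoneda.obj g)}
    {t : day (yoneda.obj g) X ⟶ day Z (yoneda.obj k)} {u : A ⟶ C} {a : U.obj (op u)}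
    {v : A' ⟶ C'} {b : V.obj (op v)}
    {x : C ⟶ E} {c : X.obj (op x)} {z : C' ⟶ E'} {d : Z.obj (op z)} (hs : TracksAt s a b)
    (ht : TracksAt t c d) : TracksAt (dayHComp s t) (pair a c) (pair b d) := by
  obtain ⟨e, hs⟩ := hs
  obtain ⟨e', ht⟩ := ht
  refine ⟨by
    rw [← Bicategory.Strict.assoc, e, Bicategory.Strict.assoc, e', Bicategory.Strict.assoc], ?_⟩
  refine (dayHComp_pair s t hs ht).trans (map_op_congr (day (day V Z) (yoneda.obj k)) ?_ _)
  simp [Bicategory.Strict.associator_eqToIso]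

theorem glob {U' : (A ⟶ C)ᵒᵖ ⥤ Type w} (φ : U ⟶ U') {u : A ⟶ C} (a : U.obj (op u)) :
    TracksAt (dayGlob φ) a (φ.app _ a) := by
  refine ⟨by rw [Bicategory.Strict.id_comp, Bicategory.Strict.comp_id], ?_⟩
  refine (dayGlob_pair φ a).trans (map_op_congr (day U' (yoneda.obj (𝟙 C))) ?_ _)
  simp [Bicategory.Strict.leftUnitor_eqToIso, Bicategory.Strict.rightUnitor_eqToIso]

theorem hid (f : A' ⟶ A) : TracksAt (U := yoneda.obj (𝟙 A)) (V := yoneda.obj (𝟙 A')) (dayHid f)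
    (𝟙 (𝟙 A)) (𝟙 (𝟙 A')) := by
  refine ⟨by rw [Bicategory.Strict.id_comp, Bicategory.Strict.comp_id], ?_⟩
  refine (dayHid_pair f).trans (map_op_congr (day (yoneda.obj (𝟙 A')) (yoneda.obj f)) ?_ _)
  simp [Bicategory.Strict.leftUnitor_eqToIso, Bicategory.Strict.rightUnitor_eqToIso]

end TracksAt

end Squares

end GenWood

/-! ### Cells of `ℙK` and their action on elements -/

namespace GenWood

open CategoryTheory Bicategory Opposite WeakDoubleCategory

universe w v u u₁ u₂ h c w' v' u' w₁ v₁ w₂ v₂ w₃ v₃ u₃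

/-- The common value is existentially quantified, so that it can be found by unification from two
tracking proofs. The two variants that follow need the test only on generators: the universal
element of a representable, and the pairs of a Day convolution. -/
theorem TracksAt.ext {K : Type u} [Bicategory.{w, w} K] {A A' C C' : K} {f : A' ⟶ A} {g : C' ⟶ C}
    {U : (A ⟶ C)ᵒᵖ ⥤ Type w} {V : (A' ⟶ C')ᵒᵖ ⥤ Type w}
    {s t : day (yoneda.obj f) U ⟶ day V (yoneda.obj g)}
    (H : ∀ (u : A ⟶ C) (a : U.obj (op u)), ∃ (v : A' ⟶ C') (b : V.obj (op v)),
      TracksAt s a b ∧ TracksAt t a b) : s = t :=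
  TracksAt.ext_pair fun u a => by
    obtain ⟨v, b, ⟨_, h₁⟩, ⟨_, h₂⟩⟩ := H u a
    rw [h₁, h₂]

theorem TracksAt.ext_yoneda {K : Type u} [Bicategory.{w, w} K] {A A' C C' : K} {f : A' ⟶ A}
    {g : C' ⟶ C} {k : A ⟶ C} {V : (A' ⟶ C')ᵒᵖ ⥤ Type w}
    {s t : day (yoneda.obj f) (yoneda.obj k) ⟶ day V (yoneda.obj g)}
    (H : ∃ (v : A' ⟶ C') (b : V.obj (op v)),
      TracksAt (U := yoneda.obj k) s (𝟙 k) b ∧ TracksAt (U := yoneda.obj k) t (𝟙 k) b) : s = t :=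
  TracksAt.ext_pair fun u (a : u ⟶ k) => by
    obtain ⟨v, b, ⟨_, h₁⟩, ⟨_, h₂⟩⟩ := H
    rw [yoneda_pair_right (yoneda.obj f) (𝟙 f) a, NatTrans.naturality_apply,
      NatTrans.naturality_apply, h₁, h₂]

theorem TracksAt.ext_day {K : Type u} [Bicategory.{w, w} K] {A A' B C C' : K} {f : A' ⟶ A}
    {g : C' ⟶ C} {U : (A ⟶ B)ᵒᵖ ⥤ Type w} {W : (B ⟶ C)ᵒᵖ ⥤ Type w} {V : (A' ⟶ C')ᵒᵖ ⥤ Type w}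
    {s t : day (yoneda.obj f) (day U W) ⟶ day V (yoneda.obj g)}
    (H : ∀ (u : A ⟶ B) (a : U.obj (op u)) (x : B ⟶ C) (c : W.obj (op x)),
      ∃ (v : A' ⟶ C') (b : V.obj (op v)), TracksAt s (pair a c) b ∧ TracksAt t (pair a c) b) :
    s = t :=
  TracksAt.ext_pair fun p y => by
    induction y using day_ind with | H u x φ a c
    obtain ⟨v, b, ⟨_, h₁⟩, ⟨_, h₂⟩⟩ := H u a x c
    rw [pair_map_right, NatTrans.naturality_apply, NatTrans.naturality_apply, h₁, h₂]

variable {K : Type u} [Bicategory.{w, w} K] [Bicategory.Strict K]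

/-- A horizontal arrow of `ℙK`, as a presheaf. -/
abbrev psh {A C : DblPsh K} (U : Hor A C) : (A.as ⟶ C.as)ᵒᵖ ⥤ Type w := U

/-- An element of a horizontal arrow of `ℙK`. -/
abbrev El {A C : DblPsh K} (U : Hor A C) (u : A.as ⟶ C.as) : Type w := (psh U).obj (op u)

/-- The pair of an element of `U` and an element of `V`. -/
abbrev elPair {A B C : DblPsh K} {U : Hor A B} {V : Hor B C} {u : A.as ⟶ B.as} {v : B.as ⟶ C.as}
    (a : El U u) (b : El V v) : El (hcomp U V) (u ≫ v) :=
  pair (U := psh U) (V := psh V) a b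

/-- The universal element of a horizontal identity. -/
abbrev elId (A : DblPsh K) : El (hid A) (𝟙 A.as) := 𝟙 (𝟙 A.as)

/-- The cell with identity vertical boundaries given by a map of presheaves. -/
def globCell {A C : DblPsh K} {U V : Hor A C} (φ : psh U ⟶ psh V) : Cell U V :=
  PCell.glob (Y := yonedaHom K) φ

/-- The globular cell given by a map of presheaves. -/
def globGlobular {A C : DblPsh K} {U V : Hor A C} (φ : psh U ⟶ psh V) : Globular U V :=
  ⟨globCell φ, rfl, rfl⟩

/-- The cell `α` sends the element `a` of its source to the element `b` of its target. -/
def Tracks {A A' C C' : DblPsh K} {U : Hor A C} {V : Hor A' C'} (α : Cell U V)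
    {u : A.as ⟶ C.as} (a : El U u) {v : A'.as ⟶ C'.as} (b : El V v) : Prop :=
  TracksAt (f := (left α).1) (g := (right α).1) (U := psh U) (V := psh V) (PCell.cell α) a b

namespace Tracks
variable {A A' A'' C C' C'' E E' : DblPsh K} {U : Hor A C} {V : Hor A' C'} {W : Hor A'' C''}
  {X : Hor C E} {Z : Hor C' E'}

theorem exists_of (α : Cell U V) {u : A.as ⟶ C.as} (a : El U u) :
    ∃ (v : A'.as ⟶ C'.as) (b : El V v), Tracks α a b :=
  TracksAt.exists_of (right α).2 _ a

theorem unique {α : Cell U V} {u : A.as ⟶ C.as} {a : El U u} {v v' : A'.as ⟶ C'.as} {b : El V v}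
    {b' : El V v'} (h : Tracks α a b) (h' : Tracks α a b') :
    (⟨v, b⟩ : (v : A'.as ⟶ C'.as) × El V v) = ⟨v', b'⟩ :=
  TracksAt.unique (right α).2 h h'

theorem comm {α : Cell U V} {u : A.as ⟶ C.as} {a : El U u} {v : A'.as ⟶ C'.as} {b : El V v}
    (h : Tracks α a b) : (left α).1 ≫ u = v ≫ (right α).1 := h.1

theorem of_sigma_eq {α : Cell U V} {u : A.as ⟶ C.as} {a : El U u} {v v' : A'.as ⟶ C'.as}
    {b : El V v} {b' : El V v'} (h : Tracks α a b)
    (e : (⟨v, b⟩ : (v : A'.as ⟶ C'.as) × El V v) = ⟨v', b'⟩) : Tracks α a b' :=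
  TracksAt.of_sigma_eq h e

theorem of_sigma_eq_left {α : Cell U V} {u u' : A.as ⟶ C.as} {a : El U u} {a' : El U u'}
    {v : A'.as ⟶ C'.as} {b : El V v} (h : Tracks α a b)
    (e : (⟨u, a⟩ : (u : A.as ⟶ C.as) × El U u) = ⟨u', a'⟩) : Tracks α a' b := by
  cases e
  exact h

theorem map {α : Cell U V} {u u' : A.as ⟶ C.as} {a : El U u} {v v' : A'.as ⟶ C'.as} {b : El V v}
    (h : Tracks α a b) (φ : u' ⟶ u) (ψ : v' ⟶ v) (e : (left α).1 ≫ u' = v' ≫ (right α).1)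
    (H : HEq ((left α).1 ◁ φ) (ψ ▷ (right α).1)) :
    Tracks α ((psh U).map φ.op a) ((psh V).map ψ.op b) :=
  TracksAt.map h φ ψ e H

theorem vcomp {α : Cell U V} {β : Cell V W} {u : A.as ⟶ C.as} {a : El U u}
    {v : A'.as ⟶ C'.as} {b : El V v} {x : A''.as ⟶ C''.as} {c : El W x} (hα : Tracks α a b)
    (hβ : Tracks β b c) : Tracks (α ≫ᵥ β) a c :=
  TracksAt.vcomp hα hβ

theorem hcompMap {α : Cell U V} {β : Cell X Z} (e : right α = left β) {u : A.as ⟶ C.as}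
    {a : El U u} {v : A'.as ⟶ C'.as} {b : El V v} {x : C.as ⟶ E.as} {c : El X x}
    {z : C'.as ⟶ E'.as} {d : El Z z} (hα : Tracks α a b) (hβ : Tracks β c d) :
    Tracks (hcompMap α β e) (elPair a c) (elPair b d) := by
  -- The shared boundary has to be substituted before the `eqToHom` inside `PCell.hcompMap` can
  -- disappear.
  obtain ⟨f, g, s⟩ := α
  obtain ⟨g', k, t⟩ := β
  change g = g' at e
  subst e
  have h₁ : WeakDoubleCategory.hcompMap (D := DblPsh K) (U := U) (U' := V) (V := X) (V' := Z)
    (PCell.mk (Y := yonedaHom K) f g s)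
    (PCell.mk (Y := yonedaHom K) g k t) rfl = PCell.mk (Y := yonedaHom K) f k (hc0 s t) :=
    PCell.hcompMap_mk s t
  rw [h₁]
  exact TracksAt.hcomp hα hβ

theorem globCell {U V : Hor A C} (φ : psh U ⟶ psh V) {u : A.as ⟶ C.as} (a : El U u) :
    Tracks (globCell φ) a (φ.app _ a) := by
  have h₁ := TracksAt.glob φ a
  rw [← yonedaHom_glY] at h₁
  exact h₁

theorem vid (U : Hor A C) {u : A.as ⟶ C.as} (a : El U u) : Tracks (vid U) a a :=
  globCell (𝟙 (psh U)) a

theorem hidMap (f : A ⟶ A') : Tracks (hidMap f) (elId A) (elId A') :=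
  TracksAt.hid f.1

/-- The constraint cells of `ℙK` are the globular cells of the constraints of Day convolution. On
generating pairs the latter restrict along a constraint of `K`, an `eqToHom` by strictness, and this
is invisible in the sigma type. -/
theorem lunit (U : Hor A C) {u : A.as ⟶ C.as} (a : El U u) :
    Tracks (lunit U) (elPair (elId A) a) a := by
  refine (globCell (dayLeftUnitorHom (psh U)) (elPair (elId A) a)).of_sigma_eq ?_
  rw [dayLeftUnitorHom_pair]
  have h₁ : 𝟙 (𝟙 A.as) ▷ u ≫ (λ_ u).hom = eqToHom (Bicategory.Strict.id_comp u) := by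
    simp [Bicategory.Strict.leftUnitor_eqToIso]
  rw [h₁]
  exact sigma_map_eqToHom (psh U) _ a

theorem runit (U : Hor A C) {u : A.as ⟶ C.as} (a : El U u) :
    Tracks (runit U) (elPair a (elId C)) a := by
  refine (globCell (dayRightUnitorHom (psh U)) (elPair a (elId C))).of_sigma_eq ?_
  rw [dayRightUnitorHom_pair]
  have h₁ : u ◁ 𝟙 (𝟙 C.as) ≫ (ρ_ u).hom = eqToHom (Bicategory.Strict.comp_id u) := by
    simp [Bicategory.Strict.rightUnitor_eqToIso]
  rw [h₁]
  exact sigma_map_eqToHom (psh U) _ a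

theorem lunitInv (U : Hor A C) {u : A.as ⟶ C.as} (a : El U u) :
    Tracks (lunitInv U) a (elPair (elId A) a) := by
  refine (globCell (dayLeftUnitorInv (psh U)) a).of_sigma_eq ?_
  rw [dayLeftUnitorInv_apply, Bicategory.Strict.leftUnitor_eqToIso]
  exact sigma_map_eqToHom (psh (hcomp (hid A) U)) (Bicategory.Strict.id_comp u).symm _

theorem runitInv (U : Hor A C) {u : A.as ⟶ C.as} (a : El U u) :
    Tracks (runitInv U) a (elPair a (elId C)) := by
  refine (globCell (dayRightUnitorInv (psh U)) a).of_sigma_eq ?_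
  rw [dayRightUnitorInv_apply, Bicategory.Strict.rightUnitor_eqToIso]
  exact sigma_map_eqToHom (psh (hcomp U (hid C))) (Bicategory.Strict.comp_id u).symm _

theorem hassoc {B : DblPsh K} (U : Hor A B) (V : Hor B C) (W : Hor C E) {u : A.as ⟶ B.as}
    {v : B.as ⟶ C.as} {x : C.as ⟶ E.as} (a : El U u) (b : El V v) (c : El W x) :
    Tracks (hassoc U V W) (elPair (elPair a b) c) (elPair a (elPair b c)) := by
  refine (globCell (dayAssocHom (psh U) (psh V) (psh W)) (elPair (elPair a b) c)).of_sigma_eq ?_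
  rw [dayAssocHom_pair, Bicategory.Strict.associator_eqToIso]
  exact sigma_map_eqToHom (psh (hcomp U (hcomp V W))) (Bicategory.Strict.assoc u v x) _

/-- Boundaries are part of the data of a cell and are compared separately; once they are identified,
equality of cells is equality of squares. -/
theorem cell_ext {α β : Cell U V} (hl : left α = left β) (hr : right α = right β)
    (H : ∀ (u : A.as ⟶ C.as) (a : El U u), ∃ (v : A'.as ⟶ C'.as) (b : El V v),
      Tracks α a b ∧ Tracks β a b) : α = β := by
  obtain ⟨f, g, s⟩ := α
  obtain ⟨f', g', t⟩ := β
  change f = f' at hl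
  change g = g' at hr
  subst hl hr
  exact PCell.mk_congr (TracksAt.ext H)

theorem cell_ext_hid {α β : Cell (hid A) V} (hl : left α = left β) (hr : right α = right β)
    (H : ∃ (v : A'.as ⟶ C'.as) (b : El V v), Tracks α (elId A) b ∧ Tracks β (elId A) b) :
    α = β := by
  obtain ⟨f, g, s⟩ := α
  obtain ⟨f', g', t⟩ := β
  change f = f' at hl
  change g = g' at hr
  subst hl hr
  exact PCell.mk_congr (TracksAt.ext_yoneda (k := 𝟙 A.as) H)

theorem cell_ext_hcomp {B : DblPsh K} {U : Hor A B} {W : Hor B C} {α β : Cell (hcomp U W) V}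
    (hl : left α = left β) (hr : right α = right β)
    (H : ∀ (u : A.as ⟶ B.as) (a : El U u) (x : B.as ⟶ C.as) (c : El W x),
      ∃ (v : A'.as ⟶ C'.as) (b : El V v), Tracks α (elPair a c) b ∧ Tracks β (elPair a c) b) :
    α = β := by
  obtain ⟨f, g, s⟩ := α
  obtain ⟨f', g', t⟩ := β
  change f = f' at hl
  change g = g' at hr
  subst hl hr
  exact PCell.mk_congr (TracksAt.ext_day (U := psh U) (W := psh W) H)

end Tracks

/-! ### Globular cells as maps of presheaves -/

theorem exists_eq_dayGlob {A C : K} {U V : (A ⟶ C)ᵒᵖ ⥤ Type w}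
    (s : day (yoneda.obj (𝟙 A)) U ⟶ day V (yoneda.obj (𝟙 C))) :
    ∃ φ : U ⟶ V, s = dayGlob φ := by
  -- The two sides are unit presheaves, so the map is obtained by conjugating with the unitors.
  refine ⟨dayLeftUnitorInv U ≫ s ≫ dayRightUnitorHom V, ?_⟩
  have h₁ : dayLeftUnitorHom U ≫ dayLeftUnitorInv U = 𝟙 _ := (dayLeftUnitor U).hom_inv_id
  have h₂ : dayRightUnitorHom V ≫ dayRightUnitorInv V = 𝟙 _ := (dayRightUnitor V).hom_inv_id
  rw [dayGlob, Category.assoc, Category.assoc, h₂, reassoc_of% h₁, Category.comp_id]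

section Globular
variable {A C : DblPsh K} {U V : Hor A C}

/-- Units and compositions of an enriched category are given as globular cells. As maps of
presheaves they send an element over `u` to an element over the same `u`, so the projection from the
total `2`-category to `K` preserves identities and composition by definition. -/
theorem exists_eq_globCell (G : Globular U V) : ∃ φ : psh U ⟶ psh V, G.cell = globCell φ := by
  obtain ⟨⟨f, g, s⟩, hl, hr⟩ := G
  change f = 𝟙 _ at hl
  change g = 𝟙 _ at hr
  subst hl hr
  obtain ⟨φ, h⟩ := exists_eq_dayGlob (U := psh U) (V := psh V) s
  exact ⟨φ, PCell.mk_congr (h.trans (yonedaHom_glY (U := psh U) (U' := psh V) φ).symm)⟩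

/-- The map of presheaves underlying a globular cell. -/
noncomputable def Globular.hom (G : Globular U V) : psh U ⟶ psh V := (exists_eq_globCell G).choose

theorem Globular.cell_eq (G : Globular U V) : G.cell = globCell (Globular.hom G) :=
  (exists_eq_globCell G).choose_spec

theorem Globular.tracks (G : Globular U V) {u : A.as ⟶ C.as} (a : El U u) :
    Tracks G.cell a ((Globular.hom G).app _ a) := by
  rw [Globular.cell_eq]
  exact Tracks.globCell _ a

end Globular

end GenWood

namespace GenWood

open CategoryTheory Bicategory Opposite WeakDoubleCategory

universe w v u u₁ u₂ h c w' v' u' w₁ v₁ w₂ v₂ w₃ v₃ u₃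

/-! ### Further generators: pairs with a unit, and triples -/

section ExtLemmas
variable {K : Type u} [Bicategory.{w, w} K]

section
variable {A A' B C C' E : K} {f : A' ⟶ A} {V : (A' ⟶ C')ᵒᵖ ⥤ Type w}

/-- The unit axioms are equations between cells out of a convolution with a unit presheaf. By the
Yoneda lemma the element of that presheaf may be taken to be the universal one. The two lemmas that
follow treat the other side, and the triples of the associativity axiom. -/
theorem TracksAt.ext_yoneda_day {g : C' ⟶ C} {k : A ⟶ B} {W : (B ⟶ C)ᵒᵖ ⥤ Type w}
    {s t : day (yoneda.obj f) (day (yoneda.obj k) W) ⟶ day V (yoneda.obj g)}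
    (H : ∀ (x : B ⟶ C) (c : W.obj (op x)), ∃ (v : A' ⟶ C') (b : V.obj (op v)),
      TracksAt s (pair (U := yoneda.obj k) (𝟙 k) c) b ∧
        TracksAt t (pair (U := yoneda.obj k) (𝟙 k) c) b) : s = t :=
  TracksAt.ext_pair fun p y => by
    induction y using day_ind with | H u x φ a c
    obtain ⟨v, b, ⟨_, h₁⟩, ⟨_, h₂⟩⟩ := H x c
    rw [yoneda_pair_left W a c, pair_map_right, pair_map_right, NatTrans.naturality_apply,
      NatTrans.naturality_apply, NatTrans.naturality_apply, NatTrans.naturality_apply, h₁, h₂]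

theorem TracksAt.ext_day_yoneda {g : C' ⟶ C} {k : B ⟶ C} {U : (A ⟶ B)ᵒᵖ ⥤ Type w}
    {s t : day (yoneda.obj f) (day U (yoneda.obj k)) ⟶ day V (yoneda.obj g)}
    (H : ∀ (u : A ⟶ B) (a : U.obj (op u)), ∃ (v : A' ⟶ C') (b : V.obj (op v)),
      TracksAt s (pair (V := yoneda.obj k) a (𝟙 k)) b ∧
        TracksAt t (pair (V := yoneda.obj k) a (𝟙 k)) b) : s = t :=
  TracksAt.ext_pair fun p y => by
    induction y using day_ind with | H u x φ a c
    obtain ⟨v, b, ⟨_, h₁⟩, ⟨_, h₂⟩⟩ := H u a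
    rw [yoneda_pair_right U a c, pair_map_right, pair_map_right, NatTrans.naturality_apply,
      NatTrans.naturality_apply, NatTrans.naturality_apply, NatTrans.naturality_apply, h₁, h₂]

theorem TracksAt.ext_day₃ {g : C' ⟶ E} {U : (A ⟶ B)ᵒᵖ ⥤ Type w} {W : (B ⟶ C)ᵒᵖ ⥤ Type w}
    {X : (C ⟶ E)ᵒᵖ ⥤ Type w} {s t : day (yoneda.obj f) (day (day U W) X) ⟶ day V (yoneda.obj g)}
    (H : ∀ (u : A ⟶ B) (a : U.obj (op u)) (x : B ⟶ C) (c : W.obj (op x)) (z : C ⟶ E)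
      (d : X.obj (op z)), ∃ (v : A' ⟶ C') (b : V.obj (op v)),
        TracksAt s (pair (pair a c) d) b ∧ TracksAt t (pair (pair a c) d) b) : s = t :=
  TracksAt.ext_pair fun p y => by
    induction y using day_ind with | H q z φ r d
    induction r using day_ind with | H u x ψ a c
    obtain ⟨v, b, ⟨_, h₁⟩, ⟨_, h₂⟩⟩ := H u a x c z d
    rw [pair_map_left, pair_map_right, pair_map_right, NatTrans.naturality_apply,
      NatTrans.naturality_apply, NatTrans.naturality_apply, NatTrans.naturality_apply, h₁, h₂]

end

variable [Bicategory.Strict K] {A A' B C C' E : DblPsh K} {V : Hor A' C'}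

theorem Tracks.of_eq {U : Hor A C} {α : Cell U V} {u : A.as ⟶ C.as} {a : El U u}
    {v : A'.as ⟶ C'.as} {b b' : El V v} (h : Tracks α a b) (e : b = b') : Tracks α a b' := e ▸ h

theorem Tracks.cell_ext_hid_hcomp {W : Hor A C} {α β : Cell (hcomp (hid A) W) V}
    (hl : left α = left β) (hr : right α = right β)
    (H : ∀ (x : A.as ⟶ C.as) (c : El W x), ∃ (v : A'.as ⟶ C'.as) (b : El V v),
      Tracks α (elPair (elId A) c) b ∧ Tracks β (elPair (elId A) c) b) : α = β := by
  obtain ⟨f, g, s⟩ := α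
  obtain ⟨f', g', t⟩ := β
  change f = f' at hl
  change g = g' at hr
  subst hl hr
  exact PCell.mk_congr (TracksAt.ext_yoneda_day (k := 𝟙 A.as) (W := psh W) H)

theorem Tracks.cell_ext_hcomp_hid {W : Hor A C} {α β : Cell (hcomp W (hid C)) V}
    (hl : left α = left β) (hr : right α = right β)
    (H : ∀ (x : A.as ⟶ C.as) (c : El W x), ∃ (v : A'.as ⟶ C'.as) (b : El V v),
      Tracks α (elPair c (elId C)) b ∧ Tracks β (elPair c (elId C)) b) : α = β := by
  obtain ⟨f, g, s⟩ := α
  obtain ⟨f', g', t⟩ := β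
  change f = f' at hl
  change g = g' at hr
  subst hl hr
  exact PCell.mk_congr (TracksAt.ext_day_yoneda (k := 𝟙 C.as) (U := psh W) H)

theorem Tracks.cell_ext_hcomp₃ {U : Hor A B} {W : Hor B C} {X : Hor C E} {V : Hor A' C'}
    {α β : Cell (hcomp (hcomp U W) X) V}
    (hl : left α = left β) (hr : right α = right β)
    (H : ∀ (u : A.as ⟶ B.as) (a : El U u) (x : B.as ⟶ C.as) (c : El W x) (z : C.as ⟶ E.as)
      (d : El X z), ∃ (v : A'.as ⟶ C'.as) (b : El V v), Tracks α (elPair (elPair a c) d) b ∧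
        Tracks β (elPair (elPair a c) d) b) :
    α = β := by
  obtain ⟨f, g, s⟩ := α
  obtain ⟨f', g', t⟩ := β
  change f = f' at hl
  change g = g' at hr
  subst hl hr
  exact PCell.mk_congr (TracksAt.ext_day₃ (U := psh U) (W := psh W) (X := psh X) H)

end ExtLemmas

/-! ### Discrete fibrations and their presheaves of fibres -/

section Fibre
variable {E : Type w} [Category.{v} E] {B : Type u'} [Category.{v'} B] {p : E ⥤ B}

namespace IsDiscreteFibration

theorem hom_ext (hp : IsDiscreteFibration p) {e e' : E} {η θ : e' ⟶ e}
    (H : p.map η = p.map θ) : η = θ := by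
  have := (hp e _ (p.map θ)).unique (y₁ := ⟨e', η⟩) (y₂ := ⟨e', θ⟩) (by dsimp only; rw [H]) rfl
  exact eq_of_heq (Sigma.mk.inj this).2

/-- Uniqueness of lifts, in a form usable when the images have only propositionally equal domains.
-/
theorem eq_of_heq_map (hp : IsDiscreteFibration p) {e e₁ e₂ : E} {η : e₁ ⟶ e} {θ : e₂ ⟶ e}
    (h : p.obj e₁ = p.obj e₂) (H : HEq (p.map η) (p.map θ)) : e₁ = e₂ := by
  have := (hp e _ (p.map θ)).unique (y₁ := ⟨e₁, η⟩) (y₂ := ⟨e₂, θ⟩) (Sigma.ext h H) rfl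
  exact congrArg Sigma.fst this

theorem exists_lift (hp : IsDiscreteFibration p) {e : E} {b b' : B} (h : p.obj e = b)
    (φ : b' ⟶ b) : ∃ (e' : E) (_ : p.obj e' = b') (η : e' ⟶ e), HEq (p.map η) φ := by
  subst h
  obtain ⟨⟨e', η⟩, H, -⟩ := hp e b' φ
  exact ⟨e', congrArg Sigma.fst H, η, (Sigma.mk.inj H).2⟩

/-- The domain of the lift of a map along a discrete fibration. -/
noncomputable def liftObj (hp : IsDiscreteFibration p) {b b' : B} (φ : b' ⟶ b)
    (e : { e : E // p.obj e = b }) : { e : E // p.obj e = b' } :=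
  ⟨(hp.exists_lift e.2 φ).choose, (hp.exists_lift e.2 φ).choose_spec.choose⟩

theorem liftObj_eq (hp : IsDiscreteFibration p) {b b' : B} {φ : b' ⟶ b} {e e' : E}
    {h : p.obj e = b} {h' : p.obj e' = b'} (η : e' ⟶ e) (H : HEq (p.map η) φ) :
    hp.liftObj φ ⟨e, h⟩ = ⟨e', h'⟩ := by
  obtain ⟨θ, H'⟩ := (hp.exists_lift h φ).choose_spec.choose_spec
  exact Subtype.ext (hp.eq_of_heq_map (((hp.exists_lift h φ).choose_spec.choose).trans h'.symm)
    (H'.trans H.symm))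

/-- The presheaf of fibres of a discrete fibration. -/
noncomputable def fibre (hp : IsDiscreteFibration p) : Bᵒᵖ ⥤ Type w where
  obj b := { e : E // p.obj e = b.unop }
  map ψ := ↾(hp.liftObj ψ.unop)
  map_id b := by
    refine ConcreteCategory.hom_ext _ _ fun ⟨e, h⟩ => ?_
    refine hp.liftObj_eq (φ := 𝟙 b.unop) (𝟙 e) ?_
    rw [p.map_id, h]
  map_comp {b b' b''} φ ψ := by
    refine ConcreteCategory.hom_ext _ _ fun ⟨e, h⟩ => ?_
    obtain ⟨e', h', η, H⟩ := hp.exists_lift h φ.unop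
    obtain ⟨e'', h'', θ, H'⟩ := hp.exists_lift h' ψ.unop
    change hp.liftObj (ψ.unop ≫ φ.unop) ⟨e, h⟩ = hp.liftObj ψ.unop (hp.liftObj φ.unop ⟨e, h⟩)
    rw [hp.liftObj_eq (h' := h') η H, hp.liftObj_eq (h' := h'') θ H']
    -- The composite of the two successive lifts is a lift of the composite, so by uniqueness it
    -- computes the restriction.
    refine hp.liftObj_eq (θ ≫ η) ?_
    rw [p.map_comp]
    exact heq_comp h'' h' h H' H

theorem fibre_map_eq (hp : IsDiscreteFibration p) {b b' : B} {φ : b' ⟶ b} {e e' : E}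
    {h : p.obj e = b} {h' : p.obj e' = b'} (η : e' ⟶ e) (H : HEq (p.map η) φ) :
    hp.fibre.map φ.op (⟨e, h⟩ : { e : E // p.obj e = b }) =
      (⟨e', h'⟩ : { e : E // p.obj e = b' }) :=
  hp.liftObj_eq η H

end IsDiscreteFibration
end Fibre

variable {K : Type u} [Bicategory.{w, w} K]

/-! ### The enriched category of fibres of a local discrete fibration -/

namespace LDF

section
variable (P : LDF.{w, u, u₁} K)

/-- The presheaf on `K(F x, F y)` of `1`-cells `x ⟶ y` over a given `1`-cell. -/
noncomputable def fib (x y : P.C) : (P.F.obj x ⟶ P.F.obj y)ᵒᵖ ⥤ Type w :=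
  (P.isDiscreteFibration x y).fibre

variable {P}

/-- A `1`-cell over `u`, as an element of the presheaf of fibres. -/
def el {x y : P.C} {u : P.F.obj x ⟶ P.F.obj y} (f : x ⟶ y) (h : P.F.map f = u) :
    (P.fib x y).obj (op u) :=
  (⟨f, h⟩ : { f : x ⟶ y // P.F.map f = u })

theorem el_surjective {x y : P.C} {u : P.F.obj x ⟶ P.F.obj y} (a : (P.fib x y).obj (op u)) :
    ∃ (f : x ⟶ y) (h : P.F.map f = u), a = el f h :=
  ⟨a.1, a.2, rfl⟩

/-- A `1`-cell of the total `2`-category determines the `1`-cell under it. This converts equality of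
tracked values into equality of `1`-cells upstairs. -/
theorem sigma_el_eq_iff {x y : P.C} {u v : P.F.obj x ⟶ P.F.obj y} {f g : x ⟶ y}
    {h : P.F.map f = u} {h' : P.F.map g = v} :
    (⟨u, el f h⟩ : (u : P.F.obj x ⟶ P.F.obj y) × (P.fib x y).obj (op u)) = ⟨v, el g h'⟩ ↔
      f = g := by
  constructor
  · intro e
    exact congrArg (fun a : (u : P.F.obj x ⟶ P.F.obj y) × (P.fib x y).obj (op u) => a.2.1) e
  · intro e
    subst e h h'
    rfl

/-- By uniqueness of lifts, restriction along `φ` can be read off from any `2`-cell over `φ` with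
the right codomain. -/
theorem fib_map_el {x y : P.C} {u v : P.F.obj x ⟶ P.F.obj y} {φ : v ⟶ u} {f g : x ⟶ y}
    {h : P.F.map f = u} {h' : P.F.map g = v} (η : g ⟶ f) (H : HEq (P.F.map₂ η) φ) :
    (P.fib x y).map φ.op (el f h) = el g h' :=
  (P.isDiscreteFibration x y).fibre_map_eq (h := h) (h' := h') η H

theorem exists_lift {x y : P.C} {u v : P.F.obj x ⟶ P.F.obj y} (φ : v ⟶ u) (f : x ⟶ y)
    (h : P.F.map f = u) : ∃ (g : x ⟶ y) (h' : P.F.map g = v) (η : g ⟶ f),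
      HEq (P.F.map₂ η) φ ∧ (P.fib x y).map φ.op (el f h) = el g h' := by
  obtain ⟨g, h', η, H⟩ := (P.isDiscreteFibration x y).exists_lift h φ
  exact ⟨g, h', η, H, fib_map_el η H⟩

theorem map₂_injective {x y : P.C} {f g : x ⟶ y} {η θ : f ⟶ g} (H : P.F.map₂ η = P.F.map₂ θ) :
    η = θ :=
  (P.isDiscreteFibration x y).hom_ext H

variable (P)

/-- Composition, as a map out of the Day convolution. -/
noncomputable def fibMul (x y z : P.C) : day (P.fib x y) (P.fib y z) ⟶ P.fib x z :=
  dayDesc (fun u v a b => el (a.1 ≫ b.1) (by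
    rw [P.F.map_comp]
    exact congrArg₂ (· ≫ ·) a.2 b.2)) (by
    intro u u' v v' φ ψ a b
    obtain ⟨f, h, rfl⟩ := el_surjective a
    obtain ⟨g, k, rfl⟩ := el_surjective b
    obtain ⟨f', h', η, H, e⟩ := exists_lift φ f h
    obtain ⟨g', k', θ, H', e'⟩ := exists_lift ψ g k
    rw [e, e']
    -- The horizontal composite of the lifts of `φ` and `ψ` lies over their horizontal composite
    -- because `P.F` is a strict `2`-functor; hence it computes the restriction of the composite
    -- `1`-cell.
    refine (fib_map_el (η ▷ g' ≫ f ◁ θ) ?_).symm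
    rw [P.F.map₂_comp]
    subst h h' k k'
    obtain rfl := eq_of_heq H
    obtain rfl := eq_of_heq H'
    exact heq_comp (P.F.map_comp _ _) (P.F.map_comp _ _) (P.F.map_comp _ _)
      (map₂_whiskerRight_heq P.F _ _) (map₂_whiskerLeft_heq P.F _ _))

theorem fibMul_pair {x y z : P.C} {u : P.F.obj x ⟶ P.F.obj y} {v : P.F.obj y ⟶ P.F.obj z}
    {f : x ⟶ y} {g : y ⟶ z} (h : P.F.map f = u) (h' : P.F.map g = v) :
    (P.fibMul x y z).app (op (u ≫ v)) (pair (el f h) (el g h')) =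
      el (f ≫ g) (by rw [P.F.map_comp, h, h']) :=
  dayDesc_pair _ _ _ _

/-- The identity `1`-cells, as a map out of the unit presheaf. -/
noncomputable def fibUnit (x : P.C) : yoneda.obj (𝟙 (P.F.obj x)) ⟶ P.fib x x :=
  yonedaEquiv.symm (el (𝟙 x) (P.F.map_id x))

theorem fibUnit_id (x : P.C) :
    (P.fibUnit x).app (op (𝟙 (P.F.obj x))) (𝟙 (𝟙 (P.F.obj x))) = el (𝟙 x) (P.F.map_id x) := by
  change (P.fib x x).map (𝟙 (𝟙 (P.F.obj x))).op _ = _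
  simp

variable [Bicategory.Strict K]

/-- The presheaf of fibres, as a horizontal arrow of `ℙK`. -/
noncomputable abbrev fibHor (x y : P.C) : Hor (DblPsh.of (P.F.obj x)) (DblPsh.of (P.F.obj y)) :=
  P.fib x y

theorem tracks_fibMul {x y z : P.C} {u : P.F.obj x ⟶ P.F.obj y} {v : P.F.obj y ⟶ P.F.obj z}
    {f : x ⟶ y} {g : y ⟶ z} (h : P.F.map f = u) (h' : P.F.map g = v) :
    Tracks (globCell (U := hcomp (P.fibHor x y) (P.fibHor y z)) (V := P.fibHor x z)
      (P.fibMul x y z)) (elPair (U := P.fibHor x y) (V := P.fibHor y z) (el f h) (el g h'))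
      (el (f ≫ g) (by rw [P.F.map_comp, h, h']) : (P.fib x z).obj (op (u ≫ v))) := by
  exact (Tracks.globCell (U := hcomp (P.fibHor x y) (P.fibHor y z)) (V := P.fibHor x z)
    (P.fibMul x y z) (elPair (U := P.fibHor x y) (V := P.fibHor y z) (el f h) (el g h'))).of_eq
    (P.fibMul_pair h h')

theorem tracks_fibUnit (x : P.C) :
    Tracks (globCell (U := hid (DblPsh.of (P.F.obj x))) (V := P.fibHor x x) (P.fibUnit x))
      (elId (DblPsh.of (P.F.obj x))) (el (𝟙 x) (P.F.map_id x)) := by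
  exact (Tracks.globCell (U := hid (DblPsh.of (P.F.obj x))) (V := P.fibHor x x) (P.fibUnit x)
    (elId (DblPsh.of (P.F.obj x)))).of_eq (P.fibUnit_id x)

/-- The enriched category of a local discrete fibration. -/
noncomputable def toECat : ECat.{w, u, u₁, w + 1, w} (DblPsh K) where
  Ob := P.C
  extent x := ⟨P.F.obj x⟩
  hom x y := P.fibHor x y
  unit x := globGlobular (P.fibUnit x)
  mul x y z := globGlobular (P.fibMul x y z)
  unit_mul x y := by
    -- In each of the three axioms both sides are evaluated on generators, and the two values agree
    -- by the corresponding strict law of `P.C`.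
    refine Tracks.cell_ext_hid_hcomp (by simp) (by simp) fun u a => ?_
    obtain ⟨f, h, rfl⟩ := el_surjective a
    refine ⟨_, _, ((P.tracks_fibUnit x).hcompMap _ (Tracks.vid _ _)).vcomp
      (P.tracks_fibMul _ h), (Tracks.lunit _ _).of_sigma_eq ?_⟩
    exact sigma_el_eq_iff.2 (Bicategory.Strict.id_comp f).symm
  mul_unit x y := by
    refine Tracks.cell_ext_hcomp_hid (by simp) (by simp) fun u a => ?_
    obtain ⟨f, h, rfl⟩ := el_surjective a
    refine ⟨_, _, ((Tracks.vid _ _).hcompMap _ (P.tracks_fibUnit y)).vcomp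
      (P.tracks_fibMul h _), (Tracks.runit _ _).of_sigma_eq ?_⟩
    exact sigma_el_eq_iff.2 (Bicategory.Strict.comp_id f).symm
  mul_assoc x y z t := by
    refine Tracks.cell_ext_hcomp₃ (by simp) (by simp) fun u a v b r c => ?_
    obtain ⟨f, h, rfl⟩ := el_surjective a
    obtain ⟨f', h', rfl⟩ := el_surjective b
    obtain ⟨f'', h'', rfl⟩ := el_surjective c
    refine ⟨_, _, ((P.tracks_fibMul h h').hcompMap _ (Tracks.vid _ _)).vcomp
      (P.tracks_fibMul _ h''), ((Tracks.hassoc _ _ _ _ _ _).vcomp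
        (((Tracks.vid _ _).hcompMap _ (P.tracks_fibMul h' h'')).vcomp
          (P.tracks_fibMul h _))).of_sigma_eq ?_⟩
    exact sigma_el_eq_iff.2 (Bicategory.Strict.assoc f f' f'').symm

end

end LDF

end GenWood

namespace GenWood

open CategoryTheory Bicategory Opposite WeakDoubleCategory

universe w v u u₁ u₂ h c w' v' u' w₁ v₁ w₂ v₂ w₃ v₃ u₃

/-! ### The `2`-functor from local discrete fibrations to enriched categories -/

variable {K : Type u} [Bicategory.{w, w} K]

section
variable {A A' C' : K} {f : A' ⟶ A} {g : C' ⟶ A} {V : (A' ⟶ C')ᵒᵖ ⥤ Type w}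

/-- The square out of the identity presheaf that picks out an element of `V`. -/
def squareOfEl {v : A' ⟶ C'} (e : f = v ≫ g) (b : V.obj (op v)) :
    day (yoneda.obj f) (yoneda.obj (𝟙 A)) ⟶ day V (yoneda.obj g) :=
  dayRightUnitorHom (yoneda.obj f) ≫ yonedaEquiv.symm
    ((day V (yoneda.obj g)).map (eqToHom e).op (pair (V := yoneda.obj g) b (𝟙 g)))

theorem squareOfEl_tracksAt [Bicategory.Strict K] {v : A' ⟶ C'} (e : f = v ≫ g)
    (b : V.obj (op v)) :
    TracksAt (U := yoneda.obj (𝟙 A)) (squareOfEl (V := V) e b) (𝟙 (𝟙 A)) b := by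
  -- The square is the right unitor followed by the map that the Yoneda lemma attaches to the chosen
  -- element; evaluating that map at `𝟙 f` returns the element.
  refine ⟨(Bicategory.Strict.comp_id f).trans e, ?_⟩
  have h : ∀ x : (day V (yoneda.obj g)).obj (op f),
      (yonedaEquiv.symm x).app (op f) (𝟙 f) = x := yonedaEquiv.apply_symm_apply
  rw [squareOfEl, NatTrans.comp_app_apply, dayRightUnitorHom_pair, NatTrans.naturality_apply, h,
    map_op_map_op]
  refine map_op_congr (day V (yoneda.obj g)) ?_ _
  simp [Bicategory.Strict.rightUnitor_eqToIso]

end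

section
variable {D : Type u} [WeakDoubleCategory.{v, u, h, c} D] {A C A' B' C' : D} {U : Hor A C}
  {V : Hor A' B'} {W : Hor B' C'} {X : Hor A' C'}

/-- These four boundary computations hold in any weak double category. They match the boundaries of
the two sides of an enriched naturality axiom. -/
theorem left_lunitInv_hcompMap_globular (α : Cell (hid A) V) (β : Cell U W) (e)
    (G : Globular (hcomp V W) X) : left (lunitInv U ≫ᵥ hcompMap α β e ≫ᵥ G.cell) = left α := by
  simp

theorem right_lunitInv_hcompMap_globular (α : Cell (hid A) V) (β : Cell U W) (e)
    (G : Globular (hcomp V W) X) : right (lunitInv U ≫ᵥ hcompMap α β e ≫ᵥ G.cell) = right β := by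
  simp

theorem left_runitInv_hcompMap_globular (α : Cell U V) (β : Cell (hid C) W) (e)
    (G : Globular (hcomp V W) X) : left (runitInv U ≫ᵥ hcompMap α β e ≫ᵥ G.cell) = left α := by
  simp

theorem right_runitInv_hcompMap_globular (α : Cell U V) (β : Cell (hid C) W) (e)
    (G : Globular (hcomp V W) X) : right (runitInv U ≫ᵥ hcompMap α β e ≫ᵥ G.cell) = right β := by
  simp

end

namespace LDF
variable {P Q R : LDF.{w, u, u₁} K}

theorem Hom.leg_naturality (S : Hom P Q) {x y : P.C} (f : x ⟶ y) :
    Q.F.map (S.H.map f) ≫ S.leg y = S.leg x ≫ P.F.map f :=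
  S.γ.naturality f

theorem Hom.leg_naturality₂ (S : Hom P Q) {x y : P.C} {f g : x ⟶ y} (η : f ⟶ g) :
    HEq (Q.F.map₂ (S.H.map₂ η) ▷ S.leg y) (S.leg x ◁ P.F.map₂ η) :=
  S.γ.naturality₂ η

/-- The action of a lax triangle on `1`-cells, as a square of presheaves. -/
noncomputable def Hom.square (S : Hom P Q) (x y : P.C) :
    day (yoneda.obj (S.leg x)) (P.fib x y) ⟶
      day (Q.fib (S.H.obj x) (S.H.obj y)) (yoneda.obj (S.leg y)) :=
  squareMk (fun _ a => Q.F.map (S.H.map a.1)) (fun _ a => el (S.H.map a.1) rfl)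
    (fun _ a => (congrArg (S.leg x ≫ ·) a.2.symm).trans (S.leg_naturality a.1).symm) (by
      intro u u' φ a
      obtain ⟨f, h, rfl⟩ := el_surjective a
      obtain ⟨f', h', η, H, e⟩ := exists_lift φ f h
      rw [e]
      -- The lift of `S.leg x ◁ φ` along `S.leg y` comes from applying `S.H` to the lift `η` of `φ`;
      -- that it is a lift is the `2`-dimensional naturality of `S.γ`.
      refine ⟨Q.F.map₂ (S.H.map₂ η), fib_map_el (S.H.map₂ η) HEq.rfl, ?_⟩
      subst h h'
      obtain rfl := eq_of_heq H
      exact (S.leg_naturality₂ η).symm)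

theorem Hom.square_tracksAt (S : Hom P Q) {x y : P.C} {u : P.F.obj x ⟶ P.F.obj y} (f : x ⟶ y)
    (h : P.F.map f = u) {v : Q.F.obj (S.H.obj x) ⟶ Q.F.obj (S.H.obj y)}
    (h' : Q.F.map (S.H.map f) = v) : TracksAt (S.square x y) (el f h) (el (S.H.map f) h') := by
  subst h'
  exact squareMk_tracksAt _ _ _ _ (el f h)

variable [Bicategory.Strict K]

/-- The vertical morphism of `ℙK` given by a leg of a lax triangle. -/
def Hom.vert (S : Hom P Q) (x : P.C) : P.toECat.extent x ⟶ Q.toECat.extent (S.H.obj x) :=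
  ⟨S.leg x, S.isDiscFib x⟩

/-- The action of a lax triangle on `1`-cells, as a cell of `ℙK`. -/
noncomputable def Hom.cell (S : Hom P Q) (x y : P.C) :
    Cell (P.toECat.hom x y) (Q.toECat.hom (S.H.obj x) (S.H.obj y)) :=
  PCell.mk (Y := yonedaHom K) (S.vert x) (S.vert y) (S.square x y)

/-- A `1`-cell over `u`, as an element of a hom of the enriched category. -/
def homEl {x y : P.C} {u : P.F.obj x ⟶ P.F.obj y} (f : x ⟶ y) (h : P.F.map f = u) :
    El (P.toECat.hom x y) u :=
  el f h

theorem homEl_surjective {x y : P.C} {u : P.F.obj x ⟶ P.F.obj y} (a : El (P.toECat.hom x y) u) :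
    ∃ (f : x ⟶ y) (h : P.F.map f = u), a = homEl f h :=
  el_surjective a

theorem sigma_homEl_eq_iff {x y : P.C} {u v : P.F.obj x ⟶ P.F.obj y} {f g : x ⟶ y}
    {h : P.F.map f = u} {h' : P.F.map g = v} :
    (⟨u, homEl f h⟩ : (u : P.F.obj x ⟶ P.F.obj y) × El (P.toECat.hom x y) u) = ⟨v, homEl g h'⟩ ↔
      f = g :=
  sigma_el_eq_iff

/-- The value may be any `k` equal to `f ≫ g`: functoriality and naturality laws enter through `e`
when the values of two sides have to be matched. -/
theorem tracks_mul {x y z : P.C} {u : P.F.obj x ⟶ P.F.obj y} {v : P.F.obj y ⟶ P.F.obj z}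
    {f : x ⟶ y} {g : y ⟶ z} (h : P.F.map f = u) (h' : P.F.map g = v)
    {k : x ⟶ z} {t : P.F.obj x ⟶ P.F.obj z} (hk : P.F.map k = t) (e : f ≫ g = k) :
    Tracks (P.toECat.mul x y z).cell (elPair (homEl f h) (homEl g h')) (homEl k hk) :=
  (P.tracks_fibMul h h').of_sigma_eq (sigma_el_eq_iff.2 e)

theorem tracks_unit (x : P.C) {u : P.F.obj x ⟶ P.F.obj x} (h : P.F.map (𝟙 x) = u) :
    Tracks (P.toECat.unit x).cell (elId (P.toECat.extent x)) (homEl (𝟙 x) h) :=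
  (P.tracks_fibUnit x).of_sigma_eq (sigma_el_eq_iff.2 rfl)

theorem Hom.tracks_cell (S : Hom P Q) {x y : P.C} {u : P.F.obj x ⟶ P.F.obj y} {f : x ⟶ y}
    (h : P.F.map f = u) {g : S.H.obj x ⟶ S.H.obj y}
    {v : Q.F.obj (S.H.obj x) ⟶ Q.F.obj (S.H.obj y)}
    (h' : Q.F.map g = v) (e : S.H.map f = g) : Tracks (S.cell x y) (homEl f h) (homEl g h') := by
  subst e
  exact S.square_tracksAt f h h'

/-- The enriched functor given by a lax triangle. -/
noncomputable def Hom.toEFunctor (S : Hom P Q) : EFunctor P.toECat Q.toECat where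
  obj := S.H.obj
  vert x := S.vert x
  map x y := S.cell x y
  left_map _ _ := rfl
  right_map _ _ := rfl
  map_unit x := by
    refine Tracks.cell_ext_hid ?_ ?_ ⟨_, _, (tracks_unit x rfl).vcomp
      (S.tracks_cell rfl (Q.F.map_id _) (S.H.map_id x)),
      (Tracks.hidMap _).vcomp (tracks_unit _ _)⟩
    · rw [left_vcomp, left_vcomp, Globular.left_cell, Globular.left_cell, left_hidMap,
        Category.id_comp, Category.comp_id]
      rfl
    · rw [right_vcomp, right_vcomp, Globular.right_cell, Globular.right_cell, right_hidMap,
        Category.id_comp, Category.comp_id]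
      rfl
  map_mul x y z := by
    refine Tracks.cell_ext_hcomp ?_ ?_ fun u a v b => ?_
    · rw [left_vcomp, left_vcomp, Globular.left_cell, Globular.left_cell, left_hcompMap,
        Category.id_comp, Category.comp_id]
      rfl
    · rw [right_vcomp, right_vcomp, Globular.right_cell, Globular.right_cell, right_hcompMap,
        Category.id_comp, Category.comp_id]
      rfl
    obtain ⟨f, h, rfl⟩ := homEl_surjective a
    obtain ⟨g, h', rfl⟩ := homEl_surjective b
    -- Preservation of composition by `S.H` is what makes the values of the two sides coincide.
    exact ⟨_, _, (tracks_mul h h' ((P.F.map_comp f g).trans (by rw [h, h'])) rfl).vcomp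
      (S.tracks_cell _ rfl (S.H.map_comp f g)),
      ((S.tracks_cell h rfl rfl).hcompMap _ (S.tracks_cell h' rfl rfl)).vcomp
        (tracks_mul _ _ _ rfl)⟩

/-- The component of the enriched transformation given by a `2`-cell of lax triangles. -/
noncomputable def Hom₂.cell {S T : Hom P Q} (σ : Hom₂ S T) (x : P.C) :
    Cell (hid (P.toECat.extent x)) (Q.toECat.hom (S.H.obj x) (T.H.obj x)) :=
  PCell.mk (Y := yonedaHom K) (S.vert x) (T.vert x)
    (squareOfEl (f := S.leg x) (g := T.leg x) (V := Q.fib (S.H.obj x) (T.H.obj x))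
      (σ.comm_app x).symm (el (σ.θ.app x) rfl))

theorem Hom₂.tracks_cell {S T : Hom P Q} (σ : Hom₂ S T) (x : P.C)
    {v : Q.F.obj (S.H.obj x) ⟶ Q.F.obj (T.H.obj x)} (h : Q.F.map (σ.θ.app x) = v) :
    Tracks (σ.cell x) (elId (P.toECat.extent x)) (homEl (σ.θ.app x) h) := by
  subst h
  exact squareOfEl_tracksAt (f := S.leg x) (g := T.leg x) (V := Q.fib (S.H.obj x) (T.H.obj x))
      (σ.comm_app x).symm (el (σ.θ.app x) rfl)

/-- The enriched transformation given by a `2`-cell of lax triangles. -/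
noncomputable def Hom₂.toENatTrans {S T : Hom P Q} (σ : Hom₂ S T) :
    ENatTrans S.toEFunctor T.toEFunctor where
  app x := σ.cell x
  left_app _ := rfl
  right_app _ := rfl
  naturality x y := by
    refine Tracks.cell_ext
      ((left_lunitInv_hcompMap_globular (U := P.toECat.hom x y) _ _ _ _).trans <|
        (show left (σ.cell x) = left (S.toEFunctor.map x y) from rfl).trans
        (left_runitInv_hcompMap_globular (U := P.toECat.hom x y) _ _ _ _).symm)
      ((right_lunitInv_hcompMap_globular (U := P.toECat.hom x y) _ _ _ _).trans <|
        (show right (T.toEFunctor.map x y) = right (σ.cell y) from rfl).trans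
        (right_runitInv_hcompMap_globular (U := P.toECat.hom x y) _ _ _ _).symm) fun u a => ?_
    obtain ⟨f, h, rfl⟩ := homEl_surjective a
    -- On the element `f`, the enriched naturality axiom is the naturality square of `σ.θ` at `f`.
    exact ⟨_, _, (Tracks.lunitInv _ _).vcomp (((σ.tracks_cell x rfl).hcompMap _
      (T.tracks_cell h rfl rfl)).vcomp (tracks_mul _ _ rfl (σ.θ.naturality f).symm)),
      (Tracks.runitInv _ _).vcomp (((S.tracks_cell h rfl rfl).hcompMap _
      (σ.tracks_cell y rfl)).vcomp (tracks_mul _ _ rfl rfl))⟩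

/-- This and the following laws of the `2`-functor are immediate on elements, since pasting of cells
is composition of the functions that they track. -/
theorem Hom.toEFunctor_id (P : LDF.{w, u, u₁} K) : (Hom.id P).toEFunctor = EFunctor.id P.toECat :=
  EFunctor.ext' (fun _ => rfl) (fun _ => HEq.rfl) fun x y => heq_of_eq <| by
    refine Tracks.cell_ext rfl rfl fun u a => ?_
    obtain ⟨f, h, rfl⟩ := homEl_surjective a
    exact ⟨_, _, (Hom.id P).tracks_cell h h rfl, Tracks.vid _ _⟩

theorem Hom.toEFunctor_comp (S : Hom P Q) (T : Hom Q R) :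
    (S.comp T).toEFunctor = S.toEFunctor.comp T.toEFunctor :=
  EFunctor.ext' (fun _ => rfl) (fun _ => HEq.rfl) fun x y => heq_of_eq <| by
    refine Tracks.cell_ext rfl rfl fun u a => ?_
    obtain ⟨f, h, rfl⟩ := homEl_surjective a
    exact ⟨_, _, (S.comp T).tracks_cell h rfl rfl,
      (S.tracks_cell h rfl rfl).vcomp (T.tracks_cell rfl rfl rfl)⟩

theorem Hom₂.toENatTrans_id (S : Hom P Q) :
    (Hom₂.id S).toENatTrans = ENatTrans.id S.toEFunctor := by
  refine ENatTrans.ext (funext fun x => Tracks.cell_ext_hid ?_ ?_ ⟨_, _,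
    (Hom₂.id S).tracks_cell x rfl, (Tracks.hidMap _).vcomp (tracks_unit _ rfl)⟩)
  · rw [ENatTrans.left_app, ENatTrans.left_app]
  · rw [ENatTrans.right_app, ENatTrans.right_app]

theorem Hom₂.toENatTrans_comp {S T V : Hom P Q} (σ : Hom₂ S T) (τ : Hom₂ T V) :
    (σ.comp τ).toENatTrans = σ.toENatTrans.comp τ.toENatTrans := by
  refine ENatTrans.ext (funext fun x => Tracks.cell_ext_hid ?_ ?_ ⟨_, _,
    (σ.comp τ).tracks_cell x rfl, (Tracks.lunitInv _ _).vcomp (((σ.tracks_cell x rfl).hcompMap _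
      (τ.tracks_cell x rfl)).vcomp (tracks_mul _ _ rfl rfl))⟩)
  · rw [ENatTrans.left_app, ENatTrans.left_app]
  · rw [ENatTrans.right_app, ENatTrans.right_app]

/-- The two transformations have different, though equal, source and target enriched functors by
`Hom.toEFunctor_comp`; hence the heterogeneous equality. -/
theorem Hom₂.toENatTrans_whiskerLeft (S : Hom P Q) {T V : Hom Q R} (τ : Hom₂ T V) :
    HEq (τ.whiskerLeft S).toENatTrans (ENatTrans.whiskerLeft S.toEFunctor τ.toENatTrans) :=
  ENatTrans.heq_of _ _ (S.toEFunctor_comp T) (S.toEFunctor_comp V) fun x => heq_of_eq <| by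
    refine Tracks.cell_ext_hid rfl rfl ⟨_, _, (τ.whiskerLeft S).tracks_cell x rfl,
      (Tracks.hidMap _).vcomp (τ.tracks_cell _ rfl)⟩

theorem Hom₂.toENatTrans_whiskerRight {S T : Hom P Q} (σ : Hom₂ S T) (V : Hom Q R) :
    HEq (σ.whiskerRight V).toENatTrans (ENatTrans.whiskerRight σ.toENatTrans V.toEFunctor) :=
  ENatTrans.heq_of _ _ (S.toEFunctor_comp V) (T.toEFunctor_comp V) fun x => heq_of_eq <| by
    refine Tracks.cell_ext_hid rfl rfl ⟨_, _, (σ.whiskerRight V).tracks_cell x rfl,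
      (σ.tracks_cell x rfl).vcomp (V.tracks_cell _ rfl rfl)⟩

variable (K) in
/-- The `2`-functor sending a local discrete fibration to its enriched category of fibres. -/
noncomputable def enrich :
    StrictPseudofunctor (LDF.{w, u, u₁} K) (ECat.{w, u, u₁, w + 1, w} (DblPsh K)) :=
  StrictPseudofunctor.mk''
    { obj := fun P => P.toECat
      map := fun S => Hom.toEFunctor S
      map₂ := fun σ => Hom₂.toENatTrans σ
      map₂_id := fun S => Hom₂.toENatTrans_id S
      map₂_comp := fun σ τ => Hom₂.toENatTrans_comp σ τ
      map_id := fun P => Hom.toEFunctor_id P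
      map_comp := fun S T => Hom.toEFunctor_comp S T
      map₂_whisker_left := fun {P _ R} S _ _ τ =>
        eq_conj_of_heq (C := P.toECat ⟶ R.toECat) (x := Hom₂.toENatTrans (Hom₂.whiskerLeft S τ))
          _ _ (Hom₂.toENatTrans_whiskerLeft S τ)
      map₂_whisker_right := fun {P _ R _ _} σ V =>
        eq_conj_of_heq (C := P.toECat ⟶ R.toECat) (x := Hom₂.toENatTrans (Hom₂.whiskerRight σ V))
          _ _ (Hom₂.toENatTrans_whiskerRight σ V) }

end LDF

end GenWood

/-! ### Recovering lax triangles and their `2`-cells from enriched data -/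

namespace GenWood

open CategoryTheory Bicategory Opposite WeakDoubleCategory

universe w v u u₁ u₂ h c w' v' u' w₁ v₁ w₂ v₂ w₃ v₃ u₃

theorem prelaxFunctor_ext {A : Type u₁} [Bicategory.{w₁, v₁} A] {B : Type u₂}
    [Bicategory.{w₂, v₂} B] {F G : PrelaxFunctor A B} (h₀ : ∀ a, F.obj a = G.obj a)
    (h₁ : ∀ {a b : A} (f : a ⟶ b), HEq (F.map f) (G.map f))
    (h₂ : ∀ {a b : A} {f g : a ⟶ b} (η : f ⟶ g), HEq (F.map₂ η) (G.map₂ η)) : F = G := by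
  obtain ⟨⟨⟨o, m⟩, m₂⟩, _, _⟩ := F
  obtain ⟨⟨⟨o', m'⟩, m₂'⟩, _, _⟩ := G
  dsimp only at h₀ h₁ h₂
  obtain rfl : o = o' := funext h₀
  obtain rfl : @m = @m' := by
    funext a b f
    exact eq_of_heq (h₁ f)
  obtain rfl : @m₂ = @m₂' := by
    funext a b f g η
    exact eq_of_heq (h₂ η)
  rfl

variable {K : Type u} [Bicategory.{w, w} K]

theorem Tracks.congr_cell [Bicategory.Strict K] {A A' C C' : DblPsh K} {U : Hor A C}
    {V : Hor A' C'} {α β : Cell U V} {u : A.as ⟶ C.as} {a : El U u} {v : A'.as ⟶ C'.as} {b : El V v}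
    (h : Tracks α a b) (e : α = β) : Tracks β a b := e ▸ h

namespace LDF
variable {P Q : LDF.{w, u, u₁} K}

/-- Both `Q.F` on hom-categories and postcomposition with `l` are discrete fibrations, hence
faithful. Equations between `2`-cells of `Q.C` can therefore be checked in `K` after whiskering with
a leg. -/
theorem hom₂_heq_of_whiskerRight_heq {x y : Q.C} {z : K} {l : Q.F.obj y ⟶ z} (hl : IsDiscFib l)
    {f f' g g' : x ⟶ y} {η : f ⟶ g} {η' : f' ⟶ g'} (hf : f = f') (hg : g = g')
    (H : HEq (Q.F.map₂ η ▷ l) (Q.F.map₂ η' ▷ l)) : HEq η η' := by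
  subst hf hg
  exact heq_of_eq (map₂_injective ((hl _).hom_ext (eq_of_heq H)))

variable [Bicategory.Strict K]

section OfEFunctor
variable (T : EFunctor P.toECat Q.toECat)

/-- The action on objects of an enriched functor. -/
def eObj (x : P.C) : Q.C := T.obj x

/-- The leg of the lax triangle of an enriched functor. -/
def eLeg (x : P.C) : Q.F.obj (eObj T x) ⟶ P.F.obj x := (T.vert x).1

theorem eLeg_isDiscFib (x : P.C) : IsDiscFib (eLeg T x) := (T.vert x).2

theorem left_eMap (x y : P.C) : (left (T.map x y)).1 = eLeg T x :=
  congrArg Subtype.val (T.left_map x y)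

theorem right_eMap (x y : P.C) : (right (T.map x y)).1 = eLeg T y :=
  congrArg Subtype.val (T.right_map x y)

/-- The value tracked by an element of a fibre is again an element of a fibre, that is, a `1`-cell
of `Q.C`. Such a value exists because the right side of the cell is a discrete fibration. -/
theorem exists_eMap {x y : P.C} (f : x ⟶ y) : ∃ g : eObj T x ⟶ eObj T y,
    Tracks (T.map x y) (homEl f rfl) (homEl (P := Q) g rfl) := by
  obtain ⟨v, b, hb⟩ := Tracks.exists_of (T.map x y) (homEl f rfl)
  obtain ⟨g, rfl, rfl⟩ := homEl_surjective (P := Q) (x := eObj T x) (y := eObj T y) b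
  exact ⟨g, hb⟩

/-- The action on `1`-cells of an enriched functor. -/
noncomputable def eMap {x y : P.C} (f : x ⟶ y) : eObj T x ⟶ eObj T y :=
  (exists_eMap T f).choose

theorem tracks_eMap {x y : P.C} {f : x ⟶ y} {u : P.F.obj x ⟶ P.F.obj y} (h : P.F.map f = u)
    {v : Q.F.obj (eObj T x) ⟶ Q.F.obj (eObj T y)} (h' : Q.F.map (eMap T f) = v) :
    Tracks (T.map x y) (homEl f h) (homEl (eMap T f) h') := by
  subst h h'
  exact (exists_eMap T f).choose_spec

theorem eMap_eq {x y : P.C} {f : x ⟶ y} {g : eObj T x ⟶ eObj T y}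
    {u : P.F.obj x ⟶ P.F.obj y} {h : P.F.map f = u}
    {v : Q.F.obj (eObj T x) ⟶ Q.F.obj (eObj T y)} {h' : Q.F.map g = v}
    (H : Tracks (T.map x y) (homEl f h) (homEl g h')) : eMap T f = g :=
  sigma_homEl_eq_iff.1 ((tracks_eMap T h rfl).unique H)

theorem eMap_comm {x y : P.C} (f : x ⟶ y) :
    Q.F.map (eMap T f) ≫ eLeg T y = eLeg T x ≫ P.F.map f := by
  have := (tracks_eMap T (f := f) rfl rfl).comm
  exact (congrArg (_ ≫ ·) (right_eMap T x y)).symm.trans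
    (this.symm.trans (congrArg (· ≫ _) (left_eMap T x y)))

/-- The `2`-cell `eLeg T x ◁ P.F.map₂ η` is lifted along `eLeg T y`, and the result is lifted along
`Q.F` to a `2`-cell with codomain `eMap T g`. Since `f` is the restriction of `g` along the image of
`η`, naturality of tracking shows that the domain of this lift is tracked by `f`; so it is `eMap T
f`. -/
theorem exists_eMap₂ {x y : P.C} {f g : x ⟶ y} (η : f ⟶ g) :
    ∃ θ : eMap T f ⟶ eMap T g, HEq (Q.F.map₂ θ ▷ eLeg T y) (eLeg T x ◁ P.F.map₂ η) := by
  obtain ⟨v, hv, ψ, hψ⟩ := (eLeg_isDiscFib T y _).exists_lift (eMap_comm T g)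
    (eLeg T x ◁ P.F.map₂ η)
  change HEq (ψ ▷ eLeg T y) _ at hψ
  change v ≫ eLeg T y = _ at hv
  obtain ⟨k, hk, θ, hθ, e⟩ := exists_lift ψ (eMap T g) rfl
  have h₁ : (P.fib x y).map (P.F.map₂ η).op (el g rfl) = el f rfl := fib_map_el η HEq.rfl
  have h₂ : Tracks (T.map x y) ((psh (P.toECat.hom x y)).map (P.F.map₂ η).op (homEl g rfl))
      ((psh (Q.toECat.hom _ _)).map ψ.op (homEl (eMap T g) rfl)) := by
    refine (tracks_eMap T (f := g) rfl rfl).map (P.F.map₂ η) ψ ?_ ?_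
    · rw [left_eMap, right_eMap]
      exact hv.symm
    · rw [left_eMap, right_eMap]
      exact hψ.symm
  have h₃ : Tracks (T.map x y) (homEl f rfl) (homEl k hk) :=
    (h₂.of_eq e).of_sigma_eq_left (Sigma.ext rfl (heq_of_eq h₁))
  -- Uniqueness of tracked values identifies the domain `k` of the lift with `eMap T f`.
  obtain rfl := eMap_eq T h₃
  subst hk
  obtain rfl := eq_of_heq hθ
  exact ⟨θ, hψ⟩

/-- The action on `2`-cells of an enriched functor. -/
noncomputable def eMap₂ {x y : P.C} {f g : x ⟶ y} (η : f ⟶ g) : eMap T f ⟶ eMap T g :=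
  (exists_eMap₂ T η).choose

theorem eMap₂_spec {x y : P.C} {f g : x ⟶ y} (η : f ⟶ g) :
    HEq (Q.F.map₂ (eMap₂ T η) ▷ eLeg T y) (eLeg T x ◁ P.F.map₂ η) :=
  (exists_eMap₂ T η).choose_spec

/-- The two sides of the unit axiom `T.map_unit` are evaluated at the universal element and
uniqueness of tracked values is applied; composition is treated in the same way with `T.map_mul`. -/
theorem eMap_id (x : P.C) : eMap T (𝟙 x) = 𝟙 (eObj T x) := by
  have h₁ := (tracks_unit x rfl).vcomp (tracks_eMap T (f := 𝟙 x) rfl rfl)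
  exact sigma_homEl_eq_iff.1 ((h₁.congr_cell (T.map_unit x)).unique ((Tracks.hidMap _).vcomp (tracks_unit _ rfl)))

theorem eMap_comp {x y z : P.C} (f : x ⟶ y) (g : y ⟶ z) :
    eMap T (f ≫ g) = eMap T f ≫ eMap T g := by
  have h₁ := (tracks_mul rfl rfl rfl rfl).vcomp (tracks_eMap T (f := f ≫ g) rfl rfl)
  exact sigma_homEl_eq_iff.1 ((h₁.congr_cell (T.map_mul x y z)).unique (((tracks_eMap T rfl rfl).hcompMap _
    (tracks_eMap T rfl rfl)).vcomp (tracks_mul rfl rfl rfl rfl)))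

/-- The equation in `K` characterises the image of `η`, by faithfulness. Functoriality and
compatibility with whiskering thus reduce to computations in `K`. -/
theorem eMap₂_heq {x y : P.C} {f g : x ⟶ y} (η : f ⟶ g)
    {f' g' : eObj T x ⟶ eObj T y} {θ : f' ⟶ g'} (hf : eMap T f = f')
    (hg : eMap T g = g') (H : HEq (Q.F.map₂ θ ▷ eLeg T y) (eLeg T x ◁ P.F.map₂ η)) :
    HEq (eMap₂ T η) θ :=
  hom₂_heq_of_whiskerRight_heq (eLeg_isDiscFib T y) hf hg ((eMap₂_spec T η).trans H.symm)

theorem eMap₂_id {x y : P.C} (f : x ⟶ y) : eMap₂ T (𝟙 f) = 𝟙 (eMap T f) :=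
  eq_of_heq <| eMap₂_heq T _ rfl rfl <| by
    rw [Q.F.map₂_id, P.F.map₂_id, id_whiskerRight, Bicategory.whiskerLeft_id, eMap_comm]

theorem eMap₂_comp {x y : P.C} {f g k : x ⟶ y} (η : f ⟶ g) (θ : g ⟶ k) :
    eMap₂ T (η ≫ θ) = eMap₂ T η ≫ eMap₂ T θ :=
  eq_of_heq <| eMap₂_heq T _ rfl rfl <| by
    rw [Q.F.map₂_comp, P.F.map₂_comp, comp_whiskerRight, Bicategory.whiskerLeft_comp]
    exact heq_comp (eMap_comm T f) (eMap_comm T g) (eMap_comm T k) (eMap₂_spec T η)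
      (eMap₂_spec T θ)

theorem eMap₂_whiskerLeft {x y z : P.C} (f : x ⟶ y) {g k : y ⟶ z} (η : g ⟶ k) :
    HEq (eMap₂ T (f ◁ η)) (eMap T f ◁ eMap₂ T η) := by
  refine eMap₂_heq T _ (eMap_comp T _ _) (eMap_comp T _ _) ?_
  refine (whiskerRight_heq (Q.F.map_comp _ _) (Q.F.map_comp _ _)
    (map₂_whiskerLeft_heq Q.F _ _) _).trans ?_
  refine (whisker_assoc_heq _ _ _).trans ?_
  refine (whiskerLeft_heq (eMap_comm T _) (eMap_comm T _) (eMap₂_spec T η) _).trans ?_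
  refine (comp_whiskerLeft_heq _ _ _).symm.trans ?_
  -- The leg has been moved to the left of `η`; naturality of the legs in `f` now moves it to the
  -- left of `f`.
  refine (whiskerLeft_heq_congr (eMap_comm T f) rfl rfl HEq.rfl).trans ?_
  refine (comp_whiskerLeft_heq _ _ _).trans ?_
  exact (whiskerLeft_heq (P.F.map_comp _ _) (P.F.map_comp _ _)
    (map₂_whiskerLeft_heq P.F _ _) _).symm

theorem eMap₂_whiskerRight {x y z : P.C} {f g : x ⟶ y} (η : f ⟶ g) (k : y ⟶ z) :
    HEq (eMap₂ T (η ▷ k)) (eMap₂ T η ▷ eMap T k) := by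
  refine eMap₂_heq T _ (eMap_comp T _ _) (eMap_comp T _ _) ?_
  refine (whiskerRight_heq (Q.F.map_comp _ _) (Q.F.map_comp _ _)
    (map₂_whiskerRight_heq Q.F _ _) _).trans ?_
  refine (whiskerRight_comp_heq _ _ _).symm.trans ?_
  refine (whiskerRight_heq_congr rfl rfl HEq.rfl (eMap_comm T k)).trans ?_
  refine (whiskerRight_comp_heq _ _ _).trans ?_
  refine (whiskerRight_heq (eMap_comm T _) (eMap_comm T _) (eMap₂_spec T η) _).trans ?_
  refine (whisker_assoc_heq _ _ _).trans ?_
  exact (whiskerLeft_heq (P.F.map_comp _ _) (P.F.map_comp _ _)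
    (map₂_whiskerRight_heq P.F _ _) _).symm

/-- The lax triangle of an enriched functor. -/
noncomputable def ofEFunctor : Hom P Q where
  H := StrictPseudofunctor.mk''
    { obj := T.obj
      map := eMap T
      map₂ := eMap₂ T
      map₂_id := eMap₂_id T
      map₂_comp := eMap₂_comp T
      map_id := eMap_id T
      map_comp := eMap_comp T
      map₂_whisker_left f _ _ η := eq_conj_of_heq _ _ (eMap₂_whiskerLeft T f η)
      map₂_whisker_right η f := eq_conj_of_heq _ _ (eMap₂_whiskerRight T η f) }
  γ :=
    { app := eLeg T
      naturality := eMap_comm T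
      naturality₂ := eMap₂_spec T }
  isDiscFib := eLeg_isDiscFib T

theorem toEFunctor_ofEFunctor : (ofEFunctor T).toEFunctor = T :=
  EFunctor.ext' (fun _ => rfl) (fun _ => HEq.rfl) fun x y => heq_of_eq <| by
    refine Tracks.cell_ext (T.left_map x y).symm (T.right_map x y).symm fun u a => ?_
    obtain ⟨f, h, rfl⟩ := homEl_surjective a
    exact ⟨_, _, (ofEFunctor T).tracks_cell h rfl rfl, tracks_eMap T h rfl⟩

end OfEFunctor

/-- The objects and legs agree by definition, and the `1`-cells by uniqueness of tracked values. The
`2`-cells agree because `2`-dimensional naturality of `S.γ` is the property that characterises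
`eMap₂`. -/
theorem ofEFunctor_toEFunctor (S : Hom P Q) : ofEFunctor S.toEFunctor = S := by
  have h₁ : ∀ {x y : P.C} (f : x ⟶ y), eMap S.toEFunctor f = S.H.map f :=
    fun f => eMap_eq S.toEFunctor (S.tracks_cell rfl rfl rfl)
  exact Hom.ext_of (prelaxFunctor_ext (fun _ => rfl) (fun f => heq_of_eq (h₁ f)) fun η =>
    eMap₂_heq S.toEFunctor η (h₁ _) (h₁ _) (S.leg_naturality₂ η)) fun _ => HEq.rfl

theorem toEFunctor_bijective (P Q : LDF.{w, u, u₁} K) :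
    Function.Bijective (fun S : Hom P Q => S.toEFunctor) :=
  Function.bijective_iff_has_inverse.2
    ⟨ofEFunctor, ofEFunctor_toEFunctor, toEFunctor_ofEFunctor⟩

section OfENatTrans
variable {S T : Hom P Q} (α : ENatTrans S.toEFunctor T.toEFunctor)

theorem exists_eApp (x : P.C) : ∃ g : S.H.obj x ⟶ T.H.obj x,
    Tracks (α.app x) (elId (P.toECat.extent x)) (homEl (P := Q) g rfl) := by
  obtain ⟨v, b, hb⟩ := Tracks.exists_of (α.app x) (elId (P.toECat.extent x))
  obtain ⟨g, rfl, rfl⟩ := homEl_surjective (P := Q) b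
  exact ⟨g, hb⟩

/-- The components of an enriched transformation, as `1`-cells. -/
noncomputable def eApp (x : P.C) : S.H.obj x ⟶ T.H.obj x := (exists_eApp α x).choose

theorem tracks_eApp (x : P.C) :
    Tracks (α.app x) (elId (P.toECat.extent x)) (homEl (P := Q) (eApp α x) rfl) :=
  (exists_eApp α x).choose_spec

theorem eApp_comm (x : P.C) : Q.F.map (eApp α x) ≫ T.leg x = S.leg x := by
  have h₁ := (tracks_eApp α x).comm
  exact (congrArg (_ ≫ ·) (congrArg Subtype.val (α.right_app x))).symm.trans (h₁.symm.trans
    ((congrArg (· ≫ _) (congrArg Subtype.val (α.left_app x))).trans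
      (Bicategory.Strict.comp_id (S.leg x))))

/-- The enriched naturality axiom is evaluated at the element `f`, and its two tracked values are
compared. -/
theorem eApp_naturality {x y : P.C} (f : x ⟶ y) :
    S.H.map f ≫ eApp α y = eApp α x ≫ T.H.map f := by
  have h₁ := (Tracks.lunitInv (P.toECat.hom x y) (homEl f rfl)).vcomp
    (((tracks_eApp α x).hcompMap (α.right_app x)
      (T.tracks_cell rfl rfl rfl)).vcomp (tracks_mul rfl rfl rfl rfl))
  have h₂ := (Tracks.runitInv (P.toECat.hom x y) (homEl f rfl)).vcomp
    (((S.tracks_cell rfl rfl rfl).hcompMap (α.left_app y).symm (tracks_eApp α y)).vcomp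
      (tracks_mul rfl rfl rfl rfl))
  exact (sigma_homEl_eq_iff.1 ((h₁.congr_cell (α.naturality x y)).unique h₂)).symm

/-- Enriched naturality concerns `1`-cells only, but the statement for `2`-cells follows. After
applying `Q.F` and whiskering with `T.leg y`, the triangle equation `eApp_comm` and naturality of
the legs reduce both sides to `S.leg x ◁ P.F.map₂ η`, and these operations are faithful. -/
theorem eApp_naturality₂ {x y : P.C} {f g : x ⟶ y} (η : f ⟶ g) :
    HEq (S.H.map₂ η ▷ eApp α y) (eApp α x ◁ T.H.map₂ η) := by
  refine hom₂_heq_of_whiskerRight_heq (T.isDiscFib y) (eApp_naturality α f) (eApp_naturality α g) ?_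
  change HEq (_ ▷ T.leg y) (_ ▷ T.leg y)
  refine (whiskerRight_heq (Q.F.map_comp _ _) (Q.F.map_comp _ _)
    (map₂_whiskerRight_heq Q.F _ _) _).trans ?_
  refine (whiskerRight_comp_heq _ _ _).symm.trans ?_
  refine (whiskerRight_heq_congr rfl rfl HEq.rfl (eApp_comm α y)).trans ?_
  refine (S.leg_naturality₂ η).trans ?_
  refine HEq.trans ?_ (whiskerRight_heq (Q.F.map_comp _ _) (Q.F.map_comp _ _)
    (map₂_whiskerLeft_heq Q.F _ _) _).symm
  refine HEq.trans ?_ (whisker_assoc_heq _ _ _).symm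
  refine HEq.trans ?_ (whiskerLeft_heq (T.leg_naturality _) (T.leg_naturality _)
    (T.leg_naturality₂ η) _).symm
  refine HEq.trans ?_ (comp_whiskerLeft_heq _ _ _)
  exact whiskerLeft_heq_congr (eApp_comm α x).symm rfl rfl HEq.rfl

/-- The `2`-cell of lax triangles of an enriched transformation. -/
noncomputable def ofENatTrans : Hom₂ S T :=
  Hom₂.mk'
    { app := eApp α
      naturality := eApp_naturality α
      naturality₂ := eApp_naturality₂ α } (eApp_comm α)

theorem toENatTrans_ofENatTrans : (ofENatTrans α).toENatTrans = α :=
  ENatTrans.ext <| funext fun x =>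
    Tracks.cell_ext_hid (α.left_app x).symm (α.right_app x).symm
      ⟨_, _, (ofENatTrans α).tracks_cell x rfl, tracks_eApp α x⟩

end OfENatTrans

theorem toENatTrans_bijective (S T : Hom P Q) :
    Function.Bijective (fun σ : Hom₂ S T => σ.toENatTrans) := by
  refine ⟨fun σ τ e => Hom₂.ext_app fun x => ?_, fun α => ⟨ofENatTrans α, toENatTrans_ofENatTrans α⟩⟩
  have h₁ : σ.cell x = τ.cell x := congrFun (congrArg ENatTrans.app e) x
  have h₂ := σ.tracks_cell x rfl
  exact sigma_homEl_eq_iff.1 ((h₂.congr_cell h₁).unique (τ.tracks_cell x rfl))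

variable (K) in
theorem enrich_isLocallyBijective : IsLocallyBijective (enrich.{w, u, u₁} K) where
  map_bijective := toEFunctor_bijective
  map₂_bijective := toENatTrans_bijective

end LDF

end GenWood

/-! ### The total `2`-category of an enriched category -/

namespace GenWood

open CategoryTheory Bicategory Opposite WeakDoubleCategory

universe w v u u₁ u₂ h c w' v' u' w₁ v₁ w₂ v₂ w₃ v₃ u₃

section
variable {D : Type u} [WeakDoubleCategory.{v, u, h, c} D] {A C A' B B' C' : D}

/-- The lemmas of this section match the boundaries of the two sides of the unit and multiplication
axioms for the comparison functors `ECat.ofFibres` and `ECat.toFibres`. -/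
theorem left_globular_vcomp {U U' : Hor A C} {V : Hor A' C'} (G : Globular U U') (α : Cell U' V) :
    left (G.cell ≫ᵥ α) = left α := by
  simp

theorem right_globular_vcomp {U U' : Hor A C} {V : Hor A' C'} (G : Globular U U') (α : Cell U' V) :
    right (G.cell ≫ᵥ α) = right α := by
  simp

theorem left_hidMap_vcomp_globular {V : Hor A' A'} (f : A ⟶ A') (G : Globular (hid A') V) :
    left (hidMap f ≫ᵥ G.cell) = f := by
  simp

theorem right_hidMap_vcomp_globular {V : Hor A' A'} (f : A ⟶ A') (G : Globular (hid A') V) :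
    right (hidMap f ≫ᵥ G.cell) = f := by
  simp

variable {U : Hor A B} {V : Hor B C} {U' : Hor A' B'} {V' : Hor B' C'} {W : Hor A' C'}

theorem left_hcompMap_vcomp_globular (α : Cell U U') (β : Cell V V') (e)
    (G : Globular (hcomp U' V') W) : left (hcompMap α β e ≫ᵥ G.cell) = left α := by
  simp

theorem right_hcompMap_vcomp_globular (α : Cell U U') (β : Cell V V') (e)
    (G : Globular (hcomp U' V') W) : right (hcompMap α β e ≫ᵥ G.cell) = right β := by
  simp

end

variable {K : Type u} [Bicategory.{w, w} K] [Bicategory.Strict K]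

namespace ECat

/-- The objects of the total `2`-category of an enriched category. -/
structure Total (X : ECat.{w, u, u₁, w + 1, w} (DblPsh K)) where
  as : X.Ob

namespace Total
variable {X : ECat.{w, u, u₁, w + 1, w} (DblPsh K)}

/-- The extent of an object, as an object of `K`. -/
abbrev base (x : Total X) : K := (X.extent x.as).as

/-- A `1`-cell of the total `2`-category: a `1`-cell of `K` with an element over it. -/
@[ext]
structure Hom (x y : Total X) where
  base : x.base ⟶ y.base
  elem : El (X.hom x.as y.as) base

theorem Hom.eq_of_sigma {x y : Total X} {f g : Hom x y}
    (e : (⟨f.base, f.elem⟩ : (u : x.base ⟶ y.base) × El (X.hom x.as y.as) u) =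
      ⟨g.base, g.elem⟩) : f = g :=
  Hom.ext (congrArg Sigma.fst e) (Sigma.mk.inj e).2

noncomputable instance : CategoryStruct (Total X) where
  Hom x y := Hom x y
  id x := ⟨𝟙 x.base, (Globular.hom (X.unit x.as)).app _ (elId _)⟩
  comp {x y z} f g := ⟨f.base ≫ g.base,
    (Globular.hom (X.mul x.as y.as z.as)).app _ (elPair f.elem g.elem)⟩

theorem tracks_unit (x : Total X) :
    Tracks (X.unit x.as).cell (elId (X.extent x.as)) (𝟙 x : x ⟶ x).elem :=
  Globular.tracks _ _

theorem tracks_mul {x y z : Total X} (f : x ⟶ y) (g : y ⟶ z) :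
    Tracks (X.mul x.as y.as z.as).cell (elPair f.elem g.elem) (f ≫ g).elem :=
  Globular.tracks _ _

/-- The two sides of the enriched unit axiom track the pair of the universal element and `f.elem` to
the elements of `𝟙 x ≫ f` and `f`. Uniqueness of tracked values turns the equation of cells into one
of `1`-cells, and the other two laws are obtained likewise. -/
theorem id_comp {x y : Total X} (f : x ⟶ y) : 𝟙 x ≫ f = f :=
  Hom.eq_of_sigma (((((tracks_unit x).hcompMap _ (Tracks.vid _ f.elem)).vcomp
    (tracks_mul (𝟙 x) f)).congr_cell (X.unit_mul x.as y.as)).unique (Tracks.lunit _ f.elem))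

theorem comp_id {x y : Total X} (f : x ⟶ y) : f ≫ 𝟙 y = f :=
  Hom.eq_of_sigma (((((Tracks.vid _ f.elem).hcompMap _ (tracks_unit y)).vcomp
    (tracks_mul f (𝟙 y))).congr_cell (X.mul_unit x.as y.as)).unique (Tracks.runit _ f.elem))

theorem assoc {x y z t : Total X} (f : x ⟶ y) (g : y ⟶ z) (k : z ⟶ t) :
    (f ≫ g) ≫ k = f ≫ g ≫ k :=
  Hom.eq_of_sigma (((((tracks_mul f g).hcompMap _ (Tracks.vid _ k.elem)).vcomp
    (tracks_mul (f ≫ g) k)).congr_cell (X.mul_assoc x.as y.as z.as t.as)).unique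
      ((Tracks.hassoc _ _ _ f.elem g.elem k.elem).vcomp
        (((Tracks.vid _ f.elem).hcompMap _ (tracks_mul g k)).vcomp (tracks_mul f (g ≫ k)))))

/-- A `2`-cell of the total `2`-category: a `2`-cell of `K` along which the elements restrict. -/
@[ext]
structure Hom₂ {x y : Total X} (f g : x ⟶ y) where
  base : f.base ⟶ g.base
  map_elem : (psh (X.hom x.as y.as)).map base.op g.elem = f.elem

instance homCategory (x y : Total X) : Category (x ⟶ y) where
  Hom f g := Hom₂ f g
  id f := ⟨𝟙 f.base, by simp⟩
  comp η θ := ⟨η.base ≫ θ.base, by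
    rw [op_comp, Functor.map_comp_apply, θ.map_elem, η.map_elem]⟩
  id_comp _ := Hom₂.ext (Category.id_comp _)
  comp_id _ := Hom₂.ext (Category.comp_id _)
  assoc _ _ _ := Hom₂.ext (Category.assoc _ _ _)

/-- Compatibility with elements is a property, so a `2`-cell is determined by its base. -/
theorem Hom₂.heq_of {x y : Total X} {f f' g g' : x ⟶ y} (η : Hom₂ f g) (θ : Hom₂ f' g')
    (hf : f = f') (hg : g = g') (H : HEq η.base θ.base) : HEq η θ := by
  subst hf hg
  exact heq_of_eq (Hom₂.ext (eq_of_heq H))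

/-- That the whiskered `2`-cell restricts the composite elements correctly is naturality of the
composition map of presheaves combined with the coend relation `pair_map_right`. -/
noncomputable def whiskerLeft {x y z : Total X} (f : x ⟶ y) {g k : y ⟶ z} (η : g ⟶ k) :
    f ≫ g ⟶ f ≫ k :=
  Hom₂.mk (f.base ◁ η.base) <| by
    change (psh (X.hom x.as z.as)).map _ ((Globular.hom _).app _ (elPair _ _)) =
      (Globular.hom _).app _ (elPair _ _)
    rw [← NatTrans.naturality_apply, ← η.map_elem]
    exact congrArg _ (pair_map_right _ _ _).symm

noncomputable def whiskerRight {x y z : Total X} {f g : x ⟶ y} (η : f ⟶ g) (k : y ⟶ z) :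
    f ≫ k ⟶ g ≫ k :=
  Hom₂.mk (η.base ▷ k.base) <| by
    change (psh (X.hom x.as z.as)).map _ ((Globular.hom _).app _ (elPair _ _)) =
      (Globular.hom _).app _ (elPair _ _)
    rw [← NatTrans.naturality_apply, ← η.map_elem]
    exact congrArg _ (pair_map_left _ _ _).symm

/-- Every law for `2`-cells is inherited from `K`, since `2`-cells are determined by their bases. -/
noncomputable instance : Bicategory (Total X) :=
  mkStrict _ id_comp comp_id assoc whiskerLeft whiskerRight
    (fun _ _ => Hom₂.ext (Bicategory.whiskerLeft_id _ _))
    (fun _ _ _ _ _ _ => Hom₂.ext (Bicategory.whiskerLeft_comp _ _ _))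
    (fun _ _ => Hom₂.ext (Bicategory.id_whiskerRight _ _))
    (fun _ _ _ => Hom₂.ext (Bicategory.comp_whiskerRight _ _ _))
    (fun _ _ => Hom₂.ext (Bicategory.whisker_exchange _ _))
    (fun _ => Hom₂.heq_of _ _ (id_comp _) (id_comp _) (id_whiskerLeft_heq _))
    (fun _ _ _ _ _ => Hom₂.heq_of _ _ (assoc _ _ _) (assoc _ _ _) (comp_whiskerLeft_heq _ _ _))
    (fun _ => Hom₂.heq_of _ _ (comp_id _) (comp_id _) (whiskerRight_id_heq _))
    (fun _ _ _ => Hom₂.heq_of _ _ (assoc _ _ _).symm (assoc _ _ _).symm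
      (whiskerRight_comp_heq _ _ _))
    (fun _ _ _ _ _ => Hom₂.heq_of _ _ (assoc _ _ _) (assoc _ _ _) (whisker_assoc_heq _ _ _))

instance : Bicategory.Strict (Total X) where
  id_comp := id_comp
  comp_id := comp_id
  assoc := assoc

variable (X) in
/-- The projection of the total `2`-category to `K`. -/
noncomputable def proj : StrictPseudofunctor (Total X) K :=
  StrictPseudofunctor.mk''
    { obj := base
      map := fun f => Hom.base f
      map₂ := fun η => Hom₂.base η
      map₂_id := fun _ => rfl
      map₂_comp := fun _ _ => rfl
      map_id := fun _ => rfl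
      map_comp := fun _ _ => rfl
      map₂_whisker_left := fun _ _ _ _ => eq_conj_of_heq _ _ HEq.rfl
      map₂_whisker_right := fun _ _ => eq_conj_of_heq _ _ HEq.rfl }

/-- The lift of `φ` at `f` has as domain the restriction of `f.elem` along `φ`. It is unique because
the definition of a `2`-cell forces the element of its domain to be that restriction. -/
theorem isDiscreteFibration_proj (x y : Total X) :
    IsDiscreteFibration ((proj X).mapFunctor x y) := by
  intro f u φ
  refine ⟨⟨⟨u, (psh (X.hom x.as y.as)).map φ.op f.elem⟩, ⟨φ, rfl⟩⟩, rfl, ?_⟩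
  rintro ⟨⟨v, a⟩, ψ, h⟩ e
  change (⟨v, ψ⟩ : (v : x.base ⟶ y.base) × (v ⟶ f.base)) = ⟨u, φ⟩ at e
  cases e
  obtain rfl : (psh (X.hom x.as y.as)).map φ.op f.elem = a := h
  rfl

end Total

/-! ### Every enriched category is isomorphic to one of fibres -/

variable (X : ECat.{w, u, u₁, w + 1, w} (DblPsh K))

/-- The local discrete fibration of an enriched category. -/
noncomputable def toLDF : LDF.{w, u, u₁} K where
  C := Total X
  F := Total.proj X
  isDiscreteFibration := Total.isDiscreteFibration_proj

section
variable {X} {x y : Total X}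

theorem fib_map_total {u v : x.base ⟶ y.base} (φ : v ⟶ u) (a : El (X.hom x.as y.as) u) :
    (X.toLDF.fib x y).map φ.op (LDF.el (P := X.toLDF) (⟨u, a⟩ : Total.Hom x y) rfl) =
      LDF.el (P := X.toLDF) (⟨v, (psh (X.hom x.as y.as)).map φ.op a⟩ : Total.Hom x y) rfl :=
  LDF.fib_map_el (P := X.toLDF) (x := x) (y := y) (⟨φ, rfl⟩ : Total.Hom₂ _ _) HEq.rfl

/-- A point of the fibre over `u` is a `1`-cell `⟨v, a⟩` with a proof of `v = u`. Eliminating that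
equation leaves exactly the elements of the hom of `X` over `u`. -/
theorem fib_cases {u : x.base ⟶ y.base} {p : (X.toLDF.fib x y).obj (op u) → Prop}
    (H : ∀ a : El (X.hom x.as y.as) u,
      p (LDF.el (P := X.toLDF) (⟨u, a⟩ : Total.Hom x y) rfl)) (b) : p b := by
  obtain ⟨⟨v, a⟩, h, rfl⟩ := LDF.el_surjective b
  obtain rfl : v = u := h
  exact H a

/-- The element of the hom of the enriched category given by an element of a fibre. -/
def elemOfFib {u : x.base ⟶ y.base} (b : (X.toLDF.fib x y).obj (op u)) : El (X.hom x.as y.as) u :=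
  (psh (X.hom x.as y.as)).map
    (eqToHom (show u = (b.1 : Total.Hom x y).base from b.2.symm)).op (b.1 : Total.Hom x y).elem

theorem elemOfFib_el {u : x.base ⟶ y.base} (a : El (X.hom x.as y.as) u) :
    elemOfFib (LDF.el (P := X.toLDF) (⟨u, a⟩ : Total.Hom x y) rfl) = a := by
  change (psh (X.hom x.as y.as)).map (𝟙 _) a = a
  simp

variable (x y)

/-- The homs of an enriched category are the fibres of its total `2`-category. -/
noncomputable def homToFib : psh (X.hom x.as y.as) ⟶ X.toLDF.fib x y where
  app u := ↾(fun a => LDF.el (P := X.toLDF) (⟨u.unop, a⟩ : Total.Hom x y) rfl)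
  naturality _ _ φ := by
    refine ConcreteCategory.hom_ext _ _ fun a => ?_
    exact (fib_map_total φ.unop a).symm

/-- The fibres of the total `2`-category are the homs of the enriched category. -/
noncomputable def fibToHom : X.toLDF.fib x y ⟶ psh (X.hom x.as y.as) where
  app u := ↾(elemOfFib (u := u.unop))
  naturality u v φ := by
    refine ConcreteCategory.hom_ext _ _ fun b => ?_
    refine fib_cases (p := fun b => _ = _) (fun a => ?_) b
    change elemOfFib ((X.toLDF.fib x y).map φ.unop.op _) =
      (psh (X.hom x.as y.as)).map φ (elemOfFib _)
    exact (congrArg elemOfFib (fib_map_total φ.unop a)).trans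
      ((elemOfFib_el _).trans (congrArg _ (elemOfFib_el a).symm))

end

section
variable {X}

/-- `homToFib` as a cell of `ℙK`. -/
noncomputable def cellToFib (x y : X.Ob) : Cell (X.hom x y) (X.toLDF.toECat.hom ⟨x⟩ ⟨y⟩) :=
  globCell (U := X.hom x y) (V := X.toLDF.toECat.hom ⟨x⟩ ⟨y⟩) (homToFib ⟨x⟩ ⟨y⟩)

/-- `fibToHom` as a cell of `ℙK`. -/
noncomputable def cellToHom (x y : Total X) : Cell (X.toLDF.toECat.hom x y) (X.hom x.as y.as) :=
  globCell (U := X.toLDF.toECat.hom x y) (V := X.hom x.as y.as) (fibToHom x y)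

/-- The two comparison cells pass between a `1`-cell of the total `2`-category and its element.
Allowing any `u` equal to `f.base` makes their values composable with those of other cells. -/
theorem tracks_cellToFib {x y : Total X} (f : x ⟶ y) {u : x.base ⟶ y.base} (h : f.base = u) :
    Tracks (cellToFib x.as y.as) f.elem (LDF.homEl (P := X.toLDF) f h) := by
  subst h
  exact Tracks.globCell _ _

theorem tracks_cellToHom {x y : Total X} (f : x ⟶ y) {u : x.base ⟶ y.base} (h : f.base = u) :
    Tracks (cellToHom x y) (LDF.homEl (P := X.toLDF) f h) f.elem := by
  subst h
  exact (Tracks.globCell (U := X.toLDF.toECat.hom x y) (V := X.hom x.as y.as) (fibToHom x y)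
    _).of_eq (elemOfFib_el f.elem)

end

/-- The comparison from the enriched category of fibres of the total `2`-category. -/
noncomputable def ofFibres : EFunctor X.toLDF.toECat X where
  obj x := x.as
  vert x := 𝟙 (X.extent x.as)
  map x y := cellToHom x y
  left_map _ _ := rfl
  right_map _ _ := rfl
  map_unit x := by
    refine Tracks.cell_ext_hid ?_ ?_ ⟨_, _, (LDF.tracks_unit (P := X.toLDF) x rfl).vcomp
      (tracks_cellToHom (CategoryStruct.id (obj := Total X) x) rfl), (Tracks.hidMap _).vcomp (Total.tracks_unit x)⟩
    · exact (left_globular_vcomp _ _).trans (left_hidMap_vcomp_globular _ _).symm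
    · exact (right_globular_vcomp _ _).trans (right_hidMap_vcomp_globular _ _).symm
  map_mul x y z := by
    refine Tracks.cell_ext_hcomp ?_ ?_ fun u a v b => ?_
    · refine (left_globular_vcomp _ _).trans
        (Eq.trans ?_ (left_hcompMap_vcomp_globular _ _ _ _).symm)
      rfl
    · refine (right_globular_vcomp _ _).trans
        (Eq.trans ?_ (right_hcompMap_vcomp_globular _ _ _ _).symm)
      rfl
    obtain ⟨f, h, rfl⟩ := LDF.homEl_surjective (P := X.toLDF) a
    obtain ⟨g, h', rfl⟩ := LDF.homEl_surjective (P := X.toLDF) b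
    exact ⟨_, _, (LDF.tracks_mul (P := X.toLDF) h h' rfl rfl).vcomp
      (tracks_cellToHom (x := x) (y := z) (f ≫ g) rfl),
      ((tracks_cellToHom (x := x) (y := y) f h).hcompMap _
        (tracks_cellToHom (x := y) (y := z) g h')).vcomp (Total.tracks_mul _ _)⟩

/-- The comparison to the enriched category of fibres of the total `2`-category. -/
noncomputable def toFibres : EFunctor X X.toLDF.toECat where
  obj x := (⟨x⟩ : Total X)
  vert x := 𝟙 (X.extent x)
  map x y := cellToFib x y
  left_map _ _ := rfl
  right_map _ _ := rfl
  map_unit x := by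
    refine Tracks.cell_ext_hid ?_ ?_ ⟨_, _, (Total.tracks_unit ⟨x⟩).vcomp
      (tracks_cellToFib (𝟙 (⟨x⟩ : Total X)) rfl),
      (Tracks.hidMap _).vcomp (LDF.tracks_unit (P := X.toLDF) (⟨x⟩ : Total X) rfl)⟩
    · exact (left_globular_vcomp _ _).trans (left_hidMap_vcomp_globular _ _).symm
    · exact (right_globular_vcomp _ _).trans (right_hidMap_vcomp_globular _ _).symm
  map_mul x y z := by
    refine Tracks.cell_ext_hcomp ?_ ?_ fun u a v b => ?_
    · refine (left_globular_vcomp _ _).trans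
        (Eq.trans ?_ (left_hcompMap_vcomp_globular _ _ _ _).symm)
      rfl
    · refine (right_globular_vcomp _ _).trans
        (Eq.trans ?_ (right_hcompMap_vcomp_globular _ _ _ _).symm)
      rfl
    let f : (⟨x⟩ : Total X) ⟶ ⟨y⟩ := ⟨u, a⟩
    let g : (⟨y⟩ : Total X) ⟶ ⟨z⟩ := ⟨v, b⟩
    exact ⟨_, _, (Total.tracks_mul f g).vcomp (tracks_cellToFib (f ≫ g) rfl),
      ((tracks_cellToFib f rfl).hcompMap _ (tracks_cellToFib g rfl)).vcomp
        (LDF.tracks_mul (P := X.toLDF) rfl rfl rfl rfl)⟩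

/-- The comparisons have identity legs and act on elements in mutually inverse ways, so the
composite is recognised on elements. They are isomorphisms rather than identities because a point of
a fibre also records a proof that its base is the given `1`-cell. -/
theorem ofFibres_comp_toFibres : X.ofFibres.comp X.toFibres = EFunctor.id X.toLDF.toECat := by
  refine EFunctor.ext' (fun _ => rfl) (fun x => heq_of_eq (Category.comp_id (𝟙 _)))
    fun x y => heq_of_eq ?_
  refine Tracks.cell_ext
    ((EFunctor.left_map (X.ofFibres.comp X.toFibres) x y).trans ((Category.comp_id (𝟙 (X.extent x.as))).trans
      (EFunctor.left_map (EFunctor.id X.toLDF.toECat) x y).symm))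
    ((EFunctor.right_map (X.ofFibres.comp X.toFibres) x y).trans ((Category.comp_id (𝟙 (X.extent y.as))).trans
      (EFunctor.right_map (EFunctor.id X.toLDF.toECat) x y).symm)) fun u b => ?_
  obtain ⟨f, h, rfl⟩ := LDF.homEl_surjective (P := X.toLDF) b
  exact ⟨_, _, (tracks_cellToHom (x := x) (y := y) f h).vcomp (tracks_cellToFib _ h),
    Tracks.vid _ _⟩

theorem toFibres_comp_ofFibres : X.toFibres.comp X.ofFibres = EFunctor.id X := by
  refine EFunctor.ext' (fun _ => rfl) (fun x => heq_of_eq (Category.comp_id (𝟙 _)))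
    fun x y => heq_of_eq ?_
  refine Tracks.cell_ext
    ((EFunctor.left_map (X.toFibres.comp X.ofFibres) x y).trans ((Category.comp_id (𝟙 (X.extent x))).trans
      (EFunctor.left_map (EFunctor.id X) x y).symm))
    ((EFunctor.right_map (X.toFibres.comp X.ofFibres) x y).trans ((Category.comp_id (𝟙 (X.extent y))).trans
      (EFunctor.right_map (EFunctor.id X) x y).symm)) fun u a => ?_
  let f : (⟨x⟩ : Total X) ⟶ ⟨y⟩ := ⟨u, a⟩
  exact ⟨_, _, (tracks_cellToFib f rfl).vcomp (tracks_cellToHom f rfl), Tracks.vid _ _⟩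

end ECat

variable (K) in
/-- Each enriched category is isomorphic to that of a local discrete fibration. -/
noncomputable def LDF.enrichReplacement : Replacement (LDF.enrich.{w, u, u₁} K) where
  obj X := X.toLDF
  hom X := X.ofFibres
  inv X := X.toFibres
  hom_inv_id X := X.ofFibres_comp_toFibres
  inv_hom_id X := X.toFibres_comp_ofFibres

end GenWood

universe w u u₁

theorem mainTheorem4 (K : Type u) [CategoryTheory.Bicategory.{w, w} K]
    [CategoryTheory.Bicategory.Strict K] :
    Nonempty (GenWood.TwoEquivalence (GenWood.ECat.{w, u, u₁, w + 1, w} (GenWood.DblPsh K))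
      (GenWood.LDF.{w, u, u₁} K)) := by
  -- `Replacement.twoEquivalence` is oriented from the codomain of the given `2`-functor to its
  -- domain, so `LDF.enrich` appears as the backward direction.
  exact ⟨(GenWood.LDF.enrichReplacement K).twoEquivalence
    (GenWood.LDF.enrich_isLocallyBijective K)⟩
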